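/- **Setup.** For each sample size $n$ there are units $i=1,\dots,n$. Unit $i$ has latent characteristics $(\theta_i,u_i,\sigma_i^2,(\epsilon_{i,j})_{j\ge1})$ and a number of measurements $J_i$. For each $n$ the tuples $(\theta_i,u_i,\sigma_i^2,(\epsilon_{i,j})_j,J_i)$, $i\le n$, are i.i.d.; the law of $(\theta_i,u_i,\sigma_i^2,(\epsilon_{i,j})_j)$ does not depend on $n$, while the law of $J_i$ may depend on $n$. One observes $Y_i=\alpha+\beta\theta_i+u_i$ and $X_{i,j}=\theta_i+\epsilon_{i,j}$ for $j=1,\dots,J_i$. Assume $\mathrm{Var}(\theta_i)>0$. **Assumption 1.** (1) $J_i$ is independent of $(\theta_i,u_i,\sigma_i^2,(\epsilon_{i,j})_j)$ and $J_i\ge3$ a.s. (2) $E[u_i]=0$, $E[u_i\theta_i]=0$, $E[Y_i^4]<\infty$. (3) Conditionally on $\sigma_i^2$ the $\epsilon_{i,j}$ are independent across $j$, with $E[\epsilon_{i,j}\mid\sigma_i^2]=0$, $E[\epsilon_{i,j}^2\mid\sigma_i^2]=\sigma_i^2$, and $E[|\epsilon_{i,j}|^L\mid\sigma_i^2]\le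 K\sigma_i^L$ for some constants $L\ge3$ and $K$, where $E|\epsilon_{i,j}|^L<\infty$; and $(\epsilon_{i,j})_j$ is independent of $\theta_i$. (4) $u_i$ and $(\epsilon_{i,j})_j$ are conditionally independent given $\theta_i$. (5) $E[\theta_i^4]<\infty$. (6) $E[\sigma_i^{16}]<\infty$. (7) $\sqrt n\,E[J_i^{-1}]\to\kappa\in[0,\infty)$. (8) $\sqrt n\,E[J_i^{-2}]\to0$. **Assumption 2.** (1) $E[u_i]=0$, $E[u_i\theta_i]=0$, and $E|\theta_i^{k_1}u_i^{k_2}|<\infty$ for all integers $1\le k_1\le8$, $1\le k_2\le4$. (2) $E[\theta_i^8]<\infty$. **Estimators.** Let $\bar X_i=J_i^{-1}\sum_{j\le J_i}X_{i,j}$, $\bar X=n^{-1}\sum_{i\le n}\bar X_i$, $\hat\sigma_i^2=(J_i-1)^{-1}\sum_{j\le J_i}(X_{i,j}-\bar X_i)^2$, $$\hat V=\frac1n\sum_{k=1}^n(\bar X_k-\bar X)^2-\frac{n-1}{n^2}\sum_{k=1}^n\frac{\hat\sigma_k^2}{J_k},\qquad w_i=\frac{\hat V}{\hat\sigma_i^2/J_i+\hat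 V},\qquad \hat\theta_{i,\mathrm{HE}}=w_i\bar X_i+(1-w_i)\bar X .$$ Let $\hat\alpha,\hat\beta_{\mathrm{HE}}$ be the OLS intercept and slope in the regression of $Y_i$ on $\hat\theta_{i,\mathrm{HE}}$ and a constant, $\hat u_i=Y_i-\hat\alpha-\hat\beta_{\mathrm{HE}}\hat\theta_{i,\mathrm{HE}}$ the residuals, $\bar{\hat\theta}=n^{-1}\sum_i\hat\theta_{i,\mathrm{HE}}$, and $$\hat\Omega=\frac{\frac1n\sum_{i=1}^n(\hat\theta_{i,\mathrm{HE}}-\bar{\hat\theta})^2\hat u_i^2}{\big(\frac1n\sum_{i=1}^n(\hat\theta_{i,\mathrm{HE}}-\bar{\hat\theta})^2\big)^2}$$ the Eicker–Huber–White variance estimator. **Theorem.** Under Assumptions 1 and 2, as $n\to\infty$, $$\hat\Omega\;\to_p\;\frac{E\big[u_i^2(\theta_i-E\theta_i)^2\big]}{\mathrm{Var}(\theta_i)^2}.$$ If moreover $E[u_i^2(\theta_i-E\theta_i)^2]>0$, then the conventional OLS confidence intervals have asymptotically nominal coverage: for every $a\in(0,1)$, with $z_{1-a/2}$ the $(1-a/2)$-quantile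 of the standard normal distribution, $$\Pr\Big(\beta\in\big[\hat\beta_{\mathrm{HE}}-z_{1-a/2}\sqrt{\hat\Omega/n},\ \hat\beta_{\mathrm{HE}}+z_{1-a/2}\sqrt{\hat\Omega/n}\,\big]\Big)\to1-a .$$ -/

import Mathlib

open MeasureTheory ProbabilityTheory Filter Topology

noncomputable section

namespace Shrinkage

/-! ### Estimators, as functions of the data

`J i` is the number of measurements of unit `i`, `X i j` (for `j < J i`) are the measurements,
and `Y i` is the outcome. -/

/-- The sample mean `n⁻¹ ∑ᵢ xᵢ`. -/
def sampleMean {n : ℕ} (x : Fin n → ℝ) : ℝ := (∑ i, x i) / n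

/-- The individual mean `X̄ᵢ` of the first `J` measurements of one unit. -/
def unitMean (J : ℕ) (x : ℕ → ℝ) : ℝ := (∑ j ∈ Finset.range J, x j) / J

/-- The individual noise variance estimator `σ̂ᵢ²`. -/
def unitVar (J : ℕ) (x : ℕ → ℝ) : ℝ :=
  (∑ j ∈ Finset.range J, (x j - unitMean J x) ^ 2) / ((J : ℝ) - 1)

/-- The grand mean `X̄ = n⁻¹ ∑ᵢ X̄ᵢ`. -/
def grandMean {n : ℕ} (J : Fin n → ℕ) (X : Fin n → ℕ → ℝ) : ℝ :=
  sampleMean fun i => unitMean (J i) (X i)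

/-- The estimator `V̂` of `Var(θᵢ)`. -/
def VHat {n : ℕ} (J : Fin n → ℕ) (X : Fin n → ℕ → ℝ) : ℝ :=
  (1 / (n : ℝ)) * ∑ k, (unitMean (J k) (X k) - grandMean J X) ^ 2
    - (((n : ℝ) - 1) / (n : ℝ) ^ 2) * ∑ k, (1 / (J k : ℝ)) * unitVar (J k) (X k)

/-- The heteroskedastic individual weight `w_{i,HE}`. -/
def weightHE {n : ℕ} (J : Fin n → ℕ) (X : Fin n → ℕ → ℝ) (i : Fin n) : ℝ :=
  VHat J X / ((1 / (J i : ℝ)) * unitVar (J i) (X i) + VHat J X)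

/-- The heteroskedastic individual-weight shrinkage estimator `θ̂_{i,HE}`. -/
def thetaHE {n : ℕ} (J : Fin n → ℕ) (X : Fin n → ℕ → ℝ) (i : Fin n) : ℝ :=
  weightHE J X i * unitMean (J i) (X i) + (1 - weightHE J X i) * grandMean J X

/-- The slope `β̂` of the OLS regression of `y` on `x` and a constant. -/
def olsSlope {n : ℕ} (x y : Fin n → ℝ) : ℝ :=
  (∑ i, (x i - sampleMean x) * (y i - sampleMean y)) / ∑ i, (x i - sampleMean x) ^ 2

/-- The intercept `α̂` of the OLS regression of `y` on `x` and a constant. -/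
def olsIntercept {n : ℕ} (x y : Fin n → ℝ) : ℝ :=
  sampleMean y - olsSlope x y * sampleMean x

/-- The OLS residual `ûᵢ`. -/
def olsResidual {n : ℕ} (x y : Fin n → ℝ) (i : Fin n) : ℝ :=
  y i - olsIntercept x y - olsSlope x y * x i

/-- The Eicker–Huber–White variance estimator `Ω̂` in the regression of `y` on `x`. -/
def ehwVariance {n : ℕ} (x y : Fin n → ℝ) : ℝ :=
  ((1 / (n : ℝ)) * ∑ i, (x i - sampleMean x) ^ 2 * olsResidual x y i ^ 2) /
    ((1 / (n : ℝ)) * ∑ i, (x i - sampleMean x) ^ 2) ^ 2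

/-- The `p`-quantile of the standard normal distribution. -/
def normalQuantile (p : ℝ) : ℝ := sInf {x : ℝ | p ≤ cdf (gaussianReal 0 1) x}

/-- The conventional OLS confidence interval `β̂ ± z_{1-a/2} √(Ω̂/n)` of level `1 - a`. -/
def olsConfInterval {n : ℕ} (a : ℝ) (x y : Fin n → ℝ) : Set ℝ :=
  Set.Icc (olsSlope x y - normalQuantile (1 - a / 2) * √(ehwVariance x y / n))
    (olsSlope x y + normalQuantile (1 - a / 2) * √(ehwVariance x y / n))

/-! ### The model -/

/-- The latent characteristics `(θᵢ, uᵢ, σᵢ², (ε_{i,j})_j)` of one unit. Only the noise terms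
`ε_{i,j}` with `j < Jᵢ` enter the data. -/
abbrev Latent : Type := ℝ × ℝ × ℝ × (ℕ → ℝ)

/-- The individual effect `θᵢ`. -/
def Latent.theta (z : Latent) : ℝ := z.1

/-- The regression error `uᵢ`. -/
def Latent.u (z : Latent) : ℝ := z.2.1

/-- The noise variance `σᵢ²`. -/
def Latent.sigmaSq (z : Latent) : ℝ := z.2.2.1

/-- The noise sequence `(ε_{i,j})_j`. -/
def Latent.eps (z : Latent) : ℕ → ℝ := z.2.2.2

/-- The measurement `X_{i,j} = θᵢ + ε_{i,j}`. -/
def Latent.X (z : Latent) (j : ℕ) : ℝ := z.theta + z.eps j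

/-- The outcome `Yᵢ = α + β θᵢ + uᵢ`. -/
def Latent.Y (α β : ℝ) (z : Latent) : ℝ := α + β * z.theta + z.u

lemma Latent.measurable_theta : Measurable Latent.theta := measurable_fst

lemma Latent.measurable_sigmaSq : Measurable Latent.sigmaSq :=
  measurable_fst.comp (measurable_snd.comp measurable_snd)

/-- The σ-algebra generated by `θᵢ`. -/
abbrev sigmaAlgTheta : MeasurableSpace Latent :=
  MeasurableSpace.comap Latent.theta inferInstance

/-- The σ-algebra generated by `σᵢ²`. -/
abbrev sigmaAlgSigmaSq : MeasurableSpace Latent :=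
  MeasurableSpace.comap Latent.sigmaSq inferInstance

/-- Random sampling: for every sample size `n`, the `n` units `(Z n i, J n i)` are independent
over `i`; the latent characteristics of each unit have the fixed law `Q`, and its number of
measurements has the law `R n`, which may change with `n`. -/
structure IsRandomSample {Ω : Type*} [MeasurableSpace Ω] (P : Measure Ω)
    (Z : (n : ℕ) → Fin n → Ω → Latent) (J : (n : ℕ) → Fin n → Ω → ℕ)
    (Q : Measure Latent) (R : ℕ → Measure ℕ) : Prop where
  measurable_latent : ∀ n i, Measurable (Z n i)
  measurable_J : ∀ n i, Measurable (J n i)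
  law_latent : ∀ n i, P.map (Z n i) = Q
  law_J : ∀ n i, P.map (J n i) = R n
  indep_units : ∀ n, iIndepFun (fun (i : Fin n) (ω : Ω) => (Z n i ω, J n i ω)) P

/-- Assumption 1. Expectations over a generic unit are integrals against `Q` and `R n`. -/
structure Assumption1 {Ω : Type*} [MeasurableSpace Ω] (P : Measure Ω)
    (Z : (n : ℕ) → Fin n → Ω → Latent) (J : (n : ℕ) → Fin n → Ω → ℕ)
    (Q : Measure Latent) [IsProbabilityMeasure Q] (R : ℕ → Measure ℕ) (α β κ : ℝ) : Prop where
  -- 1. `Jᵢ` is independent of `(θᵢ, uᵢ, σᵢ², ε_{i,·})`, and `Jᵢ ≥ 3` a.s.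
  indep_J : ∀ n i, IndepFun (J n i) (Z n i) P
  three_le_J : ∀ n i, ∀ᵐ ω ∂P, 3 ≤ J n i ω
  -- 2. exogeneity and the moment of the outcome
  mean_u : ∫ z, z.u ∂Q = 0
  mean_u_theta : ∫ z, z.u * z.theta ∂Q = 0
  moment_Y : Integrable (fun z : Latent => z.Y α β ^ 4) Q
  -- 3. the noise: independent over `j` given `σᵢ²`, conditional moments, independent of `θᵢ`
  condIndep_eps : iCondIndepFun sigmaAlgSigmaSq Latent.measurable_sigmaSq.comap_le
    (fun (j : ℕ) (z : Latent) => z.eps j) Q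
  condMean_eps : ∀ j, Q[fun z : Latent => z.eps j | sigmaAlgSigmaSq] =ᵐ[Q] 0
  condVar_eps : ∀ j, Q[fun z : Latent => z.eps j ^ 2 | sigmaAlgSigmaSq] =ᵐ[Q] Latent.sigmaSq
  condMoment_eps : ∃ L : ℝ, 3 ≤ L ∧ ∃ K : ℝ, ∀ j,
    Integrable (fun z : Latent => |z.eps j| ^ L) Q ∧
    Q[fun z : Latent => |z.eps j| ^ L | sigmaAlgSigmaSq] ≤ᵐ[Q] fun z => K * √z.sigmaSq ^ L
  indep_eps_theta : IndepFun Latent.eps Latent.theta Q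
  -- 4. `uᵢ` and `ε_{i,·}` are independent given `θᵢ`
  condIndep_u_eps : CondIndepFun sigmaAlgTheta Latent.measurable_theta.comap_le
    Latent.u Latent.eps Q
  -- 5. and 6. moments of `θᵢ` and `σᵢ`
  moment_theta : Integrable (fun z : Latent => z.theta ^ 4) Q
  moment_sigma : Integrable (fun z : Latent => √z.sigmaSq ^ 16) Q
  -- 7. and 8. the asymptotic framework
  kappa_nonneg : 0 ≤ κ
  tendsto_inv_J : Tendsto (fun n : ℕ => √(n : ℝ) * ∫ j, (1 / (j : ℝ)) ∂(R n)) atTop (𝓝 κ)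
  tendsto_inv_J_sq : Tendsto (fun n : ℕ => √(n : ℝ) * ∫ j, (1 / (j : ℝ) ^ 2) ∂(R n)) atTop (𝓝 0)

/-- Assumption 2: stronger moment conditions. -/
structure Assumption2 (Q : Measure Latent) : Prop where
  mean_u : ∫ z, z.u ∂Q = 0
  mean_u_theta : ∫ z, z.u * z.theta ∂Q = 0
  moment_theta_u : ∀ k₁ k₂ : ℕ, 1 ≤ k₁ → k₁ ≤ 8 → 1 ≤ k₂ → k₂ ≤ 4 →
    Integrable (fun z : Latent => |z.theta ^ k₁ * z.u ^ k₂|) Q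
  moment_theta : Integrable (fun z : Latent => z.theta ^ 8) Q

/-- The regressors `θ̂_{i,HE}`, `i < n`, in the sample of size `n`. -/
def regressorHE {Ω : Type*} (Z : (n : ℕ) → Fin n → Ω → Latent) (J : (n : ℕ) → Fin n → Ω → ℕ)
    (n : ℕ) (ω : Ω) : Fin n → ℝ :=
  thetaHE (fun i => J n i ω) fun i => (Z n i ω).X

/-- The outcomes `Yᵢ`, `i < n`, in the sample of size `n`. -/
def outcome {Ω : Type*} (α β : ℝ) (Z : (n : ℕ) → Fin n → Ω → Latent)
    (n : ℕ) (ω : Ω) : Fin n → ℝ :=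
  fun i => (Z n i ω).Y α β

/-- `E[uᵢ² (θᵢ - E θᵢ)²]`. -/
def scoreVariance (Q : Measure Latent) : ℝ :=
  ∫ z, z.u ^ 2 * (z.theta - ∫ z', z'.theta ∂Q) ^ 2 ∂Q

end Shrinkage

end

/-! Notation: t = θ − Eθ, e is the mean noise of a unit, s = σ̂²/J its estimated variance, c the
grand mean minus Eθ, V = Var θ with estimate V̂, and b = s/(s + V̂) = 1 − w. Up to the grand mean
the regressor is h = (1 − b)(t + e − c), and Y = α + β θ̂ + g with g = u + β(b(t + e − c) − e). The
slope error is the average of (h − h̄)g divided by the variance of h.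

Why there is no bias. Measurement error contributes terms of order 1/J, and √n E[1/J] may have a
positive limit κ, so these terms must cancel. In h·(b(t + e − c) − e) they are b t² − e², apart from
products with a mean-zero independent factor. Put b' = s/(s + V). Since V b' = s − s b', one has b'
t² − e² = b'(t² − V) − (e² − s) − s b'. The first term is a centered factor times a small
independent one, the second is centered because s estimates the variance of e without bias, and the
third has order s√s. Hence √n times the average score equals √n times the average of t u, up to
o_p(1): `abs_score_sub_le` for one unit, `ArrayLimits.tendsto_score` for the sample.

The remainder consists of the third-order noise s√s + |e|³ and of (|V − V̂| + |c| + c²)s, both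
weighted by 1 + t⁴ + u⁴. The second part is a null factor times a quantity of order √n E[1/J]. For
the first part, E[s√s + |e|³] = O(m^{-3/2}) for a unit with m measurements
(`NoiseModel.exists_moment_bounds`), and √n E[J^{-3/2}] → 0 by interpolating between E[1/J] and
E[1/J²] (`tendsto_inv_J_three_halves`). Third moments of ε suffice because e² − s is a degenerate
U-statistic, whose second moment involves only variances, while s√s is handled by Lyapunov's
inequality. All these expectations factor because ε is independent of (θ, u) jointly
(`indepFun_theta_u_eps`).

For Ω̂, the centered regressor and the residual approximate t and u in empirical fourth mean, so the
numerator tends to E[t²u²]. Coverage follows from the central limit theorem for t u, Slutsky's lemma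
and the portmanteau theorem.

Convergence in probability is encoded as convergence along the filter `whp P`, so that all Slutsky
arguments become limit algebra. `ArrayLimits` lists the stochastic orders that this algebra needs,
and `arrayLimits` derives them from the model. -/

noncomputable section

namespace Shrinkage

/-! ### Convergence in probability as convergence along a filter -/

section WithHighProbability

variable {Ω : Type*} [MeasurableSpace Ω]

/-- The filter of sequences of events whose probability tends to one. -/
def whp (P : Measure Ω) : Filter (ℕ × Ω) where
  sets := {A | Tendsto (fun n => P {ω | (n, ω) ∉ A}) atTop (𝓝 0)}
  univ_sets := by simp
  sets_of_superset {A B} hA hAB := by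
    refine tendsto_of_tendsto_of_tendsto_of_le_of_le tendsto_const_nhds hA
      (fun _ => zero_le) fun n => measure_mono fun ω hω h => hω (hAB h)
  inter_sets {A B} hA hB := by
    have h := Tendsto.add hA hB
    rw [add_zero] at h
    refine tendsto_of_tendsto_of_tendsto_of_le_of_le tendsto_const_nhds h
      (fun _ => zero_le) fun n => ?_
    refine (measure_mono ?_).trans (measure_union_le _ _)
    intro ω hω
    by_contra hc
    simp only [Set.mem_union, Set.mem_ofPred_eq, not_or, not_not] at hc
    exact hω ⟨hc.1, hc.2⟩

variable {P : Measure Ω}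

lemma eventually_whp {p : ℕ × Ω → Prop} :
    (∀ᶠ x in whp P, p x) ↔ Tendsto (fun n => P {ω | ¬ p (n, ω)}) atTop (𝓝 0) := Iff.rfl

lemma tendsto_fst_whp : Tendsto Prod.fst (whp P) atTop := by
  refine tendsto_atTop.2 fun N => eventually_whp.2 ?_
  refine tendsto_const_nhds.congr' ?_
  filter_upwards [eventually_ge_atTop N] with n hn
  simp [hn]

lemma eventually_whp_of_ae {p : ℕ × Ω → Prop} (h : ∀ n, ∀ᵐ ω ∂P, p (n, ω)) :
    ∀ᶠ x in whp P, p x :=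
  eventually_whp.2 <| tendsto_const_nhds.congr fun n => ((h n) : P _ = 0).symm

/-- The passage between the probabilistic statements and limits along `whp P`, where ordinary limit
algebra applies. -/
lemma tendstoInMeasure_iff_whp {f : ℕ → Ω → ℝ} {c : ℝ} :
    TendstoInMeasure P f atTop (fun _ => c) ↔
      Tendsto (fun x : ℕ × Ω => f x.1 x.2) (whp P) (𝓝 c) := by
  rw [tendstoInMeasure_iff_norm, Metric.tendsto_nhds]
  refine forall₂_congr fun ε _ => ?_
  rw [eventually_whp]
  simp [Real.dist_eq, Real.norm_eq_abs]

/-- A random sequence is bounded along `l` in the sense that its product with every null sequence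
is a null sequence. Along `whp P` this expresses stochastic boundedness. -/
def StochBdd {ι : Type*} (l : Filter ι) (X : ι → ℝ) : Prop :=
  ∀ a : ι → ℝ, Tendsto a l (𝓝 0) → Tendsto (fun p => a p * X p) l (𝓝 0)

namespace StochBdd

variable {ι : Type*} {l : Filter ι} {X Y : ι → ℝ}

lemma of_tendsto {c : ℝ} (h : Tendsto X l (𝓝 c)) : StochBdd l X := fun a ha => by
  simpa using ha.mul h

lemma const (c : ℝ) : StochBdd l fun _ => c := of_tendsto tendsto_const_nhds

lemma add (hX : StochBdd l X) (hY : StochBdd l Y) : StochBdd l fun p => X p + Y p := fun a ha => by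
  simpa [mul_add] using (hX a ha).add (hY a ha)

lemma mul (hX : StochBdd l X) (hY : StochBdd l Y) : StochBdd l fun p => X p * Y p := fun a ha => by
  simpa [mul_assoc] using hY _ (hX a ha)

lemma const_mul (hX : StochBdd l X) (c : ℝ) : StochBdd l fun p => c * X p := (const c).mul hX

lemma mono (hX : StochBdd l X) (h : ∀ᶠ p in l, |Y p| ≤ |X p|) : StochBdd l Y := fun a ha => by
  refine squeeze_zero_norm' ?_ (tendsto_zero_iff_abs_tendsto_zero _ |>.1 (hX a ha))
  filter_upwards [h] with p hp
  simp only [Function.comp, Real.norm_eq_abs, abs_mul]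
  gcongr

lemma mul_tendsto_zero (hX : StochBdd l X) (hY : Tendsto Y l (𝓝 0)) :
    Tendsto (fun p => X p * Y p) l (𝓝 0) := by
  simpa [mul_comm] using hX Y hY

lemma congr (hX : StochBdd l X) (h : ∀ᶠ p in l, Y p = X p) : StochBdd l Y :=
  hX.mono (h.mono fun p hp => by rw [hp])

end StochBdd

/-- Markov's inequality, with the bound `B n / ε` on the probability of a deviation. -/
lemma tendsto_whp_zero_of_integral_abs {X : ℕ → Ω → ℝ}
    (hm : ∀ᶠ n in atTop, Integrable (X n) P)
    {B : ℕ → ℝ} (hB : ∀ᶠ n in atTop, ∫ ω, |X n ω| ∂P ≤ B n)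
    (h : Tendsto B atTop (𝓝 0)) :
    Tendsto (fun x : ℕ × Ω => X x.1 x.2) (whp P) (𝓝 0) := by
  rw [Metric.tendsto_nhds]
  intro ε hε
  rw [eventually_whp]
  have h2 : Tendsto (fun n => ENNReal.ofReal (B n / ε)) atTop (𝓝 0) := by
    simpa [Function.comp_def] using (ENNReal.continuous_ofReal.tendsto _).comp (h.div_const ε)
  refine tendsto_of_tendsto_of_tendsto_of_le_of_le' tendsto_const_nhds h2
    (Eventually.of_forall fun _ => zero_le) ?_
  filter_upwards [hm, hB] with n hn hBn
  have h3 := mul_meas_ge_le_integral_of_nonneg (ae_of_all P fun ω => abs_nonneg (X n ω)) hn.abs ε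
  by_cases hfin : P {ω | ε ≤ |X n ω|} = ⊤
  · have := (hn.abs).measure_ge_lt_top hε
    exact absurd hfin this.ne
  · have h4 : {ω | ¬ dist (X n ω) 0 < ε} = {ω | ε ≤ |X n ω|} := by
      ext ω; simp
    show P {ω | ¬ dist (X n ω) 0 < ε} ≤ _
    rw [h4, ← ENNReal.ofReal_toReal hfin]
    refine ENNReal.ofReal_le_ofReal ?_
    rw [le_div_iff₀ hε, mul_comm]
    exact h3.trans hBn

/-- By Markov's inequality |X| exceeds a large level M with small probability, uniformly in n. Off
that event a null sequence times X is at most M times a null sequence. -/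
lemma stochBdd_whp_of_integral_abs [IsFiniteMeasure P] {X : ℕ → Ω → ℝ}
    (hm : ∀ᶠ n in atTop, Integrable (X n) P)
    {B : ℝ} (hB : ∀ᶠ n in atTop, ∫ ω, |X n ω| ∂P ≤ B) :
    StochBdd (whp P) fun x : ℕ × Ω => X x.1 x.2 := by
  intro a ha
  rw [Metric.tendsto_nhds]
  intro ε hε
  rw [eventually_whp, ENNReal.tendsto_nhds_zero]
  intro δ hδ
  obtain ⟨δ', hδ', hδδ⟩ : ∃ δ' : ℝ, 0 < δ' ∧ ENNReal.ofReal δ' ≤ δ := by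
    by_cases h : δ = ⊤
    · exact ⟨1, one_pos, by simp [h]⟩
    · exact ⟨δ.toReal, ENNReal.toReal_pos hδ.ne' h, ENNReal.ofReal_toReal_le⟩
  -- choose a level `M` exceeded by `X` with probability at most `δ' / 2`
  obtain ⟨M, hM, hBM⟩ : ∃ M : ℝ, 0 < M ∧ B / M ≤ δ' / 2 := by
    refine ⟨2 * (|B| + 1) / δ', by positivity, ?_⟩
    rw [div_le_div_iff₀ (by positivity) two_pos, mul_div_cancel₀ _ hδ'.ne']
    nlinarith [le_abs_self B]
  have ha' := eventually_whp.1 (Metric.tendsto_nhds.1 ha (ε / M) (by positivity))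
  rw [ENNReal.tendsto_nhds_zero] at ha'
  filter_upwards [hm, hB, ha' (ENNReal.ofReal (δ' / 2)) (by simpa using hδ')] with n hn hBn han
  have h3 := mul_meas_ge_le_integral_of_nonneg (ae_of_all P fun ω => abs_nonneg (X n ω)) hn.abs M
  have h5 : P {ω | M ≤ |X n ω|} ≤ ENNReal.ofReal (δ' / 2) := by
    rw [← ENNReal.ofReal_toReal (measure_ne_top P {ω | M ≤ |X n ω|})]
    refine ENNReal.ofReal_le_ofReal (le_trans ?_ hBM)
    rw [le_div_iff₀ hM, mul_comm]
    exact h3.trans hBn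
  have hsub : {ω | ¬ dist (a (n, ω) * X n ω) 0 < ε} ⊆
      {ω | ¬ dist (a (n, ω)) 0 < ε / M} ∪ {ω | M ≤ |X n ω|} := by
    intro ω hω
    by_contra hc
    simp only [Set.mem_union, Set.mem_ofPred_eq, not_or, not_le, Real.dist_eq,
      sub_zero, not_lt] at hc hω
    rw [abs_mul] at hω
    have : |a (n, ω)| * |X n ω| < ε / M * M := by
      rcases eq_or_lt_of_le (abs_nonneg (X n ω)) with h0 | h0
      · rw [← h0, mul_zero]; positivity
      · exact mul_lt_mul hc.1 hc.2.le h0 (by positivity)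
    rw [div_mul_cancel₀ _ hM.ne'] at this
    linarith
  calc P {ω | ¬ dist (a (n, ω) * X n ω) 0 < ε} ≤ _ := measure_mono hsub
    _ ≤ _ := measure_union_le _ _
    _ ≤ ENNReal.ofReal (δ' / 2) + ENNReal.ofReal (δ' / 2) := add_le_add han h5
    _ = ENNReal.ofReal δ' := by
      rw [← ENNReal.ofReal_add (by positivity) (by positivity), add_halves]
    _ ≤ δ := hδδ

end WithHighProbability

/-! ### Sample means -/

section SampleMean

variable {n : ℕ}

lemma sampleMean_add (x y : Fin n → ℝ) :
    sampleMean (fun i => x i + y i) = sampleMean x + sampleMean y := by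
  simp [sampleMean, Finset.sum_add_distrib, add_div]

lemma sampleMean_sub (x y : Fin n → ℝ) :
    sampleMean (fun i => x i - y i) = sampleMean x - sampleMean y := by
  simp [sampleMean, Finset.sum_sub_distrib, sub_div]

lemma sampleMean_const_mul (c : ℝ) (x : Fin n → ℝ) :
    sampleMean (fun i => c * x i) = c * sampleMean x := by
  simp [sampleMean, ← Finset.mul_sum, mul_div_assoc]

lemma sampleMean_const (hn : 0 < n) (c : ℝ) : sampleMean (fun _ : Fin n => c) = c := by
  have : (n : ℝ) ≠ 0 := by positivity
  simp [sampleMean]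
  field_simp

lemma sampleMean_mono {x y : Fin n → ℝ} (h : ∀ i, x i ≤ y i) : sampleMean x ≤ sampleMean y := by
  unfold sampleMean
  gcongr
  exact h _

lemma sampleMean_nonneg {x : Fin n → ℝ} (h : ∀ i, 0 ≤ x i) : 0 ≤ sampleMean x :=
  div_nonneg (Finset.sum_nonneg fun i _ => h i) (Nat.cast_nonneg n)

lemma abs_sampleMean_le (x : Fin n → ℝ) : |sampleMean x| ≤ sampleMean fun i => |x i| := by
  unfold sampleMean
  rw [abs_div, Nat.abs_cast]
  gcongr
  exact Finset.abs_sum_le_sum_abs _ _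

lemma sampleMean_mul_sq_le (x y : Fin n → ℝ) :
    (sampleMean fun i => x i * y i) ^ 2 ≤
      (sampleMean fun i => x i ^ 2) * sampleMean fun i => y i ^ 2 := by
  unfold sampleMean
  rw [div_pow, div_mul_div_comm, ← pow_two (n : ℝ)]
  gcongr
  exact Finset.sum_mul_sq_le_sq_mul_sq _ _ _

lemma sampleMean_centered_mul (x y : Fin n → ℝ) :
    (sampleMean fun i => (x i - sampleMean x) * y i) =
      (sampleMean fun i => x i * y i) - sampleMean x * sampleMean y := by
  rw [← sampleMean_const_mul, ← sampleMean_sub]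
  congr 1; ext i; ring

lemma sampleMean_centered_sq (hn : 0 < n) (x : Fin n → ℝ) :
    (sampleMean fun i => (x i - sampleMean x) ^ 2) =
      (sampleMean fun i => x i ^ 2) - sampleMean x ^ 2 := by
  have h : (fun i => (x i - sampleMean x) ^ 2) =
      fun i => (x i ^ 2 - (2 * sampleMean x) * x i) + sampleMean x ^ 2 := by
    ext i; ring
  rw [h, sampleMean_add, sampleMean_sub, sampleMean_const_mul, sampleMean_const hn]
  ring

/-- The least squares slope when the outcome is `a + β x + g`. -/
lemma olsSlope_eq (hn : 0 < n) {x y g : Fin n → ℝ} {a β : ℝ} (hy : ∀ i, y i = a + β * x i + g i)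
    (hx : (sampleMean fun i => (x i - sampleMean x) ^ 2) ≠ 0) :
    olsSlope x y = β + (sampleMean fun i => (x i - sampleMean x) * g i) /
      sampleMean fun i => (x i - sampleMean x) ^ 2 := by
  have hn' : (n : ℝ) ≠ 0 := by positivity
  have hx' : ∑ i, (x i - sampleMean x) ^ 2 ≠ 0 := by
    intro h; apply hx; rw [sampleMean, h, zero_div]
  have hsum : ∑ i, (x i - sampleMean x) = 0 := by
    rw [Finset.sum_sub_distrib]
    simp [sampleMean]
    field_simp
    simp
  have hnum : ∑ i, (x i - sampleMean x) * (y i - sampleMean y) =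
      β * ∑ i, (x i - sampleMean x) ^ 2 + ∑ i, (x i - sampleMean x) * g i := by
    have h : ∀ i, (x i - sampleMean x) * (y i - sampleMean y) =
        β * (x i - sampleMean x) ^ 2 + (x i - sampleMean x) * g i +
          (x i - sampleMean x) * (a + β * sampleMean x - sampleMean y) := by
      intro i; rw [hy i]; ring
    rw [Finset.sum_congr rfl fun i _ => h i, Finset.sum_add_distrib, Finset.sum_add_distrib,
      ← Finset.sum_mul, hsum, Finset.mul_sum]
    ring
  unfold olsSlope
  rw [hnum, add_div, mul_div_cancel_right₀ _ hx']
  congr 1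
  generalize (fun i => (x i - sampleMean x) * g i) = A
  unfold sampleMean at *
  rw [div_div_div_cancel_right₀ hn']

/-- The least squares residual when the outcome is `a + β x + g`. -/
lemma olsResidual_eq (hn : 0 < n) {x y g : Fin n → ℝ} {a β : ℝ}
    (hy : ∀ i, y i = a + β * x i + g i) (i : Fin n) :
    olsResidual x y i =
      g i - sampleMean g - (olsSlope x y - β) * (x i - sampleMean x) := by
  have h : sampleMean y = a + β * sampleMean x + sampleMean g := by
    have : y = fun i => (a + β * x i) + g i := funext hy
    rw [this, sampleMean_add, sampleMean_add, sampleMean_const hn, sampleMean_const_mul]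
  unfold olsResidual olsIntercept
  rw [h, hy i]
  ring

lemma ehwVariance_eq (x y : Fin n → ℝ) :
    ehwVariance x y = (sampleMean fun i => (x i - sampleMean x) ^ 2 * olsResidual x y i ^ 2) /
      (sampleMean fun i => (x i - sampleMean x) ^ 2) ^ 2 := by
  unfold ehwVariance
  simp [sampleMean, div_eq_inv_mul]

end SampleMean

/-! ### Bounds for a single unit -/

section Pointwise

/-- The weight that dominates all polynomial moments used below. -/
def momWeight (t u : ℝ) : ℝ := 1 + t ^ 4 + u ^ 4

/-- The third order size of the noise. -/
def noiseSize (e s : ℝ) : ℝ := s * √s + |e| ^ 3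

lemma one_le_momWeight (t u : ℝ) : 1 ≤ momWeight t u := by
  unfold momWeight
  have : 0 ≤ t ^ 4 := by positivity
  have : 0 ≤ u ^ 4 := by positivity
  linarith

lemma abs_le_momWeight_left (t u : ℝ) : |t| ≤ momWeight t u := by
  unfold momWeight
  rw [← Even.pow_abs (by decide : Even 4) t]
  have : 0 ≤ u ^ 4 := by positivity
  nlinarith [sq_nonneg (|t| - 1), sq_nonneg (|t| ^ 2 - 1)]

lemma abs_le_momWeight_right (t u : ℝ) : |u| ≤ momWeight t u := by
  have := abs_le_momWeight_left u t
  unfold momWeight at *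
  linarith

lemma sq_le_momWeight (t u : ℝ) : t ^ 2 ≤ momWeight t u := by
  unfold momWeight
  have : 0 ≤ u ^ 4 := by positivity
  nlinarith [sq_nonneg (t ^ 2 - 1)]

lemma pow_four_le_momWeight (t u : ℝ) : t ^ 4 ≤ momWeight t u := by
  unfold momWeight
  have : 0 ≤ u ^ 4 := by positivity
  linarith

lemma abs_mul_le_momWeight (t u : ℝ) : |t * u| ≤ momWeight t u := by
  unfold momWeight
  rw [abs_mul, ← Even.pow_abs (by decide : Even 4) t, ← Even.pow_abs (by decide : Even 4) u]
  nlinarith [sq_nonneg (|t| - |u|), sq_nonneg (|t| ^ 2 - 1), sq_nonneg (|u| ^ 2 - 1)]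

variable {e s : ℝ}

lemma noiseSize_nonneg (hs : 0 ≤ s) : 0 ≤ noiseSize e s := by unfold noiseSize; positivity

lemma mul_sqrt_le_noiseSize : s * √s ≤ noiseSize e s := by
  unfold noiseSize
  have : 0 ≤ |e| ^ 3 := by positivity
  linarith

lemma abs_cube_le_noiseSize (hs : 0 ≤ s) : |e| ^ 3 ≤ noiseSize e s := by
  unfold noiseSize
  have : 0 ≤ s * √s := by positivity
  linarith

/-- With s = a², a mixed monomial of degree three in a and |e| is at most the cube of the larger
one. -/
lemma mul_abs_le_noiseSize (hs : 0 ≤ s) : s * |e| ≤ noiseSize e s := by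
  unfold noiseSize
  obtain ⟨a, ha, rfl⟩ : ∃ a : ℝ, 0 ≤ a ∧ s = a ^ 2 := ⟨√s, by positivity, (Real.sq_sqrt hs).symm⟩
  rw [Real.sqrt_sq ha]
  have he := abs_nonneg e
  rcases le_total a |e| with h | h
  · nlinarith [mul_le_mul h h ha he, pow_nonneg ha 3]
  · nlinarith [mul_nonneg ha ha, pow_nonneg he 3]

lemma sqrt_mul_sq_le_noiseSize (hs : 0 ≤ s) : √s * e ^ 2 ≤ noiseSize e s := by
  unfold noiseSize
  obtain ⟨a, ha, rfl⟩ : ∃ a : ℝ, 0 ≤ a ∧ s = a ^ 2 := ⟨√s, by positivity, (Real.sq_sqrt hs).symm⟩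
  rw [Real.sqrt_sq ha, ← sq_abs e]
  have he := abs_nonneg e
  rcases le_total a |e| with h | h
  · nlinarith [mul_nonneg he he, pow_nonneg ha 3]
  · nlinarith [mul_le_mul h h he ha, pow_nonneg he 3]

/-! ### Size and stability of the shrinkage factor -/

/-- The constant in the bounds for the shrinkage factor. -/
def shrinkConst (v : ℝ) : ℝ := (1 + 1 / v) ^ 2

variable {v W V : ℝ}

lemma shrinkConst_nonneg : 0 ≤ shrinkConst v := by unfold shrinkConst; positivity

lemma shrink_nonneg (hv : 0 < v) (hW : v ≤ W) (hs : 0 ≤ s) : 0 ≤ s / (s + W) := by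
  have : 0 < W := by linarith
  positivity

lemma shrink_le_one (hv : 0 < v) (hW : v ≤ W) (hs : 0 ≤ s) : s / (s + W) ≤ 1 := by
  rw [div_le_one (by linarith)]; linarith

lemma shrink_le_inv_mul (hv : 0 < v) (hW : v ≤ W) (hs : 0 ≤ s) : s / (s + W) ≤ 1 / v * s := by
  rw [one_div, inv_mul_eq_div]
  gcongr
  linarith

lemma shrink_le_mul (hv : 0 < v) (hW : v ≤ W) (hs : 0 ≤ s) :
    s / (s + W) ≤ shrinkConst v * s := by
  refine (shrink_le_inv_mul hv hW hs).trans ?_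
  gcongr
  unfold shrinkConst
  have : 0 < 1 / v := by positivity
  nlinarith

/-- With a = √s, it suffices that a ≤ (1 + 1/v)(a² + v), whose right side is at least a² + 1. -/
lemma shrink_le_inv_mul_sqrt (hv : 0 < v) (hW : v ≤ W) (hs : 0 ≤ s) :
    s / (s + W) ≤ (1 + 1 / v) * √s := by
  obtain ⟨a, ha, rfl⟩ : ∃ a : ℝ, 0 ≤ a ∧ s = a ^ 2 := ⟨√s, by positivity, (Real.sq_sqrt hs).symm⟩
  rw [Real.sqrt_sq ha]
  have hk : 0 < 1 / v := by positivity
  have hkv : 1 / v * v = 1 := by field_simp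
  rw [div_le_iff₀ (by nlinarith)]
  have h1 : a ≤ (1 + 1 / v) * (a ^ 2 + W) := by
    have : (1 + 1 / v) * (a ^ 2 + v) ≤ (1 + 1 / v) * (a ^ 2 + W) := by gcongr
    nlinarith [sq_nonneg (a - 1), mul_nonneg hk.le (sq_nonneg a)]
  nlinarith

lemma shrink_le_mul_sqrt (hv : 0 < v) (hW : v ≤ W) (hs : 0 ≤ s) :
    s / (s + W) ≤ shrinkConst v * √s := by
  refine (shrink_le_inv_mul_sqrt hv hW hs).trans ?_
  gcongr
  unfold shrinkConst
  have : 0 < 1 / v := by positivity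
  nlinarith

/-- One factor is bounded by a multiple of s and the other by a multiple of √s, so the square has
third order. -/
lemma shrink_sq_le (hv : 0 < v) (hW : v ≤ W) (hs : 0 ≤ s) :
    (s / (s + W)) ^ 2 ≤ shrinkConst v * (s * √s) := by
  have h0 := shrink_nonneg hv hW hs
  have h1 := shrink_le_inv_mul hv hW hs
  have h2 := shrink_le_inv_mul_sqrt hv hW hs
  have hk : 0 < 1 / v := by positivity
  calc (s / (s + W)) ^ 2 = (s / (s + W)) * (s / (s + W)) := pow_two _
    _ ≤ (1 / v * s) * ((1 + 1 / v) * √s) := mul_le_mul h1 h2 h0 (by positivity)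
    _ = (1 / v * (1 + 1 / v)) * (s * √s) := by ring
    _ ≤ shrinkConst v * (s * √s) := by
      gcongr
      unfold shrinkConst
      nlinarith

/-- The difference equals s(V − W)/((s + W)(s + V)), and the denominator is at least v². Replacing
V̂ by V in the weights thus costs the estimation error times s. -/
lemma abs_shrink_sub_le (hv : 0 < v) (hW : v ≤ W) (hV : v ≤ V) (hs : 0 ≤ s) :
    |s / (s + W) - s / (s + V)| ≤ shrinkConst v * (|V - W| * s) := by
  have hk : 0 < 1 / v := by positivity
  have h1 : s / (s + W) - s / (s + V) = s * (V - W) / ((s + W) * (s + V)) := by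
    have : s + W ≠ 0 := by linarith
    have : s + V ≠ 0 := by linarith
    field_simp
    ring
  have h2 : 0 < (s + W) * (s + V) := mul_pos (by linarith) (by linarith)
  rw [h1, abs_div, abs_mul, abs_of_nonneg hs, abs_of_pos h2, div_le_iff₀ h2]
  have h3 : 1 ≤ shrinkConst v * ((s + W) * (s + V)) := by
    have h4 : v * v ≤ (s + W) * (s + V) :=
      mul_le_mul (by linarith) (by linarith) hv.le (by linarith)
    calc (1 : ℝ) = (1 / v) ^ 2 * (v * v) := by field_simp
      _ ≤ shrinkConst v * ((s + W) * (s + V)) := by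
        unfold shrinkConst
        gcongr
        linarith
  calc s * |V - W| = (|V - W| * s) * 1 := by ring
    _ ≤ (|V - W| * s) * (shrinkConst v * ((s + W) * (s + V))) := by gcongr
    _ = _ := by ring

/-! ### Expansion of score and regressor for one unit -/

variable {t u c β : ℝ}

lemma add_sub_sq_le (a b c : ℝ) : (a + b - c) ^ 2 ≤ 3 * (a ^ 2 + b ^ 2 + c ^ 2) := by
  nlinarith [sq_nonneg (a - b), sq_nonneg (a + c), sq_nonneg (b + c)]

lemma abs_mul_abs_le_add_sq (a b : ℝ) : |a| * |b| ≤ b ^ 2 + a ^ 2 := by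
  rw [← sq_abs b, ← sq_abs a]
  nlinarith [sq_nonneg (|a| - |b|), sq_nonneg |b|, sq_nonneg |a|]

/-- The expansion of the score of one unit. -/
lemma abs_score_sub_le (hv : 0 < v) (hW : v ≤ W) (hV : v ≤ V) (hs : 0 ≤ s) :
    |((t + e - c) - s / (s + W) * (t + e - c)) * (u + β * (s / (s + W) * (t + e - c) - e))
      - (t * u + e * u - c * u - s / (s + V) * (t * u)
        + β * (s / (s + V) * (t ^ 2 - V) - (e ^ 2 - s) - t * e + c * e))|
    ≤ 14 * (1 + |β|) * shrinkConst v * (noiseSize e s * momWeight t u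
        + (|V - W| + |c| + c ^ 2) * (s * momWeight t u)) := by
  have hF1 := one_le_momWeight t u
  have hFt := abs_le_momWeight_left t u
  have hFu := abs_le_momWeight_right t u
  have hFt2 := sq_le_momWeight t u
  have hFtu := abs_mul_le_momWeight t u
  have hr0 : 0 ≤ noiseSize e s := noiseSize_nonneg hs
  have hr1 : s * √s ≤ noiseSize e s := mul_sqrt_le_noiseSize
  have hr2 : s * |e| ≤ noiseSize e s := mul_abs_le_noiseSize hs
  have hr3 : √s * e ^ 2 ≤ noiseSize e s := sqrt_mul_sq_le_noiseSize hs
  have hK : 0 ≤ shrinkConst v := shrinkConst_nonneg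
  have hb0 := shrink_nonneg hv hW hs
  have hb1 := shrink_le_one hv hW hs
  have hbs := shrink_le_mul hv hW hs
  have hbr := shrink_le_mul_sqrt hv hW hs
  have hb2 := shrink_sq_le hv hW hs
  have hbr' := shrink_le_mul_sqrt hv hV hs
  have hd := abs_shrink_sub_le hv hW hV hs
  -- The source of the cancellation of the bias: V b' = s − s b', so shrinkage offsets s and leaves
  -- only the third-order term s b'.
  have hsV : s / (s + V) * (s + V) = s := div_mul_cancel₀ _ (by linarith)
  have e7' : 0 ≤ s * (s / (s + V)) := mul_nonneg hs (shrink_nonneg hv hV hs)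
  set F := momWeight t u
  set r := noiseSize e s
  set K := shrinkConst v
  set b := s / (s + W)
  set b' := s / (s + V)
  clear_value F r K b b'
  have hF0 : 0 ≤ F := by linarith
  have hrF : r ≤ r * F := le_mul_of_one_le_right hr0 hF1
  have hsF : s ≤ s * F := le_mul_of_one_le_right hs hF1
  have hD0 : 0 ≤ |V - W| := abs_nonneg _
  have hc0 : 0 ≤ |c| := abs_nonneg _
  have hc2 : 0 ≤ c ^ 2 := sq_nonneg _
  -- The four sources of the remainder: third-order noise, the error in V̂, and the first and second
  -- powers of the grand-mean error c.
  obtain ⟨A, hAd⟩ : ∃ A, A = K * (r * F) := ⟨_, rfl⟩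
  obtain ⟨B, hBd⟩ : ∃ B, B = K * (|V - W| * (s * F)) := ⟨_, rfl⟩
  obtain ⟨C, hCd⟩ : ∃ C, C = K * (|c| * (s * F)) := ⟨_, rfl⟩
  obtain ⟨D, hDd⟩ : ∃ D, D = K * (c ^ 2 * (s * F)) := ⟨_, rfl⟩
  have hA : 0 ≤ A := by rw [hAd]; positivity
  have hB : 0 ≤ B := by rw [hBd]; positivity
  have hC : 0 ≤ C := by rw [hCd]; positivity
  have hDD : 0 ≤ D := by rw [hDd]; positivity
  have e1 : |(b - b') * (t * u)| ≤ B := by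
    rw [abs_mul]
    calc _ ≤ K * (|V - W| * s) * F := mul_le_mul hd hFtu (abs_nonneg _) (by positivity)
      _ = B := by rw [hBd]; ring
  have e1' : |(b - b') * t ^ 2| ≤ B := by
    rw [abs_mul, abs_of_nonneg (sq_nonneg t)]
    calc _ ≤ K * (|V - W| * s) * F := mul_le_mul hd hFt2 (sq_nonneg _) (by positivity)
      _ = B := by rw [hBd]; ring
  have hbe : b * |e| ≤ K * r := by
    calc b * |e| ≤ K * s * |e| := by gcongr
      _ = K * (s * |e|) := by ring
      _ ≤ K * r := by gcongr
  have e2 : |b * e * u| ≤ A := by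
    rw [abs_mul, abs_mul, abs_of_nonneg hb0]
    calc _ ≤ K * r * F := mul_le_mul hbe hFu (abs_nonneg _) (by positivity)
      _ = A := by rw [hAd]; ring
  have e2' : |b * e * t| ≤ A := by
    rw [abs_mul, abs_mul, abs_of_nonneg hb0]
    calc _ ≤ K * r * F := mul_le_mul hbe hFt (abs_nonneg _) (by positivity)
      _ = A := by rw [hAd]; ring
  have e3 : |c * (b * u)| ≤ C := by
    rw [abs_mul, abs_mul, abs_of_nonneg hb0]
    calc _ ≤ |c| * (K * s * F) := by gcongr
      _ = C := by rw [hCd]; ring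
  have e3' : |c * (b * t)| ≤ C := by
    rw [abs_mul, abs_mul, abs_of_nonneg hb0]
    calc _ ≤ |c| * (K * s * F) := by gcongr
      _ = C := by rw [hCd]; ring
  have e4 : b * e ^ 2 ≤ A := by
    calc _ ≤ K * √s * e ^ 2 := by gcongr
      _ = K * (√s * e ^ 2) := by ring
      _ ≤ A := hAd ▸ mul_le_mul_of_nonneg_left (hr3.trans hrF) hK
  have e5 : b * c ^ 2 ≤ D := by
    calc _ ≤ K * s * c ^ 2 := by gcongr
      _ ≤ K * (s * F) * c ^ 2 := by gcongr
      _ = D := by rw [hDd]; ring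
  have e6 : b ^ 2 * t ^ 2 ≤ A := by
    calc _ ≤ K * (s * √s) * F := by gcongr
      _ ≤ K * r * F := by gcongr
      _ = A := by rw [hAd]; ring
  have e7 : s * b' ≤ A := by
    calc s * b' ≤ s * (K * √s) := by gcongr
      _ = K * (s * √s) := by ring
      _ ≤ A := hAd ▸ mul_le_mul_of_nonneg_left (hr1.trans hrF) hK
  have e8 : b ^ 2 * (t + e - c) ^ 2 ≤ 6 * A + 3 * D := by
    have h1 := add_sub_sq_le t e c
    have h2 : b ^ 2 ≤ b := pow_le_of_le_one hb0 hb1 two_ne_zero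
    have h3 : b ^ 2 * e ^ 2 ≤ b * e ^ 2 := by gcongr
    have h4 : b ^ 2 * c ^ 2 ≤ b * c ^ 2 := by gcongr
    have h5 : b ^ 2 * (t + e - c) ^ 2 ≤ b ^ 2 * (3 * (t ^ 2 + e ^ 2 + c ^ 2)) := by gcongr
    linarith only [h5, h3, h4, e4, e5, e6]
  have e8' : 0 ≤ b ^ 2 * (t + e - c) ^ 2 := by positivity
  have e9 : |b * (e - c) ^ 2| ≤ 2 * A + 2 * D := by
    rw [abs_of_nonneg (by positivity)]
    have : b * (e - c) ^ 2 ≤ b * (2 * (e ^ 2 + c ^ 2)) := by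
      gcongr
      linarith only [sq_nonneg (e + c), show (e + c) ^ 2 = e ^ 2 + 2 * (e * c) + c ^ 2 by ring,
        show (e - c) ^ 2 = e ^ 2 - 2 * (e * c) + c ^ 2 by ring]
    linarith only [this, e4, e5]
  have e10 : |b * c * e| ≤ A + D := by
    have h1 : |b * c * e| = b * (|c| * |e|) := by rw [abs_mul, abs_mul, abs_of_nonneg hb0]; ring
    rw [h1]
    have h2 := abs_mul_abs_le_add_sq c e
    have : b * (|c| * |e|) ≤ b * (e ^ 2 + c ^ 2) := by gcongr
    linarith only [this, e4, e5]
  have e11 : |b * e ^ 2| ≤ A := by rwa [abs_of_nonneg (by positivity)]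
  have hid : ((t + e - c) - b * (t + e - c)) * (u + β * (b * (t + e - c) - e))
      - (t * u + e * u - c * u - b' * (t * u)
        + β * (b' * (t ^ 2 - V) - (e ^ 2 - s) - t * e + c * e))
      = (-((b - b') * (t * u)) - b * e * u + c * (b * u))
        + β * (-(s * b') + (b - b') * t ^ 2 + b * (e - c) ^ 2 + 2 * (b * e * t)
          - 2 * (c * (b * t)) - b ^ 2 * (t + e - c) ^ 2 + b * e * t + b * e ^ 2 - b * c * e) := by
    linear_combination (β) * hsV
  rw [hid]
  have p1 : |-((b - b') * (t * u)) - b * e * u + c * (b * u)| ≤ A + B + C := by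
    rw [abs_le] at e1 e2 e3 ⊢
    constructor <;> linarith only [e1.1, e1.2, e2.1, e2.2, e3.1, e3.2]
  -- The coefficient of A collects, in the order of the terms, 1 + 2 + 2 + 6 + 1 + 1 + 1 = 14. The
  -- other coefficients are smaller, so 14 serves for all.
  have p2 : |-(s * b') + (b - b') * t ^ 2 + b * (e - c) ^ 2 + 2 * (b * e * t)
          - 2 * (c * (b * t)) - b ^ 2 * (t + e - c) ^ 2 + b * e * t + b * e ^ 2 - b * c * e|
      ≤ 14 * A + B + 2 * C + 6 * D := by
    rw [abs_le] at e1' e2' e3' e9 e10 e11 ⊢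
    constructor <;> linarith only [e7, e7', e8, e8', e1'.1, e1'.2, e2'.1, e2'.2, e3'.1, e3'.2, e9.1, e9.2, e10.1, e10.2,
      e11.1, e11.2]
  calc _ ≤ (A + B + C) + |β| * (14 * A + B + 2 * C + 6 * D) := by
        refine (abs_add_le _ _).trans ?_
        rw [abs_mul]
        gcongr
    _ ≤ (14 * (A + B + C + D)) + |β| * (14 * (A + B + C + D)) := by gcongr <;> linarith only [hA, hB, hC, hDD]
    _ = _ := by rw [hAd, hBd, hCd, hDd]; ring

/-- Used to show that the average amount of shrinkage is of order n^{-1/2}; no cancellation is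
needed for that. -/
lemma abs_shrink_mul_le (hv : 0 < v) (hW : v ≤ W) (hs : 0 ≤ s) :
    |s / (s + W) * (t + e - c)| ≤ shrinkConst v *
      (noiseSize e s * momWeight t u + (1 + |c|) * (s * momWeight t u)) := by
  have hF1 := one_le_momWeight t u
  have hFt := abs_le_momWeight_left t u
  have hr0 : 0 ≤ noiseSize e s := noiseSize_nonneg hs
  have hr2 : s * |e| ≤ noiseSize e s := mul_abs_le_noiseSize hs
  have hK : 0 ≤ shrinkConst v := shrinkConst_nonneg
  have hrF : noiseSize e s ≤ noiseSize e s * momWeight t u := le_mul_of_one_le_right hr0 hF1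
  have hsF : s ≤ s * momWeight t u := le_mul_of_one_le_right hs hF1
  rw [abs_mul, abs_of_nonneg (shrink_nonneg hv hW hs)]
  calc _ ≤ shrinkConst v * s * (|t| + |e| + |c|) := by
        gcongr
        · exact shrink_le_mul hv hW hs
        · exact (abs_sub _ _).trans (by gcongr; exact abs_add_le _ _)
    _ = shrinkConst v * (s * |t| + s * |e| + |c| * s) := by ring
    _ ≤ shrinkConst v * (s * momWeight t u + noiseSize e s * momWeight t u
          + |c| * (s * momWeight t u)) := by
        refine mul_le_mul_of_nonneg_left ?_ hK
        have := mul_le_mul_of_nonneg_left hsF (abs_nonneg c)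
        have := mul_le_mul_of_nonneg_left hFt hs
        linarith
    _ = _ := by ring

lemma shrink_mul_sq_le (hv : 0 < v) (hW : v ≤ W) (hs : 0 ≤ s) :
    s / (s + W) * (t + e - c) ^ 2 ≤ 3 * shrinkConst v *
      (noiseSize e s * momWeight t u + (1 + c ^ 2) * (s * momWeight t u)) := by
  have hF1 := one_le_momWeight t u
  have hFt := sq_le_momWeight t u
  have hr0 : 0 ≤ noiseSize e s := noiseSize_nonneg hs
  have hr3 : √s * e ^ 2 ≤ noiseSize e s := sqrt_mul_sq_le_noiseSize hs
  have hK : 0 ≤ shrinkConst v := shrinkConst_nonneg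
  have hrF : noiseSize e s ≤ noiseSize e s * momWeight t u := le_mul_of_one_le_right hr0 hF1
  have hsF : s ≤ s * momWeight t u := le_mul_of_one_le_right hs hF1
  have hb0 := shrink_nonneg hv hW hs
  have hbs := shrink_le_mul hv hW hs
  have hbr := shrink_le_mul_sqrt hv hW hs
  calc _ ≤ s / (s + W) * (3 * (t ^ 2 + e ^ 2 + c ^ 2)) := by
        gcongr
        exact add_sub_sq_le t e c
    _ = 3 * (s / (s + W) * t ^ 2 + s / (s + W) * e ^ 2 + s / (s + W) * c ^ 2) := by ring
    _ ≤ 3 * (shrinkConst v * s * momWeight t u + shrinkConst v * √s * e ^ 2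
          + shrinkConst v * s * c ^ 2) := by gcongr
    _ = 3 * (shrinkConst v * (s * momWeight t u + √s * e ^ 2 + c ^ 2 * s)) := by ring
    _ ≤ 3 * (shrinkConst v * (s * momWeight t u + noiseSize e s * momWeight t u
          + c ^ 2 * (s * momWeight t u))) := by
        refine mul_le_mul_of_nonneg_left (mul_le_mul_of_nonneg_left ?_ hK) (by norm_num)
        have := mul_le_mul_of_nonneg_left hsF (sq_nonneg c)
        linarith
    _ = _ := by ring

lemma add_pow_four_le (a b : ℝ) : (a + b) ^ 4 ≤ 8 * (a ^ 4 + b ^ 4) := by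
  have h1 : (a + b) ^ 2 ≤ 2 * (a ^ 2 + b ^ 2) := by nlinarith [sq_nonneg (a - b)]
  have h2 : ((a + b) ^ 2) ^ 2 ≤ (2 * (a ^ 2 + b ^ 2)) ^ 2 := by gcongr
  nlinarith [sq_nonneg (a ^ 2 - b ^ 2)]

lemma add_three_pow_four_le (a b c : ℝ) : (a + b + c) ^ 4 ≤ 64 * (a ^ 4 + b ^ 4 + c ^ 4) := by
  have h1 := add_pow_four_le (a + b) c
  have h2 := add_pow_four_le a b
  have : 0 ≤ c ^ 4 := by positivity
  linarith

/-- Since b⁴ ≤ b, a single factor s is available against t⁴. Against e⁴ and c⁴ the bound b⁴ ≤ 1 is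
enough, since the averages of these powers vanish on their own. -/
lemma shrink_mul_pow_four_le (hv : 0 < v) (hW : v ≤ W) (hs : 0 ≤ s) :
    (s / (s + W) * (t + e - c)) ^ 4 ≤
      64 * (shrinkConst v * (s * momWeight t u) + e ^ 4 + c ^ 4) := by
  have hb0 := shrink_nonneg hv hW hs
  have hb1 := shrink_le_one hv hW hs
  have hbs := shrink_le_mul hv hW hs
  have hF := pow_four_le_momWeight t u
  have hK : 0 ≤ shrinkConst v := shrinkConst_nonneg
  have h4 : (s / (s + W)) ^ 4 ≤ s / (s + W) := pow_le_of_le_one hb0 hb1 (by norm_num)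
  rw [mul_pow]
  calc _ ≤ (s / (s + W)) ^ 4 * (64 * (t ^ 4 + e ^ 4 + c ^ 4)) := by
        gcongr
        have := add_three_pow_four_le t e (-c)
        rwa [← sub_eq_add_neg, Even.neg_pow (by decide : Even 4)] at this
    _ = 64 * ((s / (s + W)) ^ 4 * t ^ 4 + (s / (s + W)) ^ 4 * e ^ 4
          + (s / (s + W)) ^ 4 * c ^ 4) := by ring
    _ ≤ 64 * (shrinkConst v * s * momWeight t u + 1 * e ^ 4 + 1 * c ^ 4) := by
        gcongr
        · exact h4.trans hbs
        · exact h4.trans hb1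
        · exact h4.trans hb1
    _ = _ := by ring

end Pointwise

/-! ### The shrinkage regression for arrays of numbers -/

section Arrays

variable {n : ℕ}

/-- The individual means, centered at their grand mean. -/
def centeredMean (t e : Fin n → ℝ) (i : Fin n) : ℝ :=
  t i + e i - (sampleMean t + sampleMean e)

/-- The variance estimator in terms of effects, mean noise and estimated noise variance. -/
def arrayV (t e s : Fin n → ℝ) : ℝ :=
  (sampleMean fun i => centeredMean t e i ^ 2) - ((n : ℝ) - 1) / n * sampleMean s

/-- The shrinkage factor `1 - w`. -/
def shrinkage (t e s : Fin n → ℝ) (i : Fin n) : ℝ := s i / (s i + arrayV t e s)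

/-- The shrinkage estimator, centered at the grand mean. -/
def shrunk (t e s : Fin n → ℝ) (i : Fin n) : ℝ :=
  centeredMean t e i - shrinkage t e s i * centeredMean t e i

/-- The regression error of the outcome on the shrinkage estimator. -/
def regError (β : ℝ) (t u e s : Fin n → ℝ) (i : Fin n) : ℝ :=
  u i + β * (shrinkage t e s i * centeredMean t e i - e i)

lemma sampleMean_centeredMean (hn : 0 < n) (t e : Fin n → ℝ) : sampleMean (centeredMean t e) = 0 := by
  have : centeredMean t e = fun i => (t i + e i) - (sampleMean t + sampleMean e) := rfl
  rw [this, sampleMean_sub, sampleMean_add, sampleMean_const hn, sub_self]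

lemma sampleMean_centeredMean_sq (hn : 0 < n) (t e s : Fin n → ℝ) :
    (sampleMean fun i => centeredMean t e i ^ 2) =
      (sampleMean fun i => t i ^ 2) + 2 * (sampleMean fun i => t i * e i)
        + (sampleMean fun i => e i ^ 2 - s i) + sampleMean s
        - (sampleMean t + sampleMean e) ^ 2 := by
  have h1 : (fun i => centeredMean t e i ^ 2) = fun i =>
      (((((t i ^ 2 + 2 * (t i * e i)) + (e i ^ 2 - s i)) + s i)
        - (2 * (sampleMean t + sampleMean e)) * (t i + e i))
        + (sampleMean t + sampleMean e) ^ 2) := by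
    ext i; unfold centeredMean; ring
  rw [h1, sampleMean_add, sampleMean_sub, sampleMean_add, sampleMean_add, sampleMean_add,
    sampleMean_const_mul, sampleMean_const_mul, sampleMean_add, sampleMean_const hn]
  ring

end Arrays

/-- The stochastic orders of the sample means that drive the shrinkage regression: `t` are the
centered effects, `u` the regression errors, `e` the individual mean noises and `s` their
estimated variances. -/
structure ArrayLimits {ι : Type*} (l : Filter ι) (N : ι → ℕ) (t u e s : ∀ p, Fin (N p) → ℝ)
    (V τ : ℝ) : Prop where
  V_pos : 0 < V
  tendsto_N : Tendsto N l atTop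
  s_nonneg : ∀ᶠ p in l, ∀ i, 0 ≤ s p i
  bdd_t : StochBdd l fun p => √(N p) * sampleMean (t p)
  bdd_u : StochBdd l fun p => √(N p) * sampleMean (u p)
  lim_e : Tendsto (fun p => √(N p) * sampleMean (e p)) l (𝓝 0)
  bdd_tu : StochBdd l fun p => √(N p) * sampleMean fun i => t p i * u p i
  lim_t_sq : Tendsto (fun p => sampleMean fun i => t p i ^ 2) l (𝓝 V)
  lim_tu_sq : Tendsto (fun p => sampleMean fun i => (t p i * u p i) ^ 2) l (𝓝 τ)
  bdd_t_four : StochBdd l fun p => sampleMean fun i => t p i ^ 4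
  bdd_u_four : StochBdd l fun p => sampleMean fun i => u p i ^ 4
  lim_eu : Tendsto (fun p => √(N p) * sampleMean fun i => e p i * u p i) l (𝓝 0)
  lim_te : Tendsto (fun p => √(N p) * sampleMean fun i => t p i * e p i) l (𝓝 0)
  -- The average of s is only O_p(n^{-1/2}), but e² − s is centered and therefore negligible at this
  -- scale.
  lim_q : Tendsto (fun p => √(N p) * sampleMean fun i => e p i ^ 2 - s p i) l (𝓝 0)
  -- Boundedness is all that can hold here, as √n E[1/J] may have a positive limit; this average
  -- enters the score remainder only with a null factor.
  bdd_sF : StochBdd l fun p => √(N p) * sampleMean fun i => s p i * momWeight (t p i) (u p i)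
  lim_rF : Tendsto (fun p => √(N p) * sampleMean fun i =>
    noiseSize (e p i) (s p i) * momWeight (t p i) (u p i)) l (𝓝 0)
  -- In this field and the next, V is the true variance rather than its estimate, so the units stay
  -- independent and the factors t u and t² − V are centered.
  lim_shrink_tu : Tendsto (fun p => √(N p) * sampleMean fun i =>
    s p i / (s p i + V) * (t p i * u p i)) l (𝓝 0)
  lim_shrink_t_sq : Tendsto (fun p => √(N p) * sampleMean fun i =>
    s p i / (s p i + V) * (t p i ^ 2 - V)) l (𝓝 0)

/-- Cauchy–Schwarz for sample means: the squared average is at most a null sequence times a bounded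
one. -/
lemma tendsto_sampleMean_mul_zero {ι : Type*} {l : Filter ι} {N : ι → ℕ}
    {x y : ∀ p, Fin (N p) → ℝ} (hx : Tendsto (fun p => sampleMean fun i => x p i ^ 2) l (𝓝 0))
    (hy : StochBdd l fun p => sampleMean fun i => y p i ^ 2) :
    Tendsto (fun p => sampleMean fun i => x p i * y p i) l (𝓝 0) := by
  have h1 : Tendsto (fun p => (sampleMean fun i => x p i * y p i) ^ 2) l (𝓝 0) :=
    tendsto_of_tendsto_of_tendsto_of_le_of_le tendsto_const_nhds (hy _ hx)
      (fun p => sq_nonneg _) fun p => sampleMean_mul_sq_le _ _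
  rw [tendsto_zero_iff_abs_tendsto_zero]
  have h2 := (Real.continuous_sqrt.tendsto 0).comp h1
  rw [Real.sqrt_zero] at h2
  exact h2.congr fun p => Real.sqrt_sq_eq_abs _

/-! ### Consistency of V̂ and expansion of the score -/

namespace ArrayLimits

variable {ι : Type*} {l : Filter ι} {N : ι → ℕ} {t u e s : ∀ p, Fin (N p) → ℝ} {V τ : ℝ}
  (H : ArrayLimits l N t u e s V τ)

include H

lemma eventually_pos : ∀ᶠ p in l, 0 < N p := H.tendsto_N.eventually_gt_atTop 0

lemma tendsto_sqrt : Tendsto (fun p => √(N p : ℝ)) l atTop :=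
  Real.tendsto_sqrt_atTop.comp (tendsto_natCast_atTop_atTop.comp H.tendsto_N)

lemma tendsto_inv_sqrt : Tendsto (fun p => (√(N p : ℝ))⁻¹) l (𝓝 0) :=
  tendsto_inv_atTop_zero.comp H.tendsto_sqrt

lemma tendsto_zero_of_sqrt_mul {X : ι → ℝ} (h : StochBdd l fun p => √(N p) * X p) :
    Tendsto X l (𝓝 0) := by
  refine (h _ H.tendsto_inv_sqrt).congr' ?_
  filter_upwards [H.eventually_pos] with p hp
  have : √(N p : ℝ) ≠ 0 := by positivity
  field_simp

lemma tendsto_t : Tendsto (fun p => sampleMean (t p)) l (𝓝 0) := H.tendsto_zero_of_sqrt_mul H.bdd_t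

lemma tendsto_u : Tendsto (fun p => sampleMean (u p)) l (𝓝 0) := H.tendsto_zero_of_sqrt_mul H.bdd_u

lemma tendsto_e : Tendsto (fun p => sampleMean (e p)) l (𝓝 0) :=
  H.tendsto_zero_of_sqrt_mul (.of_tendsto H.lim_e)

lemma tendsto_center : Tendsto (fun p => sampleMean (t p) + sampleMean (e p)) l (𝓝 0) := by
  simpa using H.tendsto_t.add H.tendsto_e

lemma tendsto_sF : Tendsto (fun p => sampleMean fun i => s p i * momWeight (t p i) (u p i))
    l (𝓝 0) := H.tendsto_zero_of_sqrt_mul H.bdd_sF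

lemma tendsto_rF : Tendsto (fun p => sampleMean fun i =>
    noiseSize (e p i) (s p i) * momWeight (t p i) (u p i)) l (𝓝 0) :=
  H.tendsto_zero_of_sqrt_mul (.of_tendsto H.lim_rF)

lemma tendsto_s : Tendsto (fun p => sampleMean (s p)) l (𝓝 0) := by
  refine tendsto_of_tendsto_of_tendsto_of_le_of_le' tendsto_const_nhds H.tendsto_sF ?_ ?_
  · filter_upwards [H.s_nonneg] with p hp using sampleMean_nonneg hp
  · filter_upwards [H.s_nonneg] with p hp
    exact sampleMean_mono fun i => le_mul_of_one_le_right (hp i) (one_le_momWeight _ _)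

lemma tendsto_centeredMean_sq :
    Tendsto (fun p => sampleMean fun i => centeredMean (t p) (e p) i ^ 2) l (𝓝 V) := by
  have h1 := ((((H.lim_t_sq).add ((H.tendsto_zero_of_sqrt_mul (.of_tendsto H.lim_te)).const_mul 2)).add
    (H.tendsto_zero_of_sqrt_mul (.of_tendsto H.lim_q))).add H.tendsto_s).sub
    (H.tendsto_center.pow 2)
  simp only [mul_zero, add_zero, ne_eq, OfNat.ofNat_ne_zero, not_false_eq_true, zero_pow,
    sub_zero] at h1
  refine h1.congr' ?_
  filter_upwards [H.eventually_pos] with p hp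
  rw [sampleMean_centeredMean_sq hp _ _ (s p)]

/-- Consistency of the variance estimator. -/
lemma tendsto_arrayV : Tendsto (fun p => arrayV (t p) (e p) (s p)) l (𝓝 V) := by
  have h2 : Tendsto (fun p => ((N p : ℝ) - 1) / N p * sampleMean (s p)) l (𝓝 0) := by
    refine squeeze_zero_norm' ?_ (tendsto_zero_iff_abs_tendsto_zero _ |>.1 H.tendsto_s)
    filter_upwards [H.eventually_pos] with p hp
    have h0 : (1 : ℝ) ≤ N p := by exact_mod_cast hp
    rw [Real.norm_eq_abs, abs_mul]
    refine mul_le_of_le_one_left (abs_nonneg _) ?_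
    rw [abs_of_nonneg (div_nonneg (by linarith) (by linarith)), div_le_one (by linarith)]
    linarith
  simpa [arrayV] using H.tendsto_centeredMean_sq.sub h2

lemma eventually_half_le : ∀ᶠ p in l, V / 2 ≤ arrayV (t p) (e p) (s p) :=
  H.tendsto_arrayV.eventually_const_le (by linarith [H.V_pos])

/-- The shrinkage factor has the order of s, whose weighted average is O_p(n^{-1/2}). -/
lemma bdd_shrinkage_mul : StochBdd l fun p => √(N p) * sampleMean fun i =>
    shrinkage (t p) (e p) (s p) i * centeredMean (t p) (e p) i := by
  have h1 := (StochBdd.of_tendsto H.lim_rF).add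
    ((StochBdd.of_tendsto (tendsto_const_nhds.add
      ((tendsto_zero_iff_abs_tendsto_zero _).1 H.tendsto_center)) :
      StochBdd l fun p => (1 : ℝ) + |sampleMean (t p) + sampleMean (e p)|).mul H.bdd_sF)
  refine (h1.const_mul (shrinkConst (V / 2))).mono ?_
  filter_upwards [H.s_nonneg, H.eventually_half_le] with p hs hW
  have hv := half_pos H.V_pos
  rw [abs_mul, abs_of_nonneg (Real.sqrt_nonneg _)]
  refine le_trans ?_ (le_abs_self _)
  calc _ ≤ √(N p : ℝ) * sampleMean fun i => shrinkConst (V / 2) *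
      (noiseSize (e p i) (s p i) * momWeight (t p i) (u p i)
        + (1 + |sampleMean (t p) + sampleMean (e p)|) * (s p i * momWeight (t p i) (u p i))) := by
        gcongr
        refine (abs_sampleMean_le _).trans (sampleMean_mono fun i => ?_)
        exact abs_shrink_mul_le hv hW (hs i)
    _ = _ := by
        rw [sampleMean_const_mul, sampleMean_add, sampleMean_const_mul]
        ring

lemma tendsto_shrinkage_mul : Tendsto (fun p => sampleMean fun i =>
    shrinkage (t p) (e p) (s p) i * centeredMean (t p) (e p) i) l (𝓝 0) :=
  H.tendsto_zero_of_sqrt_mul H.bdd_shrinkage_mul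

lemma sampleMean_shrunk_eq : ∀ᶠ p in l, sampleMean (shrunk (t p) (e p) (s p)) =
    -sampleMean fun i => shrinkage (t p) (e p) (s p) i * centeredMean (t p) (e p) i := by
  filter_upwards [H.eventually_pos] with p hp
  have : shrunk (t p) (e p) (s p) = fun i => centeredMean (t p) (e p) i -
    shrinkage (t p) (e p) (s p) i * centeredMean (t p) (e p) i := rfl
  rw [this, sampleMean_sub, sampleMean_centeredMean hp, zero_sub]

lemma bdd_shrunk : StochBdd l fun p => √(N p) * sampleMean (shrunk (t p) (e p) (s p)) := by
  refine H.bdd_shrinkage_mul.mono ?_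
  filter_upwards [H.sampleMean_shrunk_eq] with p hp
  rw [hp, mul_neg, abs_neg]

lemma tendsto_shrunk : Tendsto (fun p => sampleMean (shrunk (t p) (e p) (s p))) l (𝓝 0) :=
  H.tendsto_zero_of_sqrt_mul H.bdd_shrunk

/-- The regressor variance is consistent. -/
lemma tendsto_regressor_variance : Tendsto (fun p => sampleMean fun i =>
    (shrunk (t p) (e p) (s p) i - sampleMean (shrunk (t p) (e p) (s p))) ^ 2) l (𝓝 V) := by
  have hv := half_pos H.V_pos
  have h1 : Tendsto (fun p => (sampleMean fun i => shrunk (t p) (e p) (s p) i ^ 2)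
      - sampleMean fun i => centeredMean (t p) (e p) i ^ 2) l (𝓝 0) := by
    have hB : Tendsto (fun p => 6 * shrinkConst (V / 2) * ((sampleMean fun i =>
          noiseSize (e p i) (s p i) * momWeight (t p i) (u p i))
        + (1 + (sampleMean (t p) + sampleMean (e p)) ^ 2) *
          sampleMean fun i => s p i * momWeight (t p i) (u p i))) l (𝓝 0) := by
      simpa using (H.tendsto_rF.add ((tendsto_const_nhds.add (H.tendsto_center.pow 2)).mul
        H.tendsto_sF)).const_mul (6 * shrinkConst (V / 2))
    refine squeeze_zero_norm' ?_ hB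
    filter_upwards [H.s_nonneg, H.eventually_half_le] with p hs hW
    rw [← sampleMean_sub, ← sampleMean_const_mul (1 + _), ← sampleMean_add,
      ← sampleMean_const_mul]
    refine (abs_sampleMean_le _).trans (sampleMean_mono fun i => ?_)
    have hb0 := shrink_nonneg hv hW (hs i)
    have hb1 := shrink_le_one hv hW (hs i)
    have hb2 := shrink_mul_sq_le (t := t p i) (e := e p i) (u := u p i)
      (c := sampleMean (t p) + sampleMean (e p)) hv hW (hs i)
    -- (1 − b)² − 1 = −(2 − b)b, with 0 ≤ 2 − b ≤ 2; the factors 2 and 3 make the constant 6 in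
    -- `hB`.
    have hid : shrunk (t p) (e p) (s p) i ^ 2 - centeredMean (t p) (e p) i ^ 2 =
      -((2 - shrinkage (t p) (e p) (s p) i) *
        (shrinkage (t p) (e p) (s p) i * centeredMean (t p) (e p) i ^ 2)) := by
      unfold shrunk; ring
    change 0 ≤ shrinkage (t p) (e p) (s p) i at hb0
    change shrinkage (t p) (e p) (s p) i ≤ 1 at hb1
    change shrinkage (t p) (e p) (s p) i * centeredMean (t p) (e p) i ^ 2 ≤ _ at hb2
    have hp0 : 0 ≤ shrinkage (t p) (e p) (s p) i * centeredMean (t p) (e p) i ^ 2 := by positivity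
    rw [hid, abs_neg, abs_mul, abs_of_nonneg hp0, abs_of_nonneg (by linarith)]
    calc _ ≤ 2 * (shrinkage (t p) (e p) (s p) i * centeredMean (t p) (e p) i ^ 2) := by
          gcongr; linarith
      _ ≤ 2 * _ := mul_le_mul_of_nonneg_left hb2 (by norm_num)
      _ = _ := by ring
  have h2 := (h1.add H.tendsto_centeredMean_sq).sub (H.tendsto_shrunk.pow 2)
  simp only [sub_add_cancel, zero_add, ne_eq, OfNat.ofNat_ne_zero, not_false_eq_true, zero_pow,
    sub_zero] at h2
  refine h2.congr' ?_
  filter_upwards [H.eventually_pos] with p hp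
  rw [sampleMean_centered_sq hp]

lemma tendsto_regError (β : ℝ) :
    Tendsto (fun p => sampleMean (regError β (t p) (u p) (e p) (s p))) l (𝓝 0) := by
  have h : ∀ p, sampleMean (regError β (t p) (u p) (e p) (s p)) = sampleMean (u p) + β *
      ((sampleMean fun i => shrinkage (t p) (e p) (s p) i * centeredMean (t p) (e p) i)
        - sampleMean (e p)) := fun p => by
    rw [← sampleMean_sub, ← sampleMean_const_mul, ← sampleMean_add]
    rfl
  simp_rw [h]
  simpa using H.tendsto_u.add ((H.tendsto_shrinkage_mul.sub H.tendsto_e).const_mul β)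

/-- The first order expansion of the score of the shrinkage regression. -/
lemma tendsto_score (β : ℝ) : Tendsto (fun p => √(N p) * (sampleMean fun i =>
      (shrunk (t p) (e p) (s p) i - sampleMean (shrunk (t p) (e p) (s p))) *
        regError β (t p) (u p) (e p) (s p) i)
    - √(N p) * sampleMean fun i => t p i * u p i) l (𝓝 0) := by
  have hv := half_pos H.V_pos
  have hc := (tendsto_zero_iff_abs_tendsto_zero _).1 H.tendsto_center
  have hV : Tendsto (fun p => |V - arrayV (t p) (e p) (s p)|) l (𝓝 0) := by
    simpa using (tendsto_const_nhds.sub H.tendsto_arrayV : Tendsto (fun p => V - arrayV _ _ _) l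
      (𝓝 (V - V))).abs
  -- the remainder of the expansion
  have hR : Tendsto (fun p => √(N p) * sampleMean fun i =>
      shrunk (t p) (e p) (s p) i * regError β (t p) (u p) (e p) (s p) i -
      (t p i * u p i + e p i * u p i - (sampleMean (t p) + sampleMean (e p)) * u p i
        - s p i / (s p i + V) * (t p i * u p i)
        + β * (s p i / (s p i + V) * (t p i ^ 2 - V) - (e p i ^ 2 - s p i) - t p i * e p i
          + (sampleMean (t p) + sampleMean (e p)) * e p i))) l (𝓝 0) := by
    have hB : Tendsto (fun p => 14 * (1 + |β|) * shrinkConst (V / 2) * (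
        (√(N p) * sampleMean fun i => noiseSize (e p i) (s p i) * momWeight (t p i) (u p i))
        + (|V - arrayV (t p) (e p) (s p)| + |sampleMean (t p) + sampleMean (e p)|
            + (sampleMean (t p) + sampleMean (e p)) ^ 2) *
          (√(N p) * sampleMean fun i => s p i * momWeight (t p i) (u p i)))) l (𝓝 0) := by
      have h0 := (hV.add hc).add (H.tendsto_center.pow 2)
      simp only [add_zero, ne_eq, OfNat.ofNat_ne_zero, not_false_eq_true, zero_pow,
        Function.comp_def] at h0
      simpa using (H.lim_rF.add (H.bdd_sF _ h0)).const_mul (14 * (1 + |β|) * shrinkConst (V / 2))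
    refine squeeze_zero_norm' ?_ hB
    filter_upwards [H.s_nonneg, H.eventually_half_le] with p hs hW
    rw [Real.norm_eq_abs, abs_mul, abs_of_nonneg (Real.sqrt_nonneg _)]
    calc _ ≤ √(N p : ℝ) * sampleMean fun i => 14 * (1 + |β|) * shrinkConst (V / 2) * (
          noiseSize (e p i) (s p i) * momWeight (t p i) (u p i)
        + (|V - arrayV (t p) (e p) (s p)| + |sampleMean (t p) + sampleMean (e p)|
            + (sampleMean (t p) + sampleMean (e p)) ^ 2) *
          (s p i * momWeight (t p i) (u p i))) := by
          gcongr
          refine (abs_sampleMean_le _).trans (sampleMean_mono fun i => ?_)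
          exact abs_score_sub_le hv hW (by linarith) (hs i)
      _ = _ := by
          rw [sampleMean_const_mul, sampleMean_add, sampleMean_const_mul]
          ring
  -- the terms of first order
  have hcu := H.bdd_u _ H.tendsto_center
  have hce := H.tendsto_center.mul H.lim_e
  -- Centering the regressor changes the scaled score by √n h̄ · ḡ, a bounded factor times a null
  -- one.
  have hsm := H.bdd_shrunk.mul_tendsto_zero (H.tendsto_regError β)
  have h := (((hR.add H.lim_eu).sub hcu).sub H.lim_shrink_tu).add
    ((((H.lim_shrink_t_sq.sub H.lim_q).sub H.lim_te).add hce).const_mul β) |>.sub hsm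
  simp only [add_zero, sub_zero, mul_zero] at h
  refine h.congr fun p => ?_
  rw [sampleMean_centered_mul, sampleMean_sub, sampleMean_add, sampleMean_sub, sampleMean_sub,
    sampleMean_add, sampleMean_const_mul, sampleMean_const_mul, sampleMean_add, sampleMean_sub,
    sampleMean_sub, sampleMean_const_mul]
  ring

end ArrayLimits

/-- Fourth powers are controlled by third moments alone: the hypothesis gives Σ|eᵢ|³ ≤ √n, so every
|eᵢ| is at most √n, and one factor can be pulled out of the fourth power. -/
lemma sampleMean_pow_four_le {n : ℕ} (hn : 0 < n) {e : Fin n → ℝ}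
    (h : √n * (sampleMean fun i => |e i| ^ 3) ≤ 1) :
    (sampleMean fun i => e i ^ 4) ≤ √n * sampleMean fun i => |e i| ^ 3 := by
  have hn1 : (1 : ℝ) ≤ √n := Real.one_le_sqrt.2 (by exact_mod_cast hn)
  have hsq : √(n : ℝ) * √n = n := Real.mul_self_sqrt (Nat.cast_nonneg n)
  have hn0 : (0 : ℝ) < n := by exact_mod_cast hn
  have hsum : ∑ i, |e i| ^ 3 ≤ √n := by
    unfold sampleMean at h
    rw [← mul_div_assoc, div_le_one hn0] at h
    nlinarith
  have he : ∀ i, |e i| ≤ √n := fun i => by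
    have h1 : |e i| ^ 3 ≤ √n :=
      (Finset.single_le_sum (f := fun i => |e i| ^ 3) (fun j _ => by positivity)
        (Finset.mem_univ i)).trans hsum
    by_contra hc
    push Not at hc
    have h2 : 1 ≤ |e i| := hn1.trans hc.le
    have h3 : |e i| ≤ |e i| ^ 3 := le_self_pow₀ h2 (by norm_num)
    linarith
  rw [← sampleMean_const_mul]
  refine sampleMean_mono fun i => ?_
  rw [← Even.pow_abs (by decide : Even 4) (e i)]
  calc |e i| ^ 4 = |e i| * |e i| ^ 3 := by ring
    _ ≤ √n * |e i| ^ 3 := by gcongr; exact he i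

/-- A perturbation of both factors that vanishes in fourth mean does not change the limit of the
mean squared product. -/
lemma tendsto_sampleMean_mul_sq {ι : Type*} {l : Filter ι} {N : ι → ℕ}
    {x y a b : ∀ p, Fin (N p) → ℝ} {τ : ℝ}
    (hxy : Tendsto (fun p => sampleMean fun i => (x p i * y p i) ^ 2) l (𝓝 τ))
    (hx : StochBdd l fun p => sampleMean fun i => x p i ^ 4)
    (hy : StochBdd l fun p => sampleMean fun i => y p i ^ 4)
    (ha : Tendsto (fun p => sampleMean fun i => a p i ^ 4) l (𝓝 0))
    (hb : Tendsto (fun p => sampleMean fun i => b p i ^ 4) l (𝓝 0)) :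
    Tendsto (fun p => sampleMean fun i => (x p i + a p i) ^ 2 * (y p i + b p i) ^ 2) l (𝓝 τ) := by
  have key : ∀ {z w : ∀ p, Fin (N p) → ℝ},
      Tendsto (fun p => sampleMean fun i => z p i ^ 4) l (𝓝 0) →
      (StochBdd l fun p => sampleMean fun i => w p i ^ 4) →
      Tendsto (fun p => sampleMean fun i => z p i ^ 2 * w p i ^ 2) l (𝓝 0) := by
    intro z w hz hw
    refine tendsto_sampleMean_mul_zero ?_ ?_
    · simpa only [← pow_mul] using hz
    · simpa only [← pow_mul] using hw
  have h1 := key ha hy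
  have h2 := key hb hx
  have h3 := key ha (.of_tendsto hb)
  -- the perturbation of the product vanishes in mean square
  have hB : Tendsto (fun p => sampleMean fun i =>
      (a p i * y p i + x p i * b p i + a p i * b p i) ^ 2) l (𝓝 0) := by
    have h4 := ((h1.add h2).add h3).const_mul 3
    simp only [add_zero, mul_zero] at h4
    refine tendsto_of_tendsto_of_tendsto_of_le_of_le tendsto_const_nhds h4
      (fun p => sampleMean_nonneg fun i => sq_nonneg _) fun p => ?_
    dsimp only
    rw [← sampleMean_add, ← sampleMean_add, ← sampleMean_const_mul]
    refine sampleMean_mono fun i => ?_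
    have := add_sub_sq_le (a p i * y p i) (x p i * b p i) (-(a p i * b p i))
    rw [sub_neg_eq_add] at this
    refine this.trans (le_of_eq ?_)
    ring
  have hAB := tendsto_sampleMean_mul_zero hB (.of_tendsto hxy)
  have h := (hxy.add (hAB.const_mul 2)).add hB
  simp only [add_zero, mul_zero] at h
  refine h.congr fun p => ?_
  rw [← sampleMean_const_mul, ← sampleMean_add, ← sampleMean_add]
  congr 1; ext i; ring

/-! ### Fourth-mean approximation, slope and variance estimator -/

namespace ArrayLimits

variable {ι : Type*} {l : Filter ι} {N : ι → ℕ} {t u e s : ∀ p, Fin (N p) → ℝ} {V τ : ℝ}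
  (H : ArrayLimits l N t u e s V τ)

include H

/-- No fourth moment of ε is assumed; the limit comes from √n times the average of |e|³, which is
null. -/
lemma tendsto_noise_four : Tendsto (fun p => sampleMean fun i => e p i ^ 4) l (𝓝 0) := by
  have h1 : ∀ᶠ p in l, √(N p) * (sampleMean fun i => |e p i| ^ 3) ≤ √(N p) * sampleMean fun i =>
      noiseSize (e p i) (s p i) * momWeight (t p i) (u p i) := by
    filter_upwards [H.s_nonneg] with p hs
    gcongr
    refine sampleMean_mono fun i => (abs_cube_le_noiseSize (hs i)).trans ?_
    exact le_mul_of_one_le_right (noiseSize_nonneg (hs i)) (one_le_momWeight _ _)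
  refine tendsto_of_tendsto_of_tendsto_of_le_of_le' tendsto_const_nhds H.lim_rF
    (Eventually.of_forall fun p => sampleMean_nonneg fun i => by positivity) ?_
  filter_upwards [h1, H.lim_rF.eventually_le_const zero_lt_one, H.eventually_pos] with p hp hp1 hN
  exact (sampleMean_pow_four_le hN (hp.trans hp1)).trans hp

/-- The regressor approximates the centered effect in fourth mean. -/
lemma tendsto_regressor_sub_four : Tendsto (fun p => sampleMean fun i =>
    (shrunk (t p) (e p) (s p) i - sampleMean (shrunk (t p) (e p) (s p)) - t p i) ^ 4) l (𝓝 0) := by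
  have hv := half_pos H.V_pos
  have hB : Tendsto (fun p => 64 * ((sampleMean fun i => e p i ^ 4)
      + 64 * (shrinkConst (V / 2) * (sampleMean fun i => s p i * momWeight (t p i) (u p i))
        + (sampleMean fun i => e p i ^ 4) + (sampleMean (t p) + sampleMean (e p)) ^ 4)
      + (sampleMean (t p) + sampleMean (e p) + sampleMean (shrunk (t p) (e p) (s p))) ^ 4))
      l (𝓝 0) := by
    have h := ((H.tendsto_noise_four.add (((((H.tendsto_sF.const_mul (shrinkConst (V / 2))).add
      H.tendsto_noise_four).add (H.tendsto_center.pow 4))).const_mul 64)).add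
      ((H.tendsto_center.add H.tendsto_shrunk).pow 4)).const_mul 64
    simpa using h
  refine tendsto_of_tendsto_of_tendsto_of_le_of_le' tendsto_const_nhds hB
    (Eventually.of_forall fun p => sampleMean_nonneg fun i => by positivity) ?_
  filter_upwards [H.s_nonneg, H.eventually_half_le, H.eventually_pos] with p hs hW hN
  have hle : ∀ i, (shrunk (t p) (e p) (s p) i - sampleMean (shrunk (t p) (e p) (s p)) - t p i) ^ 4
      ≤ 64 * (e p i ^ 4 + 64 * (shrinkConst (V / 2) * (s p i * momWeight (t p i) (u p i))
        + e p i ^ 4 + (sampleMean (t p) + sampleMean (e p)) ^ 4)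
      + (sampleMean (t p) + sampleMean (e p) + sampleMean (shrunk (t p) (e p) (s p))) ^ 4) := by
    intro i
    have h1 := shrink_mul_pow_four_le (t := t p i) (e := e p i) (u := u p i)
      (c := sampleMean (t p) + sampleMean (e p)) hv hW (hs i)
    change (shrinkage (t p) (e p) (s p) i * centeredMean (t p) (e p) i) ^ 4 ≤ _ at h1
    have h2 := add_three_pow_four_le (e p i)
      (-(shrinkage (t p) (e p) (s p) i * centeredMean (t p) (e p) i))
      (-(sampleMean (t p) + sampleMean (e p) + sampleMean (shrunk (t p) (e p) (s p))))
    rw [Even.neg_pow (by decide : Even 4), Even.neg_pow (by decide : Even 4)] at h2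
    have h3 : shrunk (t p) (e p) (s p) i - sampleMean (shrunk (t p) (e p) (s p)) - t p i =
        e p i + -(shrinkage (t p) (e p) (s p) i * centeredMean (t p) (e p) i)
        + -(sampleMean (t p) + sampleMean (e p) + sampleMean (shrunk (t p) (e p) (s p))) := by
      unfold shrunk
      have : centeredMean (t p) (e p) i = t p i + e p i - (sampleMean (t p) + sampleMean (e p)) :=
        rfl
      linear_combination this
    rw [h3]
    linarith
  refine (sampleMean_mono hle).trans (le_of_eq ?_)
  rw [sampleMean_const_mul, sampleMean_add, sampleMean_add, sampleMean_const_mul, sampleMean_add,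
    sampleMean_add, sampleMean_const_mul, sampleMean_const hN, sampleMean_const hN]

/-- The normalized estimation error of the slope. -/
lemma tendsto_slope (β : ℝ) : Tendsto (fun p => √(N p) * ((sampleMean fun i =>
      (shrunk (t p) (e p) (s p) i - sampleMean (shrunk (t p) (e p) (s p))) *
        regError β (t p) (u p) (e p) (s p) i) / (sampleMean fun i =>
      (shrunk (t p) (e p) (s p) i - sampleMean (shrunk (t p) (e p) (s p))) ^ 2))
    - (√(N p) * sampleMean fun i => t p i * u p i) / V) l (𝓝 0) := by
  have hD := H.tendsto_regressor_variance.inv₀ H.V_pos.ne'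
  have h1 := (H.tendsto_score β).mul hD
  have hD0 := hD.sub_const V⁻¹
  rw [sub_self] at hD0
  have h2 := H.bdd_tu.mul_tendsto_zero hD0
  have h := h1.add h2
  simp only [zero_mul, add_zero] at h
  refine h.congr fun p => ?_
  simp only [div_eq_mul_inv]
  ring

lemma tendsto_slope_zero (β : ℝ) : Tendsto (fun p => (sampleMean fun i =>
      (shrunk (t p) (e p) (s p) i - sampleMean (shrunk (t p) (e p) (s p))) *
        regError β (t p) (u p) (e p) (s p) i) / (sampleMean fun i =>
      (shrunk (t p) (e p) (s p) i - sampleMean (shrunk (t p) (e p) (s p))) ^ 2)) l (𝓝 0) := by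
  refine H.tendsto_zero_of_sqrt_mul ?_
  refine ((StochBdd.of_tendsto (H.tendsto_slope β)).add (H.bdd_tu.const_mul V⁻¹)).congr ?_
  refine Eventually.of_forall fun p => ?_
  simp only [div_eq_mul_inv]
  ring

/-- The numerator of the variance estimator is consistent. -/
lemma tendsto_ehw_numerator (β : ℝ) : Tendsto (fun p => sampleMean fun i =>
    (shrunk (t p) (e p) (s p) i - sampleMean (shrunk (t p) (e p) (s p))) ^ 2 *
      (regError β (t p) (u p) (e p) (s p) i - sampleMean (regError β (t p) (u p) (e p) (s p))
        - (sampleMean fun i => (shrunk (t p) (e p) (s p) i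
              - sampleMean (shrunk (t p) (e p) (s p))) * regError β (t p) (u p) (e p) (s p) i) /
            (sampleMean fun i => (shrunk (t p) (e p) (s p) i
              - sampleMean (shrunk (t p) (e p) (s p))) ^ 2)
          * (shrunk (t p) (e p) (s p) i - sampleMean (shrunk (t p) (e p) (s p)))) ^ 2)
    l (𝓝 τ) := by
  have hδ := H.tendsto_regressor_sub_four
  have hρ := H.tendsto_slope_zero β
  have hg := H.tendsto_regError β
  set h : ∀ p, Fin (N p) → ℝ := fun p => shrunk (t p) (e p) (s p)
  set g : ∀ p, Fin (N p) → ℝ := fun p => regError β (t p) (u p) (e p) (s p)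
  set ρ : ι → ℝ := fun p => (sampleMean fun i => (h p i - sampleMean (h p)) * g p i) /
    (sampleMean fun i => (h p i - sampleMean (h p)) ^ 2)
  have hη : Tendsto (fun p => sampleMean fun i =>
      (g p i - sampleMean (g p) - ρ p * (h p i - sampleMean (h p)) - u p i) ^ 4) l (𝓝 0) := by
    -- the residual error in terms of the approximation error of the regressor
    have hid : ∀ p i, g p i - sampleMean (g p) - ρ p * (h p i - sampleMean (h p)) - u p i =
        (-(β + ρ p)) * (h p i - sampleMean (h p) - t p i) + (-ρ p) * t p i
          + (-(β * (sampleMean (t p) + sampleMean (e p) + sampleMean (h p))) - sampleMean (g p)) := by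
      intro p i
      -- Since b(t + e − c) − e = t − c − h, the regression error approximates u as closely as the
      -- regressor approximates t.
      have h1 : g p i = u p i + β * (t p i - (sampleMean (t p) + sampleMean (e p)) - h p i) := by
        simp only [g, h, regError, shrunk, centeredMean]
        ring
      rw [h1]; ring
    have hB := (((((hρ.const_add β).neg.pow 4).mul hδ).add
      (H.bdd_t_four _ (by simpa using (hρ.neg.pow 4) : Tendsto (fun p => (-ρ p) ^ 4) l (𝓝 0)))).add
      (((((H.tendsto_center.add H.tendsto_shrunk).const_mul β).neg).sub hg).pow 4)).const_mul 64
    simp only [mul_zero, add_zero, neg_zero, sub_zero, ne_eq, OfNat.ofNat_ne_zero,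
      not_false_eq_true, zero_pow] at hB
    refine tendsto_of_tendsto_of_tendsto_of_le_of_le' tendsto_const_nhds hB
      (Eventually.of_forall fun p => sampleMean_nonneg fun i => by positivity) ?_
    filter_upwards [H.eventually_pos] with p hN
    rw [← sampleMean_const_mul, ← sampleMean_const_mul, ← sampleMean_add]
    change _ ≤ 64 * (_ + (-(β * (sampleMean (t p) + sampleMean (e p)
      + sampleMean (h p))) - sampleMean (g p)) ^ 4)
    rw [← sampleMean_const hN ((-(β * (sampleMean (t p) + sampleMean (e p)
      + sampleMean (h p))) - sampleMean (g p)) ^ 4), ← sampleMean_add, ← sampleMean_const_mul]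
    refine sampleMean_mono fun i => ?_
    rw [hid p i, ← mul_pow, ← mul_pow]
    exact add_three_pow_four_le _ _ _
  refine (tendsto_sampleMean_mul_sq H.lim_tu_sq H.bdd_t_four H.bdd_u_four hδ hη).congr fun p => ?_
  congr 1; ext i
  simp only [h, g, ρ]
  ring

end ArrayLimits

/-! ### Conditional independence and the conditional laws -/

section CondIndep

variable {Ω : Type*} {m mΩ : MeasurableSpace Ω} [StandardBorelSpace Ω] {hm : m ≤ mΩ}
  {μ : Measure Ω} [IsFiniteMeasure μ]

/-- A conditionally independent sequence of real random variables is independent under almost every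
conditional law. -/
lemma ae_iIndepFun_condExpKernel {f : ℕ → Ω → ℝ} (hf : ∀ i, Measurable (f i))
    (h : iCondIndepFun m hm f μ) : ∀ᵐ ω ∂μ, iIndepFun f (condExpKernel μ m ω) := by
  -- Half-lines with rational endpoints form a π-system that generates the Borel sets, and finitely
  -- supported choices of endpoints are countable. One null set therefore serves every finite
  -- intersection.
  have h1 : ∀ᵐ ω ∂(μ.trim hm), ∀ (S : Finset ℕ) (q : ℕ →₀ ℚ),
      condExpKernel μ m ω (⋂ i ∈ S, f i ⁻¹' Set.Iic (q i : ℝ)) =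
        ∏ i ∈ S, condExpKernel μ m ω (f i ⁻¹' Set.Iic (q i : ℝ)) := by
    rw [ae_all_iff]; intro S
    rw [ae_all_iff]; intro q
    exact Kernel.iIndepFun.meas_biInter h fun i _ => ⟨_, measurableSet_Iic, rfl⟩
  filter_upwards [ae_of_ae_trim hm h1] with ω hω
  refine iIndepSets.iIndep (m := fun i => MeasurableSpace.comap (f i) inferInstance)
    (fun i => (hf i).comap_le)
    (fun i => {s | ∃ t ∈ (⋃ a : ℚ, {Set.Iic (a : ℝ)} : Set (Set ℝ)), f i ⁻¹' t = s})
    (fun i => Real.isPiSystem_Iic_rat.comap (f i)) (fun i => ?_) ?_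
  · rw [show (inferInstance : MeasurableSpace ℝ) = borel ℝ from BorelSpace.measurable_eq,
      Real.borel_eq_generateFrom_Iic_rat, MeasurableSpace.comap_generateFrom]
    rfl
  · rw [iIndepSets_iff]
    intro S g hg
    have hg' : ∀ i, ∃ q : ℚ, i ∈ S → g i = f i ⁻¹' Set.Iic (q : ℝ) := by
      intro i
      by_cases hi : i ∈ S
      · obtain ⟨t, ht, hti⟩ := hg i hi
        obtain ⟨q, hq⟩ := Set.mem_iUnion.1 ht
        rw [Set.mem_singleton_iff] at hq
        exact ⟨q, fun _ => by rw [← hti, hq]⟩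
      · exact ⟨0, fun h => absurd h hi⟩
    choose q hq using hg'
    have h2 := hω S (Finsupp.onFinset S (fun i => if i ∈ S then q i else 0) (by aesop))
    have h3 : ∀ i ∈ S, f i ⁻¹' Set.Iic ((Finsupp.onFinset S (fun i => if i ∈ S then q i else 0)
        (by aesop) i : ℚ) : ℝ) = g i := by
      intro i hi
      rw [hq i hi]
      simp [hi]
    rwa [Set.iInter₂_congr h3, Finset.prod_congr rfl fun i hi => by rw [h3 i hi]] at h2

/-- The tower property for nonnegative functions, stated without integrability so that it can be
used to prove integrability. -/
lemma lintegral_condExpKernel (hm : m ≤ mΩ) {f : Ω → ENNReal} (hf : Measurable f) :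
    ∫⁻ ω, ∫⁻ y, f y ∂(condExpKernel μ m ω) ∂μ = ∫⁻ ω, f ω ∂μ := by
  have h := condExpKernel_comp_trim (μ := μ) hm
  conv_rhs => rw [← h]
  rw [Measure.lintegral_bind (Kernel.aemeasurable _) hf.aemeasurable, lintegral_trim hm]
  exact Measurable.lintegral_kernel hf

end CondIndep

/-! ### Sums of independent centered variables -/

/-- The `U`-statistic sum `∑_{k<j<m} xₖ xⱼ`. -/
def pairSum (x : ℕ → ℝ) (m : ℕ) : ℝ := ∑ j ∈ Finset.range m, x j * ∑ k ∈ Finset.range j, x k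

lemma sq_sum_eq (x : ℕ → ℝ) (m : ℕ) :
    (∑ j ∈ Finset.range m, x j) ^ 2 = ∑ j ∈ Finset.range m, x j ^ 2 + 2 * pairSum x m := by
  induction m with
  | zero => simp [pairSum]
  | succ m ih =>
    unfold pairSum at *
    rw [Finset.sum_range_succ, Finset.sum_range_succ, Finset.sum_range_succ, add_sq, ih]
    ring

/-- The estimated variance of the individual mean noise. -/
def noiseVar (m : ℕ) (x : ℕ → ℝ) : ℝ := (1 / (m : ℝ)) * unitVar m x

lemma noiseVar_eq {m : ℕ} (hm : 3 ≤ m) (x : ℕ → ℝ) :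
    noiseVar m x = (∑ j ∈ Finset.range m, x j ^ 2 - (∑ j ∈ Finset.range m, x j) ^ 2 / m)
      / (m * (m - 1)) := by
  have h3 : (3 : ℝ) ≤ m := by exact_mod_cast hm
  have h0 : (m : ℝ) ≠ 0 := by positivity
  have h1 : (m : ℝ) - 1 ≠ 0 := by linarith
  have h : ∑ j ∈ Finset.range m, (x j - unitMean m x) ^ 2 =
      ∑ j ∈ Finset.range m, x j ^ 2 - (∑ j ∈ Finset.range m, x j) ^ 2 / m := by
    have h2 : ∀ j, (x j - unitMean m x) ^ 2 =
        x j ^ 2 - 2 * unitMean m x * x j + unitMean m x ^ 2 := fun j => by ring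
    simp_rw [h2]
    rw [Finset.sum_add_distrib, Finset.sum_sub_distrib, ← Finset.mul_sum]
    simp only [Finset.sum_const, Finset.card_range, nsmul_eq_mul]
    unfold unitMean
    field_simp
    ring
  unfold noiseVar unitVar
  rw [h]
  field_simp

/-- The squares x_j² cancel and only products of distinct noises remain. The difference is thus a
degenerate U-statistic: centered, with a second moment that needs only variances. -/
lemma unitMean_sq_sub_noiseVar {m : ℕ} (hm : 3 ≤ m) (x : ℕ → ℝ) :
    unitMean m x ^ 2 - noiseVar m x = 2 * pairSum x m / (m * (m - 1)) := by
  have h3 : (3 : ℝ) ≤ m := by exact_mod_cast hm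
  have h0 : (m : ℝ) ≠ 0 := by positivity
  have h1 : (m : ℝ) - 1 ≠ 0 := by linarith
  rw [noiseVar_eq hm, show ∑ j ∈ Finset.range m, x j ^ 2 =
    (∑ j ∈ Finset.range m, x j) ^ 2 - 2 * pairSum x m by rw [sq_sum_eq]; ring]
  unfold unitMean
  field_simp
  ring

lemma noiseVar_nonneg {m : ℕ} (hm : 3 ≤ m) (x : ℕ → ℝ) : 0 ≤ noiseVar m x := by
  have h3 : (3 : ℝ) ≤ m := by exact_mod_cast hm
  unfold noiseVar unitVar
  have : 0 ≤ (m : ℝ) - 1 := by linarith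
  positivity

section Independent

variable {Ω : Type*} [MeasurableSpace Ω] {ν : Measure Ω}
  {f : ℕ → Ω → ℝ} {v : ℝ}

/-- The noise k is independent of any statistic of the earlier noises; this drives both inductions
over the number of terms. -/
lemma indepFun_comp_range (hf : ∀ i, Measurable (f i)) (hi : iIndepFun f ν) (k : ℕ)
    {g : (ℕ → ℝ) → ℝ} (hg : Measurable g)
    (hgk : ∀ x y : ℕ → ℝ, (∀ j < k, x j = y j) → g x = g y) :
    IndepFun (fun ω => g fun j => f j ω) (f k) ν := by
  have h1 := hi.indepFun_finset (Finset.range k) {k} (by simp) hf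
  -- Padding by zero is harmless, because `g` sees only the coordinates below k.
  let ext : (Finset.range k → ℝ) → ℕ → ℝ := fun x j => if h : j ∈ Finset.range k then x ⟨j, h⟩ else 0
  have hext : Measurable ext := by
    refine measurable_pi_lambda _ fun j => ?_
    by_cases h : j ∈ Finset.range k
    · simp only [ext, h, dite_true]; exact measurable_pi_apply _
    · simp only [ext, h, dite_false]; exact measurable_const
  have hψ : Measurable fun x : (({k} : Finset ℕ) → ℝ) => x ⟨k, Finset.mem_singleton_self k⟩ :=
    measurable_pi_apply _
  have h2 := h1.comp (φ := fun x => g (ext x))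
    (ψ := fun x : (({k} : Finset ℕ) → ℝ) => x ⟨k, Finset.mem_singleton_self k⟩)
    (hg.comp hext) hψ
  have h3 : (fun ω => g fun j => f j ω) =
      (fun x => g (ext x)) ∘ fun a (i : Finset.range k) => f i a := by
    ext ω
    refine hgk _ _ fun j hj => ?_
    simp [ext, hj]
  rw [h3]
  exact h2

variable (hf : ∀ i, Measurable (f i)) (hi : iIndepFun f ν) (h0 : ∀ i, ∫ ω, f i ω ∂ν = 0)
  (h2 : ∀ i, MemLp (f i) 2 ν) (hv : ∀ i, ∫ ω, f i ω ^ 2 ∂ν = v)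

include hf hi h0 h2 hv

lemma integral_sum_sq_of_indep (k : ℕ) :
    MemLp (fun ω => ∑ j ∈ Finset.range k, f j ω) 2 ν ∧
      ∫ ω, (∑ j ∈ Finset.range k, f j ω) ^ 2 ∂ν = k * v := by
  induction k with
  | zero => simp
  | succ k ih =>
    have hind : IndepFun (fun ω => ∑ j ∈ Finset.range k, f j ω) (f k) ν :=
      indepFun_comp_range hf hi k (g := fun x => ∑ j ∈ Finset.range k, x j) (by fun_prop)
        fun x y h => Finset.sum_congr rfl fun j hj => h j (Finset.mem_range.1 hj)
    have hint := hind.integral_fun_mul_eq_mul_integral (by fun_prop) (by fun_prop)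
    rw [h0 k, mul_zero] at hint
    constructor
    · simp_rw [Finset.sum_range_succ]
      exact ih.1.add (h2 k)
    · have hprod : Integrable (fun ω => (∑ j ∈ Finset.range k, f j ω) * f k ω) ν :=
        ih.1.integrable_mul (h2 k)
      simp_rw [Finset.sum_range_succ, add_sq, mul_assoc]
      rw [integral_add, integral_add, ih.2, hv k, integral_const_mul, hint]
      · push_cast; ring
      · exact ih.1.integrable_sq
      · exact hprod.const_mul 2
      · exact (ih.1.integrable_sq).add (hprod.const_mul 2)
      · exact (h2 k).integrable_sq

/-- The increment f_k Σ_{j<k} f_j is orthogonal to the past and has second moment k v². Summing over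
k gives k(k − 1)/2 · v². -/
lemma integral_pairSum_of_indep [IsProbabilityMeasure ν] (k : ℕ) :
    MemLp (fun ω => pairSum (fun j => f j ω) k) 2 ν ∧
      ∫ ω, pairSum (fun j => f j ω) k ∂ν = 0 ∧
      ∫ ω, pairSum (fun j => f j ω) k ^ 2 ∂ν = k * (k - 1) / 2 * v ^ 2 := by
  induction k with
  | zero => simp [pairSum]
  | succ k ih =>
    have hS := integral_sum_sq_of_indep hf hi h0 h2 hv k
    have hstep : ∀ ω, pairSum (fun j => f j ω) (k + 1) = pairSum (fun j => f j ω) k +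
        (∑ j ∈ Finset.range k, f j ω) * f k ω := fun ω => by
      unfold pairSum; rw [Finset.sum_range_succ, mul_comm (f k ω)]
    have hpm : Measurable fun x : ℕ → ℝ => pairSum x k := by unfold pairSum; fun_prop
    have hpe : ∀ x y : ℕ → ℝ, (∀ j < k, x j = y j) → pairSum x k = pairSum y k := by
      intro x y h
      refine Finset.sum_congr rfl fun j hj => ?_
      rw [Finset.mem_range] at hj
      rw [h j hj, Finset.sum_congr rfl fun i hi => h i ((Finset.mem_range.1 hi).trans hj)]
    have hse : ∀ x y : ℕ → ℝ, (∀ j < k, x j = y j) →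
        ∑ j ∈ Finset.range k, x j = ∑ j ∈ Finset.range k, y j :=
      fun x y h => Finset.sum_congr rfl fun j hj => h j (Finset.mem_range.1 hj)
    have hind1 : IndepFun (fun ω => ∑ j ∈ Finset.range k, f j ω) (f k) ν :=
      indepFun_comp_range hf hi k (g := fun x => ∑ j ∈ Finset.range k, x j) (by fun_prop) hse
    have hind2 : IndepFun (fun ω => pairSum (fun j => f j ω) k * ∑ j ∈ Finset.range k, f j ω)
        (f k) ν :=
      indepFun_comp_range hf hi k (g := fun x => pairSum x k * ∑ j ∈ Finset.range k, x j)
        (hpm.mul (by fun_prop)) fun x y h => by rw [hpe x y h, hse x y h]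
    have hsq : IndepFun (fun ω => (∑ j ∈ Finset.range k, f j ω) ^ 2) (fun ω => f k ω ^ 2) ν :=
      hind1.comp (φ := fun x => x ^ 2) (ψ := fun x => x ^ 2) (by fun_prop) (by fun_prop)
    have hpf : Measurable fun ω => pairSum (fun j => f j ω) k :=
      hpm.comp (measurable_pi_lambda _ hf)
    -- Independence makes the product square integrable without any fourth moment.
    have hprod2 : MemLp (fun ω => (∑ j ∈ Finset.range k, f j ω) * f k ω) 2 ν := by
      rw [memLp_two_iff_integrable_sq (by fun_prop)]
      simp_rw [mul_pow]
      exact hsq.integrable_mul hS.1.integrable_sq (h2 k).integrable_sq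
    have e1 := hind1.integral_fun_mul_eq_mul_integral (by fun_prop) (by fun_prop)
    rw [h0 k, mul_zero] at e1
    have e2 := hind2.integral_fun_mul_eq_mul_integral
      (hpf.mul (by fun_prop)).aestronglyMeasurable (by fun_prop)
    rw [h0 k, mul_zero] at e2
    have e3 := hsq.integral_fun_mul_eq_mul_integral (by fun_prop) (by fun_prop)
    rw [hS.2, hv k] at e3
    simp_rw [hstep]
    refine ⟨ih.1.add hprod2, ?_, ?_⟩
    · rw [integral_add (ih.1.integrable one_le_two) (hprod2.integrable one_le_two), ih.2.1, e1,
        add_zero]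
    · have hc : Integrable (fun ω => pairSum (fun j => f j ω) k *
          ((∑ j ∈ Finset.range k, f j ω) * f k ω)) ν := ih.1.integrable_mul hprod2
      simp_rw [add_sq, mul_assoc]
      simp_rw [mul_assoc] at e2
      rw [integral_add, integral_add, ih.2.2, integral_const_mul, e2]
      · simp_rw [mul_pow]
        rw [e3]
        push_cast; ring
      · exact ih.1.integrable_sq
      · exact hc.const_mul 2
      · exact (ih.1.integrable_sq).add (hc.const_mul 2)
      · exact hprod2.integrable_sq

end Independent

/-! ### Moments of the noise -/

lemma pow_le_one_add_rpow {x L : ℝ} (hx : 0 ≤ x) {k : ℕ} (hk : (k : ℝ) ≤ L) :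
    x ^ k ≤ 1 + x ^ L := by
  rcases le_total x 1 with h | h
  · have := pow_le_one₀ (n := k) hx h
    have := Real.rpow_nonneg hx L
    linarith
  · rw [← Real.rpow_natCast]
    have := Real.rpow_le_rpow_of_exponent_le h hk
    linarith

/-- Discrete Lyapunov inequality between second and third moments. -/
lemma sum_sq_mul_sqrt_le (x : ℕ → ℝ) (m : ℕ) :
    (∑ j ∈ Finset.range m, x j ^ 2) * √(∑ j ∈ Finset.range m, x j ^ 2) ≤
      √m * ∑ j ∈ Finset.range m, |x j| ^ 3 := by
  set A := ∑ j ∈ Finset.range m, x j ^ 2 with hA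
  set B := ∑ j ∈ Finset.range m, |x j| ^ 3
  set D := ∑ j ∈ Finset.range m, |x j|
  have hA0 : 0 ≤ A := Finset.sum_nonneg fun _ _ => sq_nonneg _
  have hB0 : 0 ≤ B := Finset.sum_nonneg fun _ _ => by positivity
  have hD0 : 0 ≤ D := Finset.sum_nonneg fun _ _ => by positivity
  -- Two uses of Cauchy–Schwarz: x² = |x|^{1/2}|x|^{3/2} gives A² ≤ D B, and |x| = 1·|x| gives D² ≤
  -- m A. Hence A⁴ ≤ m A B², and a factor A cancels.
  have h1 : A ^ 2 ≤ D * B := by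
    have h := Finset.sum_mul_sq_le_sq_mul_sq (Finset.range m) (fun j => √|x j|)
      (fun j => √|x j| * |x j|)
    have e1 : ∑ j ∈ Finset.range m, √|x j| * (√|x j| * |x j|) = A := by
      refine Finset.sum_congr rfl fun j _ => ?_
      rw [← mul_assoc, Real.mul_self_sqrt (abs_nonneg _), ← pow_two, sq_abs]
    have e2 : ∑ j ∈ Finset.range m, √|x j| ^ 2 = D :=
      Finset.sum_congr rfl fun j _ => Real.sq_sqrt (abs_nonneg _)
    have e3 : ∑ j ∈ Finset.range m, (√|x j| * |x j|) ^ 2 = B := by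
      refine Finset.sum_congr rfl fun j _ => ?_
      rw [mul_pow, Real.sq_sqrt (abs_nonneg _)]; ring
    rwa [e1, e2, e3] at h
  have h2 : D ^ 2 ≤ m * A := by
    have h := Finset.sum_mul_sq_le_sq_mul_sq (Finset.range m) (fun _ => (1 : ℝ)) (fun j => |x j|)
    simpa [A, D] using h
  have h3 : A ^ 3 ≤ m * B ^ 2 := by
    rcases hA0.eq_or_lt with h | h
    · have : A ^ 3 = 0 := by simp [← h]
      rw [this]; positivity
    · have h4 : A ^ 4 ≤ (m * A) * B ^ 2 := by
        calc A ^ 4 = (A ^ 2) ^ 2 := by ring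
          _ ≤ (D * B) ^ 2 := by gcongr
          _ = D ^ 2 * B ^ 2 := by ring
          _ ≤ _ := by gcongr
      have h5 : A * A ^ 3 ≤ A * (m * B ^ 2) := by nlinarith
      exact le_of_mul_le_mul_left h5 h
  refine abs_le_of_sq_le_sq' ?_ (by positivity) |>.2
  rw [mul_pow, mul_pow, Real.sq_sqrt hA0, Real.sq_sqrt (Nat.cast_nonneg m)]
  nlinarith

lemma noiseVar_mul_sqrt_le {m : ℕ} (hm : 3 ≤ m) (x : ℕ → ℝ) :
    noiseVar m x * √(noiseVar m x) ≤ 8 * √m / m ^ 3 * ∑ j ∈ Finset.range m, |x j| ^ 3 := by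
  have h3 : (3 : ℝ) ≤ m := by exact_mod_cast hm
  have h0 : (0 : ℝ) < m := by linarith
  set A := ∑ j ∈ Finset.range m, x j ^ 2 with hA
  have hA0 : 0 ≤ A := Finset.sum_nonneg fun _ _ => sq_nonneg _
  -- The bound 1/(m(m − 1)) ≤ 4/m² is wasteful for m ≥ 3, but as a perfect square it passes through
  -- the root.
  have h1 : noiseVar m x ≤ (2 / m) ^ 2 * A := by
    rw [noiseVar_eq hm, div_le_iff₀ (mul_pos h0 (by linarith))]
    have h4 : 0 ≤ (∑ j ∈ Finset.range m, x j) ^ 2 / m := by positivity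
    have h5 : (1 : ℝ) ≤ (2 / m) ^ 2 * (m * (m - 1)) := by
      rw [div_pow, div_mul_eq_mul_div, le_div_iff₀ (by positivity)]
      nlinarith
    calc A - _ ≤ A * 1 := by linarith
      _ ≤ A * ((2 / m) ^ 2 * (m * (m - 1))) := by gcongr
      _ = _ := by ring
  calc noiseVar m x * √(noiseVar m x) ≤ ((2 / m) ^ 2 * A) * √((2 / m) ^ 2 * A) := by
        gcongr
    _ = (2 / m) ^ 3 * (A * √A) := by
        rw [Real.sqrt_mul (by positivity), Real.sqrt_sq (by positivity)]; ring
    _ ≤ (2 / m) ^ 3 * (√m * ∑ j ∈ Finset.range m, |x j| ^ 3) := by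
        exact mul_le_mul_of_nonneg_left (sum_sq_mul_sqrt_le x m) (by positivity)
    _ = _ := by ring

/-- Either e² ≤ 2s or e² ≤ 2|e² − s|, and (√2)³ ≤ 3. The cube of e is thereby reduced to s and to
the U-statistic e² − s. -/
lemma noiseSize_le {e s : ℝ} (hs : 0 ≤ s) :
    noiseSize e s ≤ 4 * (s * √s) + 3 * (|e ^ 2 - s| * √|e ^ 2 - s|) := by
  unfold noiseSize
  have key : ∀ a : ℝ, 0 ≤ a → |e| ≤ √2 * √a → |e| ^ 3 ≤ 3 * (a * √a) := by
    intro a ha h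
    calc |e| ^ 3 ≤ (√2 * √a) ^ 3 := by gcongr
      _ = (√2 ^ 2 * √2) * (√a ^ 2 * √a) := by ring
      _ ≤ 3 * (a * √a) := by
        rw [Real.sq_sqrt ha, Real.sq_sqrt (by norm_num)]
        gcongr
        have : √2 ≤ 3 / 2 := by
          rw [Real.sqrt_le_left (by norm_num)]; norm_num
        linarith
  have h1 : 0 ≤ s * √s := by positivity
  have h2 : 0 ≤ |e ^ 2 - s| * √|e ^ 2 - s| := by positivity
  have h3 : e ^ 2 ≤ s + |e ^ 2 - s| := by linarith [le_abs_self (e ^ 2 - s)]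
  rcases le_total |e ^ 2 - s| s with h | h
  · have := key s hs (by
      rw [← Real.sqrt_mul (by norm_num), ← Real.sqrt_sq_eq_abs]
      exact Real.sqrt_le_sqrt (by linarith))
    linarith
  · have := key _ (abs_nonneg (e ^ 2 - s)) (by
      rw [← Real.sqrt_mul (by norm_num), ← Real.sqrt_sq_eq_abs]
      exact Real.sqrt_le_sqrt (by linarith))
    linarith

/-- A bound for the size of the noise of one unit with `m` measurements. -/
lemma noiseSize_le_of_three_le {m : ℕ} (hm : 3 ≤ m) (x : ℕ → ℝ) :
    noiseSize (unitMean m x) (noiseVar m x) ≤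
      32 * √m / m ^ 3 * ∑ j ∈ Finset.range m, |x j| ^ 3 +
        3 / (m * √m) * (1 + m ^ 2 * (unitMean m x ^ 2 - noiseVar m x) ^ 2) := by
  have h3 : (3 : ℝ) ≤ m := by exact_mod_cast hm
  have h0 : (0 : ℝ) < m := by linarith
  have h1 := noiseSize_le (e := unitMean m x) (noiseVar_nonneg hm x)
  have h2 := noiseVar_mul_sqrt_le hm x
  set q := unitMean m x ^ 2 - noiseVar m x
  have h4 : |q| * √|q| ≤ 1 / (m * √m) * (1 + m ^ 2 * q ^ 2) := by
    rw [one_div, inv_mul_eq_div, le_div_iff₀ (by positivity)]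
    -- With a = √(m|q|) the inequality reads a³ ≤ 1 + a⁴.
    obtain ⟨a, ha, hqa⟩ : ∃ a : ℝ, 0 ≤ a ∧ m * |q| = a ^ 2 :=
      ⟨√(m * |q|), by positivity, (Real.sq_sqrt (by positivity)).symm⟩
    have e1 : |q| * √|q| * (m * √m) = a ^ 3 := by
      calc _ = (m * |q|) * √(m * |q|) := by rw [Real.sqrt_mul h0.le]; ring
        _ = a ^ 3 := by rw [hqa, Real.sqrt_sq ha]; ring
    have e2 : (m : ℝ) ^ 2 * q ^ 2 = a ^ 4 := by
      rw [← sq_abs q, ← mul_pow, hqa]; ring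
    rw [e1, e2]
    nlinarith [sq_nonneg (a ^ 2 - a), sq_nonneg (a - 1), sq_nonneg (a ^ 2 - 1)]
  calc _ ≤ _ := h1
    _ ≤ 4 * (8 * √m / m ^ 3 * ∑ j ∈ Finset.range m, |x j| ^ 3)
        + 3 * (1 / (m * √m) * (1 + m ^ 2 * q ^ 2)) := by gcongr
    _ = _ := by ring

/-! ### Noise moments through the conditional law given σ² -/

section Noise

variable {Q : Measure Latent} [IsProbabilityMeasure Q]

/-- The conditional law given `σ²`. -/
abbrev condLaw (Q : Measure Latent) [IsProbabilityMeasure Q] :=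
  condExpKernel Q sigmaAlgSigmaSq

/-- A conditional bound is integrated by the tower property for nonnegative functions, which yields
integrability and the bound together. -/
lemma integrable_of_condLaw {F G : Latent → ℝ} (hF : Measurable F) (hF0 : ∀ z, 0 ≤ F z)
    (hG : Integrable G Q)
    (h : ∀ᵐ z ∂Q, Integrable F (condLaw Q z) ∧ ∫ y, F y ∂(condLaw Q z) ≤ G z) :
    Integrable F Q ∧ ∫ z, F z ∂Q ≤ ∫ z, G z ∂Q := by
  have hG0 : 0 ≤ᵐ[Q] G := by
    filter_upwards [h] with z hz using (integral_nonneg hF0).trans hz.2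
  have h1 : ∫⁻ z, ENNReal.ofReal (F z) ∂Q ≤ ∫⁻ z, ENNReal.ofReal (G z) ∂Q := by
    rw [← lintegral_condExpKernel Latent.measurable_sigmaSq.comap_le hF.ennreal_ofReal]
    refine lintegral_mono_ae ?_
    filter_upwards [h] with z hz
    rw [← ofReal_integral_eq_lintegral_ofReal hz.1 (ae_of_all _ hF0)]
    exact ENNReal.ofReal_le_ofReal hz.2
  rw [← ofReal_integral_eq_lintegral_ofReal hG hG0] at h1
  have hFi : Integrable F Q := by
    refine ⟨hF.aestronglyMeasurable, ?_⟩
    rw [hasFiniteIntegral_iff_ofReal (ae_of_all _ hF0)]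
    exact h1.trans_lt ENNReal.ofReal_lt_top
  refine ⟨hFi, ?_⟩
  rw [← ofReal_integral_eq_lintegral_ofReal hFi (ae_of_all _ hF0)] at h1
  exact (ENNReal.ofReal_le_ofReal_iff (integral_nonneg_of_ae hG0)).1 h1

lemma integral_eq_zero_of_condLaw {F : Latent → ℝ} (hF : Integrable F Q)
    (h : ∀ᵐ z ∂Q, ∫ y, F y ∂(condLaw Q z) = 0) : ∫ z, F z ∂Q = 0 := by
  rw [← integral_condExp Latent.measurable_sigmaSq.comap_le,
    integral_congr_ae (condExp_ae_eq_integral_condExpKernel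
      Latent.measurable_sigmaSq.comap_le hF), integral_congr_ae h, integral_zero]

lemma Latent.measurable_eps (j : ℕ) : Measurable fun z : Latent => z.eps j := by
  unfold Latent.eps; fun_prop

/-- The noise conditions, for a generic unit. -/
structure NoiseModel (Q : Measure Latent) [IsProbabilityMeasure Q] : Prop where
  condIndep_eps : iCondIndepFun sigmaAlgSigmaSq Latent.measurable_sigmaSq.comap_le
    (fun (j : ℕ) (z : Latent) => z.eps j) Q
  condMean_eps : ∀ j, Q[fun z : Latent => z.eps j | sigmaAlgSigmaSq] =ᵐ[Q] 0
  condVar_eps : ∀ j, Q[fun z : Latent => z.eps j ^ 2 | sigmaAlgSigmaSq] =ᵐ[Q] Latent.sigmaSq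
  condMoment_eps : ∃ L : ℝ, 3 ≤ L ∧ ∃ K : ℝ, ∀ j,
    Integrable (fun z : Latent => |z.eps j| ^ L) Q ∧
    Q[fun z : Latent => |z.eps j| ^ L | sigmaAlgSigmaSq] ≤ᵐ[Q] fun z => K * √z.sigmaSq ^ L
  moment_sigma : Integrable (fun z : Latent => √z.sigmaSq ^ 16) Q

namespace NoiseModel

variable (H : NoiseModel Q)

include H

lemma integrable_pow_eps (j : ℕ) {k : ℕ} (hk : k ≤ 3) :
    Integrable (fun z : Latent => |z.eps j| ^ k) Q := by
  obtain ⟨L, hL, K, h⟩ := H.condMoment_eps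
  refine ((integrable_const 1).add (h j).1).mono'
    ((Latent.measurable_eps j).abs.pow_const k).aestronglyMeasurable (ae_of_all _ fun z => ?_)
  rw [Real.norm_of_nonneg (by positivity)]
  refine pow_le_one_add_rpow (abs_nonneg _) (le_trans ?_ hL)
  exact_mod_cast hk

lemma integrable_eps (j : ℕ) : Integrable (fun z : Latent => z.eps j) Q := by
  have := H.integrable_pow_eps j (k := 1) (by norm_num)
  simp only [pow_one] at this
  exact (integrable_norm_iff (Latent.measurable_eps j).aestronglyMeasurable).1 this

lemma integrable_eps_sq (j : ℕ) : Integrable (fun z : Latent => z.eps j ^ 2) Q := by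
  simpa using H.integrable_pow_eps j (k := 2) (by norm_num)

lemma sigmaSq_nonneg : ∀ᵐ z ∂Q, 0 ≤ z.sigmaSq := by
  have h : 0 ≤ᵐ[Q] Q[fun z : Latent => z.eps 0 ^ 2 | sigmaAlgSigmaSq] :=
    condExp_nonneg (ae_of_all _ fun z => sq_nonneg _)
  filter_upwards [h, H.condVar_eps 0] with z h1 h2
  rwa [h2] at h1

lemma integrable_sqrt_sigmaSq_pow {k : ℕ} (hk : k ≤ 16) :
    Integrable (fun z : Latent => √z.sigmaSq ^ k) Q := by
  refine ((integrable_const 1).add H.moment_sigma).mono'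
    (Latent.measurable_sigmaSq.sqrt.pow_const k).aestronglyMeasurable (ae_of_all _ fun z => ?_)
  rw [Real.norm_of_nonneg (by positivity)]
  have := pow_le_one_add_rpow (Real.sqrt_nonneg z.sigmaSq) (L := (16 : ℕ)) (k := k)
    (by exact_mod_cast hk)
  rwa [Real.rpow_natCast] at this

lemma integrable_sigmaSq : Integrable Latent.sigmaSq Q := by
  refine (H.integrable_sqrt_sigmaSq_pow (k := 2) (by norm_num)).congr ?_
  filter_upwards [H.sigmaSq_nonneg] with z hz using Real.sq_sqrt hz

lemma integrable_sigmaSq_sq : Integrable (fun z : Latent => z.sigmaSq ^ 2) Q := by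
  refine (H.integrable_sqrt_sigmaSq_pow (k := 4) (by norm_num)).congr ?_
  filter_upwards [H.sigmaSq_nonneg] with z hz
  rw [show 4 = 2 * 2 from rfl, pow_mul, Real.sq_sqrt hz]

/-- Under almost every conditional law the noises are independent, centered and of variance
`σ²`. -/
lemma ae_condLaw : ∀ᵐ z ∂Q, iIndepFun (fun (j : ℕ) (y : Latent) => y.eps j) (condLaw Q z) ∧
    ∀ j, MemLp (fun y : Latent => y.eps j) 2 (condLaw Q z) ∧
      ∫ y, y.eps j ∂(condLaw Q z) = 0 ∧ ∫ y, y.eps j ^ 2 ∂(condLaw Q z) = z.sigmaSq := by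
  have hm := Latent.measurable_sigmaSq.comap_le
  have h1 : ∀ᵐ z ∂Q, ∀ j, MemLp (fun y : Latent => y.eps j) 2 (condLaw Q z) := by
    rw [ae_all_iff]; intro j
    filter_upwards [(H.integrable_eps_sq j).condExpKernel_ae (m := sigmaAlgSigmaSq)] with z hz
    exact (memLp_two_iff_integrable_sq (Latent.measurable_eps j).aestronglyMeasurable).2 hz
  have h2 : ∀ᵐ z ∂Q, ∀ j, ∫ y, y.eps j ∂(condLaw Q z) = 0 := by
    rw [ae_all_iff]; intro j
    filter_upwards [condExp_ae_eq_integral_condExpKernel hm (H.integrable_eps j),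
      H.condMean_eps j] with z hz hz'
    rw [← hz, hz', Pi.zero_apply]
  have h3 : ∀ᵐ z ∂Q, ∀ j, ∫ y, y.eps j ^ 2 ∂(condLaw Q z) = z.sigmaSq := by
    rw [ae_all_iff]; intro j
    filter_upwards [condExp_ae_eq_integral_condExpKernel hm (H.integrable_eps_sq j),
      H.condVar_eps j] with z hz hz'
    rw [← hz, hz']
  filter_upwards [ae_iIndepFun_condExpKernel Latent.measurable_eps H.condIndep_eps, h1, h2, h3]
    with z e0 e1 e2 e3
  exact ⟨e0, fun j => ⟨e1 j, e2 j, e3 j⟩⟩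

/-- The third absolute moments of the noise are bounded. -/
lemma exists_third_moment_le : ∃ C : ℝ, 0 ≤ C ∧ ∀ j, ∫ z, |z.eps j| ^ 3 ∂Q ≤ C := by
  obtain ⟨L, hL, K, h⟩ := H.condMoment_eps
  have hs3 := H.integrable_sqrt_sigmaSq_pow (k := 3) (by norm_num)
  refine ⟨∫ z, (1 + |K|) * √z.sigmaSq ^ 3 ∂Q, integral_nonneg fun z => by positivity, fun j => ?_⟩
  refine (integrable_of_condLaw ((Latent.measurable_eps j).abs.pow_const 3)
    (fun z => by positivity) (hs3.const_mul _) ?_).2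
  filter_upwards [H.ae_condLaw, H.sigmaSq_nonneg, (h j).2,
    condExp_ae_eq_integral_condExpKernel Latent.measurable_sigmaSq.comap_le (h j).1,
    (h j).1.condExpKernel_ae (m := sigmaAlgSigmaSq),
    (H.integrable_pow_eps j le_rfl).condExpKernel_ae (m := sigmaAlgSigmaSq)]
    with z h1 h0 h2 h3 h4 h5
  refine ⟨h5, ?_⟩
  rw [h3] at h2
  -- If σ² = 0, the noise vanishes almost surely under the conditional law. Otherwise |ε/σ|³ ≤ 1 +
  -- |ε/σ|^L, and the assumed bound on the L-th moment scales back to σ³.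
  rcases h0.eq_or_lt with hz | hz
  · have h6 := (h1.2 j).2.2
    rw [← hz, integral_eq_zero_iff_of_nonneg (fun y => sq_nonneg _)
      (h1.2 j).1.integrable_sq] at h6
    have h7 : ∫ y, |y.eps j| ^ 3 ∂(condLaw Q z) = 0 := by
      rw [← integral_zero Latent ℝ (μ := condLaw Q z)]
      refine integral_congr_ae ?_
      filter_upwards [h6] with y hy
      have : y.eps j = 0 := by simpa using hy
      simp [this]
    rw [h7]; positivity
  · have hσ : 0 < √z.sigmaSq := Real.sqrt_pos.2 hz
    have hσL : 0 < √z.sigmaSq ^ L := Real.rpow_pos_of_pos hσ L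
    have hle : ∀ y : Latent, |y.eps j| ^ 3 ≤
        √z.sigmaSq ^ 3 * (1 + (√z.sigmaSq ^ L)⁻¹ * |y.eps j| ^ L) := by
      intro y
      have := pow_le_one_add_rpow (x := |y.eps j| / √z.sigmaSq) (k := 3) (L := L)
        (by positivity) (by exact_mod_cast hL)
      rw [Real.div_rpow (abs_nonneg _) hσ.le, div_pow, div_le_iff₀ (by positivity)] at this
      refine this.trans (le_of_eq ?_)
      rw [div_eq_inv_mul]; ring
    calc _ ≤ ∫ y, √z.sigmaSq ^ 3 * (1 + (√z.sigmaSq ^ L)⁻¹ * |y.eps j| ^ L) ∂(condLaw Q z) :=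
          integral_mono h5 (((integrable_const 1).add (h4.const_mul _)).const_mul _) hle
      _ = √z.sigmaSq ^ 3 * (1 + (√z.sigmaSq ^ L)⁻¹ * ∫ y, |y.eps j| ^ L ∂(condLaw Q z)) := by
          rw [integral_const_mul, integral_add (integrable_const 1) (h4.const_mul _),
            integral_const_mul]
          simp
      _ ≤ √z.sigmaSq ^ 3 * (1 + (√z.sigmaSq ^ L)⁻¹ * (|K| * √z.sigmaSq ^ L)) := by
          gcongr
          exact h2.trans (mul_le_mul_of_nonneg_right (le_abs_self K) hσL.le)
      _ = (1 + |K|) * √z.sigmaSq ^ 3 := by field_simp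

lemma integral_unitMean (m : ℕ) : ∫ z : Latent, unitMean m z.eps ∂Q = 0 := by
  unfold unitMean
  rw [integral_div, integral_finsetSum _ fun j _ => H.integrable_eps j,
    Finset.sum_eq_zero, zero_div]
  intro j _
  refine integral_eq_zero_of_condLaw (H.integrable_eps j) ?_
  filter_upwards [H.ae_condLaw] with z hz using (hz.2 j).2.1

end NoiseModel

lemma Latent.measurable_unitMean (m : ℕ) : Measurable fun z : Latent => unitMean m z.eps := by
  unfold unitMean
  exact (Finset.measurable_sum _ fun j _ => Latent.measurable_eps j).div_const _

lemma Latent.measurable_noiseVar (m : ℕ) : Measurable fun z : Latent => noiseVar m z.eps := by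
  unfold noiseVar unitVar
  exact ((Finset.measurable_sum _ fun j _ => ((Latent.measurable_eps j).sub
    (Latent.measurable_unitMean m)).pow_const 2).div_const _).const_mul _

namespace NoiseModel

variable (H : NoiseModel Q)

include H

lemma integral_unitMean_sq {m : ℕ} (hm : 3 ≤ m) :
    Integrable (fun z : Latent => unitMean m z.eps ^ 2) Q ∧
      ∫ z : Latent, unitMean m z.eps ^ 2 ∂Q ≤ (∫ z, z.sigmaSq ∂Q) / m := by
  rw [← integral_div]
  refine integrable_of_condLaw ((Latent.measurable_unitMean m).pow_const 2)
    (fun z => sq_nonneg _) (H.integrable_sigmaSq.div_const _) ?_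
  filter_upwards [H.ae_condLaw] with z hz
  have h := integral_sum_sq_of_indep Latent.measurable_eps hz.1 (fun j => (hz.2 j).2.1)
    (fun j => (hz.2 j).1) (fun j => (hz.2 j).2.2) m
  unfold unitMean
  simp_rw [div_pow]
  refine ⟨h.1.integrable_sq.div_const _, ?_⟩
  rw [integral_div, h.2]
  have : (m : ℝ) ≠ 0 := by positivity
  exact le_of_eq (by field_simp)

/-- Given σ², the U-statistic is centered with second moment 2σ⁴/(m(m − 1)). The rate m^{-2} is what
makes e² − s negligible after scaling by √n. -/
lemma integral_sq_sub_noiseVar {m : ℕ} (hm : 3 ≤ m) :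
    Integrable (fun z : Latent => (unitMean m z.eps ^ 2 - noiseVar m z.eps) ^ 2) Q ∧
      ∫ z : Latent, (unitMean m z.eps ^ 2 - noiseVar m z.eps) ^ 2 ∂Q ≤
        3 * (∫ z, z.sigmaSq ^ 2 ∂Q) / m ^ 2 ∧
      ∫ z : Latent, (unitMean m z.eps ^ 2 - noiseVar m z.eps) ∂Q = 0 := by
  have h3 : (3 : ℝ) ≤ m := by exact_mod_cast hm
  have hm1 : (0 : ℝ) < m - 1 := by linarith
  have hcond : ∀ᵐ z ∂Q, Integrable (fun y : Latent =>
        (unitMean m y.eps ^ 2 - noiseVar m y.eps) ^ 2) (condLaw Q z) ∧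
      ∫ y, (unitMean m y.eps ^ 2 - noiseVar m y.eps) ^ 2 ∂(condLaw Q z)
        ≤ 3 / (m : ℝ) ^ 2 * z.sigmaSq ^ 2 ∧
      ∫ y, (unitMean m y.eps ^ 2 - noiseVar m y.eps) ∂(condLaw Q z) = 0 := by
    filter_upwards [H.ae_condLaw] with z hz
    have h := integral_pairSum_of_indep Latent.measurable_eps hz.1 (fun j => (hz.2 j).2.1)
      (fun j => (hz.2 j).1) (fun j => (hz.2 j).2.2) m
    have hq : ∀ y : Latent, unitMean m y.eps ^ 2 - noiseVar m y.eps =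
        2 / (m * (m - 1)) * pairSum (fun j => y.eps j) m := fun y => by
      rw [unitMean_sq_sub_noiseVar hm]; ring
    simp_rw [hq, mul_pow]
    refine ⟨h.1.integrable_sq.const_mul _, ?_, ?_⟩
    · rw [integral_const_mul, h.2.2]
      have : (2 / ((m : ℝ) * (m - 1))) ^ 2 * (m * (m - 1) / 2 * z.sigmaSq ^ 2) =
          2 / (m * (m - 1)) * z.sigmaSq ^ 2 := by
        field_simp
      rw [this]
      gcongr ?_ * _
      -- 2/(m(m − 1)) ≤ 3/m² holds exactly when m ≥ 3.
      rw [div_le_div_iff₀ (by positivity) (by positivity)]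
      nlinarith
    · rw [integral_const_mul, h.2.1, mul_zero]
  have hmeas := (((Latent.measurable_unitMean m).pow_const 2).sub (Latent.measurable_noiseVar m))
  have h1 := integrable_of_condLaw (hmeas.pow_const 2)
    (fun z => sq_nonneg _) (H.integrable_sigmaSq_sq.const_mul (3 / (m : ℝ) ^ 2))
    (hcond.mono fun z hz => ⟨hz.1, hz.2.1⟩)
  refine ⟨h1.1, ?_, ?_⟩
  · refine h1.2.trans (le_of_eq ?_)
    rw [integral_const_mul]; ring
  · refine integral_eq_zero_of_condLaw ?_ (hcond.mono fun z hz => hz.2.2)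
    exact ((memLp_two_iff_integrable_sq hmeas.aestronglyMeasurable).2 h1.1).integrable one_le_two

/-- Uniform moment bounds for the noise of a unit with `m ≥ 3` measurements. -/
lemma exists_moment_bounds : ∃ C : ℝ, 0 ≤ C ∧ ∀ m : ℕ, 3 ≤ m →
    (Integrable (fun z : Latent => unitMean m z.eps ^ 2) Q ∧
      ∫ z : Latent, unitMean m z.eps ^ 2 ∂Q ≤ C * (1 / m)) ∧
    (Integrable (fun z : Latent => (unitMean m z.eps ^ 2 - noiseVar m z.eps) ^ 2) Q ∧
      ∫ z : Latent, (unitMean m z.eps ^ 2 - noiseVar m z.eps) ^ 2 ∂Q ≤ C * (1 / m ^ 2)) ∧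
    (Integrable (fun z : Latent => noiseVar m z.eps) Q ∧
      ∫ z : Latent, noiseVar m z.eps ∂Q ≤ C * (1 / m)) ∧
    (Integrable (fun z : Latent => noiseSize (unitMean m z.eps) (noiseVar m z.eps)) Q ∧
      ∫ z : Latent, noiseSize (unitMean m z.eps) (noiseVar m z.eps) ∂Q ≤ C * (1 / (m * √m))) := by
  obtain ⟨C3, hC3, h3m⟩ := H.exists_third_moment_le
  set A := ∫ z, z.sigmaSq ∂Q with hA
  set B := ∫ z, z.sigmaSq ^ 2 ∂Q with hB
  have hA0 : 0 ≤ A := integral_nonneg_of_ae H.sigmaSq_nonneg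
  have hB0 : 0 ≤ B := integral_nonneg fun z => sq_nonneg _
  -- A covers E[e²] and E[s], and 9 B + 3 + 32 C3 is what the pointwise bound of the noise size
  -- integrates to, with B dominating the U-statistic as well.
  refine ⟨A + 9 * B + 3 + 32 * C3, by positivity, fun m hm => ?_⟩
  have h3 : (3 : ℝ) ≤ m := by exact_mod_cast hm
  have hm0 : (0 : ℝ) < m := by linarith
  have he := H.integral_unitMean_sq hm
  have hq := H.integral_sq_sub_noiseVar hm
  have hmeas := (((Latent.measurable_unitMean m).pow_const 2).sub (Latent.measurable_noiseVar m))
  have hqi : Integrable (fun z : Latent => unitMean m z.eps ^ 2 - noiseVar m z.eps) Q :=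
    ((memLp_two_iff_integrable_sq hmeas.aestronglyMeasurable).2 hq.1).integrable one_le_two
  have hbound : A / m ≤ (A + 9 * B + 3 + 32 * C3) * (1 / m) := by
    rw [div_eq_mul_one_div]
    gcongr
    linarith
  refine ⟨⟨he.1, he.2.trans hbound⟩, ⟨hq.1, hq.2.1.trans ?_⟩, ⟨?_, ?_⟩, ?_⟩
  · rw [div_eq_mul_one_div]
    gcongr
    linarith
  · have := he.1.sub hqi
    refine this.congr (ae_of_all _ fun z => ?_)
    simp
  -- E[s] = E[e²], because e² − s has mean zero.
  · have h : ∫ z : Latent, noiseVar m z.eps ∂Q = ∫ z : Latent, unitMean m z.eps ^ 2 ∂Q -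
        ∫ z : Latent, (unitMean m z.eps ^ 2 - noiseVar m z.eps) ∂Q := by
      rw [← integral_sub he.1 hqi]
      simp
    rw [h, hq.2.2, sub_zero]
    exact he.2.trans hbound
  · have hi3 : Integrable (fun z : Latent => ∑ j ∈ Finset.range m, |z.eps j| ^ 3) Q :=
      integrable_finsetSum _ fun j _ => H.integrable_pow_eps j le_rfl
    have hS : ∫ z : Latent, ∑ j ∈ Finset.range m, |z.eps j| ^ 3 ∂Q ≤ m * C3 := by
      rw [integral_finsetSum _ fun j _ => H.integrable_pow_eps j le_rfl]
      refine (Finset.sum_le_sum fun j _ => h3m j).trans (le_of_eq ?_)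
      simp
    have hI1 : Integrable (fun z : Latent =>
        1 + m ^ 2 * (unitMean m z.eps ^ 2 - noiseVar m z.eps) ^ 2) Q :=
      (integrable_const 1).add (hq.1.const_mul _)
    have hI2 : Integrable (fun z : Latent => 3 / (m * √m) *
        (1 + m ^ 2 * (unitMean m z.eps ^ 2 - noiseVar m z.eps) ^ 2)) Q := hI1.const_mul _
    have hG : Integrable (fun z : Latent => 32 * √m / m ^ 3 * ∑ j ∈ Finset.range m, |z.eps j| ^ 3 +
        3 / (m * √m) * (1 + m ^ 2 * (unitMean m z.eps ^ 2 - noiseVar m z.eps) ^ 2)) Q :=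
      (hi3.const_mul _).add hI2
    have hle : ∀ z : Latent, _ := fun z => noiseSize_le_of_three_le hm z.eps
    have hi : Integrable (fun z : Latent => noiseSize (unitMean m z.eps) (noiseVar m z.eps)) Q := by
      refine hG.mono' ?_ (ae_of_all _ fun z => ?_)
      · unfold noiseSize
        exact (((Latent.measurable_noiseVar m).mul (Latent.measurable_noiseVar m).sqrt).add
          ((Latent.measurable_unitMean m).abs.pow_const 3)).aestronglyMeasurable
      · rw [Real.norm_of_nonneg (noiseSize_nonneg (noiseVar_nonneg hm _))]
        exact hle z
    refine ⟨hi, (integral_mono hi hG hle).trans ?_⟩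
    rw [integral_add (hi3.const_mul _) hI2, integral_const_mul,
      integral_const_mul, integral_add (integrable_const 1) (hq.1.const_mul _),
      integral_const_mul]
    have e1 : ∫ _ : Latent, (1 : ℝ) ∂Q = 1 := by simp
    have e2 : 32 * √m / (m : ℝ) ^ 3 * (m * C3) = 32 * C3 * (1 / (m * √m)) := by
      have hs : √(m : ℝ) ^ 2 = m := Real.sq_sqrt hm0.le
      field_simp
      linear_combination C3 * hs
    have e3 : (m : ℝ) ^ 2 * (3 * B / m ^ 2) = 3 * B := by field_simp
    calc _ ≤ 32 * √m / (m : ℝ) ^ 3 * (m * C3)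
          + 3 / (m * √m) * (1 + m ^ 2 * (3 * B / m ^ 2)) := by
          rw [e1]
          gcongr
          exact hq.2.1
      _ = (9 * B + 3 + 32 * C3) * (1 / (m * √m)) := by
          rw [e2, e3]; ring
      _ ≤ _ := by gcongr; linarith

end NoiseModel

end Noise

/-! ### Joint laws of the effects, the errors and the noise -/

lemma Latent.measurable_u : Measurable Latent.u := measurable_fst.comp measurable_snd

lemma Latent.measurable_epsSeq : Measurable Latent.eps :=
  measurable_snd.comp (measurable_snd.comp measurable_snd)

/-- If `ε` is independent of `θ`, and of `u` given `θ`, then `ε` is independent of `(θ, u)`. -/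
lemma indepFun_theta_u_eps {Q : Measure Latent} [IsProbabilityMeasure Q]
    (hθ : IndepFun Latent.eps Latent.theta Q)
    (hu : CondIndepFun sigmaAlgTheta Latent.measurable_theta.comap_le Latent.u Latent.eps Q) :
    IndepFun (fun z : Latent => (z.theta, z.u)) Latent.eps Q := by
  have hm := Latent.measurable_theta.comap_le
  have key : ∀ (T A : Set ℝ) (B : Set (ℕ → ℝ)), MeasurableSet T → MeasurableSet A →
      MeasurableSet B → Q (Latent.theta ⁻¹' T ∩ Latent.u ⁻¹' A ∩ Latent.eps ⁻¹' B) =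
        Q (Latent.theta ⁻¹' T ∩ Latent.u ⁻¹' A) * Q (Latent.eps ⁻¹' B) := by
    intro T A B hT hA hB
    have hT' := Latent.measurable_theta hT
    have hA' := Latent.measurable_u hA
    have hB' := Latent.measurable_epsSeq hB
    have hTm : MeasurableSet[sigmaAlgTheta] (Latent.theta ⁻¹' T) := ⟨T, hT, rfl⟩
    have h1 := (condIndepFun_iff_condExp_inter_preimage_eq_mul Latent.measurable_u
      Latent.measurable_epsSeq).1 hu A B hA hB
    -- Independence of ε and θ makes the conditional probability of {ε ∈ B} constant, so the
    -- conditional factorization can be integrated over {θ ∈ T}.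
    have h2 : Q⟦Latent.eps ⁻¹' B | sigmaAlgTheta⟧ =ᵐ[Q] fun _ => Q.real (Latent.eps ⁻¹' B) := by
      have := condExp_indep_eq (f := (Latent.eps ⁻¹' B).indicator fun _ => (1 : ℝ))
        Latent.measurable_epsSeq.comap_le hm
        (stronglyMeasurable_const.indicator ⟨B, hB, rfl⟩) hθ
      refine this.trans (ae_of_all _ fun z => ?_)
      simp [integral_indicator hB']
    have h3 : ∀ S : Set Latent, MeasurableSet S →
        ∫ z in Latent.theta ⁻¹' T, (Q⟦S | sigmaAlgTheta⟧) z ∂Q = Q.real (Latent.theta ⁻¹' T ∩ S) := by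
      intro S hS
      rw [setIntegral_condExp hm ((integrable_const (1 : ℝ)).indicator hS) hTm,
        setIntegral_indicator hS]
      simp
    have h4 : Q.real (Latent.theta ⁻¹' T ∩ (Latent.u ⁻¹' A ∩ Latent.eps ⁻¹' B)) =
        Q.real (Latent.theta ⁻¹' T ∩ Latent.u ⁻¹' A) * Q.real (Latent.eps ⁻¹' B) := by
      rw [← h3 _ (hA'.inter hB'), ← h3 _ hA', ← integral_mul_const]
      refine integral_congr_ae (ae_restrict_of_ae ?_)
      filter_upwards [h1, h2] with z e1 e2
      rw [e1, e2]
    rw [← Set.inter_assoc] at h4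
    rw [← ENNReal.toReal_eq_toReal_iff' (measure_ne_top _ _)
      (ENNReal.mul_ne_top (measure_ne_top _ _) (measure_ne_top _ _)), ENNReal.toReal_mul]
    exact h4
  have hpair : Measurable fun z : Latent => (z.theta, z.u) :=
    Latent.measurable_theta.prodMk Latent.measurable_u
  refine IndepSets.indep hpair.comap_le Latent.measurable_epsSeq.comap_le
    (p1 := {s | ∃ t ∈ Set.image2 (· ×ˢ ·) {T : Set ℝ | MeasurableSet T} {A : Set ℝ | MeasurableSet A},
      (fun z : Latent => (z.theta, z.u)) ⁻¹' t = s})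
    (p2 := {s | ∃ t ∈ {B : Set (ℕ → ℝ) | MeasurableSet B}, Latent.eps ⁻¹' t = s})
    (isPiSystem_prod.comap _) (MeasurableSpace.isPiSystem_measurableSet.comap _) ?_ ?_ ?_
  · rw [← generateFrom_prod, MeasurableSpace.comap_generateFrom]
    rfl
  · conv_lhs => rw [← @MeasurableSpace.generateFrom_measurableSet (ℕ → ℝ) _]
    rw [MeasurableSpace.comap_generateFrom]
    rfl
  · rw [IndepSets_iff]
    rintro _ _ ⟨_, ⟨T, hT, A, hA, rfl⟩, rfl⟩ ⟨B, hB, rfl⟩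
    exact key T A B hT hA hB

/-- Products of a function of `(θ, u)` and a function of the noise and the number of
measurements. -/
def effectNoise (A : ℝ × ℝ → ℝ) (B : ℕ → (ℕ → ℝ) → ℝ) (p : Latent × ℕ) : ℝ :=
  A (p.1.theta, p.1.u) * B p.2 p.1.eps

section Product

variable {Q : Measure Latent} [IsProbabilityMeasure Q] {ρ : Measure ℕ} [SFinite ρ]
  {A : ℝ × ℝ → ℝ} {B : ℕ → (ℕ → ℝ) → ℝ} {g : ℕ → ℝ}

lemma measurable_effectNoise (hA : Measurable A) (hB : ∀ m, Measurable (B m)) :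
    Measurable (effectNoise A B) := by
  refine measurable_from_prod_countable_left fun m => ?_
  exact (hA.comp (Latent.measurable_theta.prodMk Latent.measurable_u)).mul
    ((hB m).comp Latent.measurable_epsSeq)

/-- For a fixed number m of measurements the two factors are independent and the expectation splits;
averaging over m then turns the bound C·g(m) into C·∫ g. -/
lemma integral_effectNoise
    (hind : IndepFun (fun z : Latent => (z.theta, z.u)) Latent.eps Q)
    (hρ : ∀ᵐ m ∂ρ, 3 ≤ m) (hA : Measurable A) (hB : ∀ m, Measurable (B m))
    (hAi : Integrable (fun z : Latent => A (z.theta, z.u)) Q)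
    (hBi : ∀ m, 3 ≤ m → Integrable (fun z : Latent => B m z.eps) Q)
    (hg : Integrable g ρ) {C : ℝ}
    (hC : ∀ m, 3 ≤ m → ∫ z : Latent, |B m z.eps| ∂Q ≤ C * g m) :
    Integrable (effectNoise A B) (Q.prod ρ) ∧
      ∫ p, |effectNoise A B p| ∂(Q.prod ρ) ≤
        (∫ z : Latent, |A (z.theta, z.u)| ∂Q) * (C * ∫ m, g m ∂ρ) ∧
      ((∀ m, 3 ≤ m → (∫ z : Latent, A (z.theta, z.u) ∂Q) * ∫ z : Latent, B m z.eps ∂Q = 0) →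
        ∫ p, effectNoise A B p ∂(Q.prod ρ) = 0) := by
  have hmeas := measurable_effectNoise hA hB
  have hindm : ∀ m, IndepFun (fun z : Latent => A (z.theta, z.u)) (fun z : Latent => B m z.eps) Q :=
    fun m => hind.comp hA (hB m)
  have hA1 : Integrable (fun z : Latent => |A (z.theta, z.u)|) Q := hAi.abs
  have habs : ∀ m, 3 ≤ m → ∫ z, |effectNoise A B (z, m)| ∂Q =
      (∫ z : Latent, |A (z.theta, z.u)| ∂Q) * ∫ z : Latent, |B m z.eps| ∂Q := by
    intro m hm
    have h : IndepFun (fun z : Latent => |A (z.theta, z.u)|) (fun z : Latent => |B m z.eps|) Q :=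
      (hindm m).comp (φ := fun x => |x|) (ψ := fun x => |x|) measurable_norm measurable_norm
    rw [← IndepFun.integral_fun_mul_eq_mul_integral h hA1.aestronglyMeasurable
      (hBi m hm).abs.aestronglyMeasurable]
    simp [effectNoise, abs_mul]
  have hAnn : 0 ≤ ∫ z : Latent, |A (z.theta, z.u)| ∂Q := integral_nonneg fun z => abs_nonneg _
  have hle : ∀ᵐ m ∂ρ, ∫ z, |effectNoise A B (z, m)| ∂Q ≤
      (∫ z : Latent, |A (z.theta, z.u)| ∂Q) * (C * g m) := by
    filter_upwards [hρ] with m hm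
    rw [habs m hm]
    gcongr
    exact hC m hm
  have hint : Integrable (effectNoise A B) (Q.prod ρ) := by
    rw [integrable_prod_iff' hmeas.aestronglyMeasurable]
    constructor
    · filter_upwards [hρ] with m hm
      exact (hindm m).integrable_mul hAi (hBi m hm)
    · refine ((hg.const_mul C).const_mul (∫ z : Latent, |A (z.theta, z.u)| ∂Q)).mono'
        (measurable_of_countable _).aestronglyMeasurable ?_
      filter_upwards [hle] with m hm
      rw [Real.norm_of_nonneg (integral_nonneg fun z => norm_nonneg _)]
      exact hm
  refine ⟨hint, ?_, fun h0 => ?_⟩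
  · rw [integral_prod_symm _ hint.abs, ← integral_const_mul, ← integral_const_mul]
    refine integral_mono_ae ?_ ((hg.const_mul C).const_mul _) hle
    exact hint.abs.integral_prod_right
  · rw [integral_prod_symm _ hint]
    refine integral_eq_zero_of_ae ?_
    filter_upwards [hρ] with m hm
    rw [Pi.zero_apply, ← h0 m hm]
    exact (hindm m).integral_fun_mul_eq_mul_integral hAi.aestronglyMeasurable
      (hBi m hm).aestronglyMeasurable

end Product

/-! ### Sample means of a random sample -/

/-- The sample mean of a function of the units. -/
def unitAverage {Ω : Type*} (Z : (n : ℕ) → Fin n → Ω → Latent) (J : (n : ℕ) → Fin n → Ω → ℕ)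
    (φ : Latent × ℕ → ℝ) (x : ℕ × Ω) : ℝ :=
  sampleMean fun i : Fin x.1 => φ (Z x.1 i x.2, J x.1 i x.2)

lemma unitAverage_apply {Ω : Type*} (Z : (n : ℕ) → Fin n → Ω → Latent)
    (J : (n : ℕ) → Fin n → Ω → ℕ) (φ : Latent × ℕ → ℝ) (n : ℕ) (ω : Ω) :
    unitAverage Z J φ (n, ω) = (∑ i, φ (Z n i ω, J n i ω)) / n := rfl

section Sample

variable {Ω : Type*} [MeasurableSpace Ω] {P : Measure Ω}
  {Z : (n : ℕ) → Fin n → Ω → Latent} {J : (n : ℕ) → Fin n → Ω → ℕ}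
  {Q : Measure Latent} {R : ℕ → Measure ℕ}

namespace IsRandomSample

variable (hs : IsRandomSample P Z J Q R) (hJ : ∀ n i, IndepFun (J n i) (Z n i) P)
  (h3 : ∀ n i, ∀ᵐ ω ∂P, 3 ≤ J n i ω)

include hs

lemma measurable_unit (n : ℕ) (i : Fin n) : Measurable fun ω => (Z n i ω, J n i ω) :=
  (hs.measurable_latent n i).prodMk (hs.measurable_J n i)

/-- A sample of size zero has no unit, so `R 0` is unconstrained; this is why the moment bounds are
asked only for large n. -/
lemma isProbabilityMeasure_R [IsProbabilityMeasure P] {n : ℕ} (hn : 0 < n) : IsProbabilityMeasure (R n) := by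
  rw [← hs.law_J n ⟨0, hn⟩]
  exact Measure.isProbabilityMeasure_map (hs.measurable_J n _).aemeasurable

include h3 in
lemma ae_three_le {n : ℕ} (hn : 0 < n) : ∀ᵐ m ∂(R n), 3 ≤ m := by
  rw [← hs.law_J n ⟨0, hn⟩, ae_map_iff (hs.measurable_J n _).aemeasurable
    (MeasurableSet.of_discrete)]
  exact h3 n _

variable [IsProbabilityMeasure P]

include hJ

lemma map_unit (n : ℕ) (i : Fin n) :
    P.map (fun ω => (Z n i ω, J n i ω)) = Q.prod (R n) := by
  rw [(indepFun_iff_map_prod_eq_prod_map_map (hs.measurable_latent n i).aemeasurable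
    (hs.measurable_J n i).aemeasurable).1 (hJ n i).symm, hs.law_latent, hs.law_J]

lemma integrable_comp_unit {n : ℕ} {φ : Latent × ℕ → ℝ} (hφ : Integrable φ (Q.prod (R n)))
    (i : Fin n) : Integrable (fun ω => φ (Z n i ω, J n i ω)) P := by
  rw [← hs.map_unit hJ n i] at hφ
  exact hφ.comp_measurable (hs.measurable_unit n i)

lemma integral_comp_unit {n : ℕ} {φ : Latent × ℕ → ℝ} (hφ : Measurable φ) (i : Fin n) :
    ∫ ω, φ (Z n i ω, J n i ω) ∂P = ∫ p, φ p ∂(Q.prod (R n)) := by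
  rw [← hs.map_unit hJ n i, integral_map (hs.measurable_unit n i).aemeasurable
    hφ.aestronglyMeasurable]

lemma integrable_unitAverage {n : ℕ} {φ : Latent × ℕ → ℝ} (hφ : Integrable φ (Q.prod (R n))) :
    Integrable (fun ω => unitAverage Z J φ (n, ω)) P := by
  simp only [unitAverage_apply]
  exact (integrable_finsetSum _ fun i _ => hs.integrable_comp_unit hJ hφ i).div_const _

lemma integral_abs_unitAverage_le {n : ℕ} (hn : 0 < n) {φ : Latent × ℕ → ℝ}
    (hm : Measurable φ) (hφ : Integrable φ (Q.prod (R n))) :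
    ∫ ω, |unitAverage Z J φ (n, ω)| ∂P ≤ ∫ p, |φ p| ∂(Q.prod (R n)) := by
  calc _ ≤ ∫ ω, unitAverage Z J (fun p => |φ p|) (n, ω) ∂P :=
        integral_mono (hs.integrable_unitAverage hJ hφ).abs
          (hs.integrable_unitAverage hJ hφ.abs) fun ω => abs_sampleMean_le _
    _ = _ := by
        simp only [unitAverage_apply]
        rw [integral_div, integral_finsetSum _ fun i _ => hs.integrable_comp_unit hJ hφ.abs i]
        simp_rw [hs.integral_comp_unit hJ (φ := fun p => |φ p|) (measurable_norm.comp hm)]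
        have : (n : ℝ) ≠ 0 := by positivity
        simp
        field_simp

/-- For centered summands, pairwise independence makes the second moment of √n times the average
that of a single summand; the first absolute moment is at most its root. -/
lemma integral_abs_sqrt_mul_unitAverage_le {n : ℕ} (hn : 0 < n) {φ : Latent × ℕ → ℝ}
    (hm : Measurable φ) (h2 : Integrable (fun p => φ p ^ 2) (Q.prod (R n)))
    (h0 : ∫ p, φ p ∂(Q.prod (R n)) = 0) :
    Integrable (fun ω => √n * unitAverage Z J φ (n, ω)) P ∧
    ∫ ω, |√n * unitAverage Z J φ (n, ω)| ∂P ≤ √(∫ p, φ p ^ 2 ∂(Q.prod (R n))) := by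
  have := hs.isProbabilityMeasure_R hn
  have hn' : (n : ℝ) ≠ 0 := by positivity
  have hmem : ∀ i : Fin n, MemLp (fun ω => φ (Z n i ω, J n i ω)) 2 P := fun i =>
    (memLp_two_iff_integrable_sq (hm.comp (hs.measurable_unit n i)).aestronglyMeasurable).2
      (hs.integrable_comp_unit hJ h2 i)
  have hmean : ∀ i : Fin n, ∫ ω, φ (Z n i ω, J n i ω) ∂P = 0 := fun i => by
    rw [hs.integral_comp_unit hJ hm, h0]
  have hvar : Var[∑ i : Fin n, fun ω => φ (Z n i ω, J n i ω); P] =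
      n * ∫ p, φ p ^ 2 ∂(Q.prod (R n)) := by
    rw [IndepFun.variance_sum (fun i _ => hmem i) fun i _ j _ hij =>
      ((hs.indep_units n).indepFun hij).comp hm hm]
    have : ∀ i : Fin n, Var[fun ω => φ (Z n i ω, J n i ω); P] =
        ∫ p, φ p ^ 2 ∂(Q.prod (R n)) := fun i => by
      rw [variance_of_integral_eq_zero (X := fun ω => φ (Z n i ω, J n i ω))
        (hm.comp (hs.measurable_unit n i)).aemeasurable (hmean i)]
      exact hs.integral_comp_unit hJ (hm.pow_const 2) i
    simp [this]
  have hsum : MemLp (∑ i : Fin n, fun ω => φ (Z n i ω, J n i ω)) 2 P :=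
    memLp_finsetSum' _ fun i _ => hmem i
  have hsum0 : ∫ ω, (∑ i : Fin n, fun ω => φ (Z n i ω, J n i ω)) ω ∂P = 0 := by
    simp only [Finset.sum_apply]
    rw [integral_finsetSum _ fun i _ => (hmem i).integrable one_le_two,
      Finset.sum_eq_zero fun i _ => hmean i]
  rw [variance_of_integral_eq_zero hsum.aemeasurable hsum0] at hvar
  have hform : (fun ω => √(n : ℝ) * unitAverage Z J φ (n, ω)) =
      fun ω => (√n / n) * (∑ i : Fin n, fun ω => φ (Z n i ω, J n i ω)) ω := by
    ext ω; simp [unitAverage, sampleMean]; ring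
  have hX : MemLp (fun ω => √(n : ℝ) * unitAverage Z J φ (n, ω)) 2 P := by
    rw [hform]; exact hsum.const_mul _
  have hX2 : ∫ ω, (√n * unitAverage Z J φ (n, ω)) ^ 2 ∂P = ∫ p, φ p ^ 2 ∂(Q.prod (R n)) := by
    have : ∀ ω, (√n * unitAverage Z J φ (n, ω)) ^ 2 =
        (√n / n) ^ 2 * (∑ i : Fin n, fun ω => φ (Z n i ω, J n i ω)) ω ^ 2 := fun ω => by
      rw [← mul_pow]; exact congrArg (· ^ 2) (congrFun hform ω)
    simp_rw [this]
    rw [integral_const_mul, show ∫ ω, (∑ i : Fin n, fun ω => φ (Z n i ω, J n i ω)) ω ^ 2 ∂P = _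
      from hvar, div_pow, Real.sq_sqrt (Nat.cast_nonneg n)]
    field_simp
  refine ⟨hX.integrable one_le_two, ?_⟩
  refine Real.le_sqrt_of_sq_le ?_
  rw [← hX2]
  -- Nonnegativity of the variance of |X| is the inequality (E|X|)² ≤ E[X²].
  have hv := variance_nonneg (fun ω => |√n * unitAverage Z J φ (n, ω)|) P
  have habs : MemLp (fun ω => |√n * unitAverage Z J φ (n, ω)|) 2 P := hX.norm
  rw [variance_eq_sub habs] at hv
  simp only [Pi.pow_apply, sq_abs] at hv
  linarith

end IsRandomSample

/-- Convergence in probability, or stochastic boundedness, from first absolute moments. -/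
lemma stoch_of_integral_abs_le [IsProbabilityMeasure P] {X : ℕ × Ω → ℝ} {b : ℕ → ℝ} {c : ℝ}
    (h : ∀ᶠ n in atTop, Integrable (fun ω => X (n, ω)) P ∧ ∫ ω, |X (n, ω)| ∂P ≤ b n)
    (hb : Tendsto b atTop (𝓝 c)) :
    StochBdd (whp P) X ∧ (c = 0 → Tendsto X (whp P) (𝓝 0)) := by
  refine ⟨stochBdd_whp_of_integral_abs (X := fun n ω => X (n, ω)) (B := c + 1)
    (h.mono fun n hn => hn.1) ?_, fun hc => ?_⟩
  · filter_upwards [h, hb.eventually_le_const (lt_add_one c)] with n hn hn'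
    exact hn.2.trans hn'
  · rw [hc] at hb
    exact tendsto_whp_zero_of_integral_abs (X := fun n ω => X (n, ω))
      (h.mono fun n hn => hn.1) (h.mono fun n hn => hn.2) hb

variable [IsProbabilityMeasure P] [IsProbabilityMeasure Q] {A : ℝ × ℝ → ℝ} {B : ℕ → (ℕ → ℝ) → ℝ} {g : ℕ → ℝ}

/-- First moment asymptotics of averages of products of effects and noise. -/
lemma stoch_effectNoise_first (hs : IsRandomSample P Z J Q R)
    (hJ : ∀ n i, IndepFun (J n i) (Z n i) P) (h3 : ∀ n i, ∀ᵐ ω ∂P, 3 ≤ J n i ω)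
    (hind : IndepFun (fun z : Latent => (z.theta, z.u)) Latent.eps Q)
    (hA : Measurable A) (hB : ∀ m, Measurable (B m))
    (hAi : Integrable (fun z : Latent => A (z.theta, z.u)) Q)
    (hBi : ∀ m, 3 ≤ m → Integrable (fun z : Latent => B m z.eps) Q)
    (hg : ∀ ρ : Measure ℕ, IsProbabilityMeasure ρ → Integrable g ρ) {C : ℝ}
    (hC : ∀ m, 3 ≤ m → ∫ z : Latent, |B m z.eps| ∂Q ≤ C * g m)
    {w : ℕ → ℝ} (hw : ∀ n, 0 ≤ w n) {c : ℝ}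
    (hlim : Tendsto (fun n => w n * ∫ m, g m ∂(R n)) atTop (𝓝 c)) :
    StochBdd (whp P) (fun x => w x.1 * unitAverage Z J (effectNoise A B) x) ∧
      (c = 0 → Tendsto (fun x => w x.1 * unitAverage Z J (effectNoise A B) x) (whp P) (𝓝 0)) := by
  have hb : Tendsto (fun n => ((∫ z : Latent, |A (z.theta, z.u)| ∂Q) * C) *
      (w n * ∫ m, g m ∂(R n))) atTop (𝓝 (((∫ z : Latent, |A (z.theta, z.u)| ∂Q) * C) * c)) :=
    hlim.const_mul _
  have h := stoch_of_integral_abs_le (P := P)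
    (X := fun x => w x.1 * unitAverage Z J (effectNoise A B) x) ?_ hb
  · exact ⟨h.1, fun hc => h.2 (by rw [hc, mul_zero])⟩
  · filter_upwards [eventually_gt_atTop 0] with n hn
    have := hs.isProbabilityMeasure_R hn
    have hE := integral_effectNoise hind (hs.ae_three_le h3 hn) hA hB hAi hBi (hg _ this) hC
    refine ⟨(hs.integrable_unitAverage hJ hE.1).const_mul _, ?_⟩
    simp_rw [abs_mul, abs_of_nonneg (hw n)]
    rw [integral_const_mul]
    calc _ ≤ w n * _ := mul_le_mul_of_nonneg_left ((hs.integral_abs_unitAverage_le hJ hn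
          (measurable_effectNoise hA hB) hE.1).trans hE.2.1) (hw n)
      _ = _ := by ring

/-- Second moment asymptotics of averages of products of effects and noise. -/
lemma stoch_effectNoise_second (hs : IsRandomSample P Z J Q R)
    (hJ : ∀ n i, IndepFun (J n i) (Z n i) P) (h3 : ∀ n i, ∀ᵐ ω ∂P, 3 ≤ J n i ω)
    (hind : IndepFun (fun z : Latent => (z.theta, z.u)) Latent.eps Q)
    (hA : Measurable A) (hB : ∀ m, Measurable (B m))
    (hAi : Integrable (fun z : Latent => A (z.theta, z.u) ^ 2) Q)
    (hBi : ∀ m, 3 ≤ m → Integrable (fun z : Latent => B m z.eps ^ 2) Q)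
    (hg : ∀ ρ : Measure ℕ, IsProbabilityMeasure ρ → Integrable g ρ) {C : ℝ}
    (hC : ∀ m, 3 ≤ m → ∫ z : Latent, B m z.eps ^ 2 ∂Q ≤ C * g m)
    (h0 : ∀ m, 3 ≤ m → (∫ z : Latent, A (z.theta, z.u) ∂Q) * ∫ z : Latent, B m z.eps ∂Q = 0)
    {c : ℝ} (hlim : Tendsto (fun n => ∫ m, g m ∂(R n)) atTop (𝓝 c)) :
    StochBdd (whp P) (fun x => √x.1 * unitAverage Z J (effectNoise A B) x) ∧
      (c = 0 → Tendsto (fun x => √x.1 * unitAverage Z J (effectNoise A B) x) (whp P) (𝓝 0)) := by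
  have hb : Tendsto (fun n => √((∫ z : Latent, A (z.theta, z.u) ^ 2 ∂Q) *
      (C * ∫ m, g m ∂(R n)))) atTop (𝓝 (√((∫ z : Latent, A (z.theta, z.u) ^ 2 ∂Q) * (C * c)))) :=
    ((hlim.const_mul _).const_mul _).sqrt
  have h := stoch_of_integral_abs_le (P := P)
    (X := fun x => √x.1 * unitAverage Z J (effectNoise A B) x) ?_ hb
  · exact ⟨h.1, fun hc => h.2 (by rw [hc, mul_zero, mul_zero, Real.sqrt_zero])⟩
  · filter_upwards [eventually_gt_atTop 0] with n hn
    have hR := hs.isProbabilityMeasure_R hn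
    have hsq : (fun p => effectNoise A B p ^ 2) =
        effectNoise (fun x => A x ^ 2) (fun m y => B m y ^ 2) := by
      ext p; unfold effectNoise; rw [mul_pow]
    have hE2 := integral_effectNoise (B := fun m y => B m y ^ 2) (A := fun x => A x ^ 2) hind
      (hs.ae_three_le h3 hn) (hA.pow_const 2) (fun m => (hB m).pow_const 2) hAi hBi (hg _ hR)
      (C := C) (by simpa only [abs_pow, sq_abs] using hC)
    have hmemA : MemLp (fun z : Latent => A (z.theta, z.u)) 2 Q :=
      (memLp_two_iff_integrable_sq (hA.comp (Latent.measurable_theta.prodMk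
        Latent.measurable_u)).aestronglyMeasurable).2 hAi
    have hmemB : ∀ m, 3 ≤ m → MemLp (fun z : Latent => B m z.eps) 2 Q := fun m hm =>
      (memLp_two_iff_integrable_sq ((hB m).comp
        Latent.measurable_epsSeq).aestronglyMeasurable).2 (hBi m hm)
    have hE0 : ∫ p, effectNoise A B p ∂(Q.prod (R n)) = 0 := by
      have hmeas := measurable_effectNoise hA hB
      have hint : Integrable (effectNoise A B) (Q.prod (R n)) := by
        have hE21 := hE2.1
        rw [← hsq] at hE21
        exact ((memLp_two_iff_integrable_sq hmeas.aestronglyMeasurable).2 hE21).integrable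
          one_le_two
      rw [integral_prod_symm _ hint]
      refine integral_eq_zero_of_ae ?_
      filter_upwards [hs.ae_three_le h3 hn] with m hm
      rw [Pi.zero_apply, ← h0 m hm]
      exact (hind.comp hA (hB m)).integral_fun_mul_eq_mul_integral
        hmemA.aestronglyMeasurable (hmemB m hm).aestronglyMeasurable
    have hE2i := hE2.1
    have hE2b := hE2.2.1
    rw [← hsq] at hE2i hE2b
    have hfin := hs.integral_abs_sqrt_mul_unitAverage_le hJ hn (measurable_effectNoise hA hB)
      hE2i hE0
    refine ⟨hfin.1, hfin.2.trans (Real.sqrt_le_sqrt ?_)⟩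
    have habs : ∀ x : ℝ, |x ^ 2| = x ^ 2 := fun x => abs_of_nonneg (sq_nonneg x)
    simp only [habs] at hE2b
    exact hE2b

end Sample

/-! ### The shrinkage regression in the model -/

section Link

lemma unitMean_add_const {m : ℕ} (hm : 3 ≤ m) (c : ℝ) (x : ℕ → ℝ) :
    unitMean m (fun j => c + x j) = c + unitMean m x := by
  have : (m : ℝ) ≠ 0 := by positivity
  unfold unitMean
  rw [Finset.sum_add_distrib]
  simp only [Finset.sum_const, Finset.card_range, nsmul_eq_mul]
  field_simp

lemma unitVar_add_const {m : ℕ} (hm : 3 ≤ m) (c : ℝ) (x : ℕ → ℝ) :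
    unitVar m (fun j => c + x j) = unitVar m x := by
  unfold unitVar
  rw [unitMean_add_const hm]
  simp

variable {n : ℕ} (z : Fin n → Latent) (J : Fin n → ℕ) (μ : ℝ)

/-- The centered effects. -/
def effects (i : Fin n) : ℝ := (z i).theta - μ

/-- The individual mean noises. -/
def meanNoises (i : Fin n) : ℝ := unitMean (J i) (z i).eps

/-- The estimated variances of the individual mean noises. -/
def noiseVars (i : Fin n) : ℝ := noiseVar (J i) (z i).eps

variable {z J}

/-- The centering point μ is arbitrary here and in the identities below; it is the mean of θ when
they are used. -/
lemma grandMean_eq (hn : 0 < n) (hJ : ∀ i, 3 ≤ J i) :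
    grandMean J (fun i => (z i).X) =
      μ + (sampleMean (effects z μ) + sampleMean (meanNoises z J)) := by
  have h : (fun i => unitMean (J i) (z i).X) =
      fun i => μ + (effects z μ i + meanNoises z J i) := by
    ext i
    have : (z i).X = fun j => (z i).theta + (z i).eps j := rfl
    rw [this, unitMean_add_const (hJ i)]
    unfold effects meanNoises
    ring
  unfold grandMean
  rw [h, sampleMean_add, sampleMean_const hn, sampleMean_add]

lemma unitMean_sub_grandMean (hn : 0 < n) (hJ : ∀ i, 3 ≤ J i) (i : Fin n) :
    unitMean (J i) (z i).X - grandMean J (fun i => (z i).X) =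
      centeredMean (effects z μ) (meanNoises z J) i := by
  have : (z i).X = fun j => (z i).theta + (z i).eps j := rfl
  rw [grandMean_eq μ hn hJ, this, unitMean_add_const (hJ i)]
  unfold centeredMean
  simp only [effects, meanNoises]
  ring

lemma inv_mul_unitVar_eq (hJ : ∀ i, 3 ≤ J i) (i : Fin n) :
    (1 / (J i : ℝ)) * unitVar (J i) (z i).X = noiseVars z J i := by
  have : (z i).X = fun j => (z i).theta + (z i).eps j := rfl
  rw [this, unitVar_add_const (hJ i)]
  rfl

lemma VHat_eq (hn : 0 < n) (hJ : ∀ i, 3 ≤ J i) :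
    VHat J (fun i => (z i).X) = arrayV (effects z μ) (meanNoises z J) (noiseVars z J) := by
  have hn' : (n : ℝ) ≠ 0 := by positivity
  unfold VHat arrayV
  simp_rw [unitMean_sub_grandMean μ hn hJ, inv_mul_unitVar_eq hJ]
  unfold sampleMean
  field_simp

/-- The shrinkage estimator is the grand mean plus the shrunk individual mean. -/
lemma thetaHE_eq (hn : 0 < n) (hJ : ∀ i, 3 ≤ J i)
    (hV : 0 < arrayV (effects z μ) (meanNoises z J) (noiseVars z J)) (i : Fin n) :
    thetaHE J (fun i => (z i).X) i =
      (μ + (sampleMean (effects z μ) + sampleMean (meanNoises z J)))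
        + shrunk (effects z μ) (meanNoises z J) (noiseVars z J) i := by
  have hs : 0 ≤ noiseVars z J i := noiseVar_nonneg (hJ i) _
  have hw : weightHE J (fun i => (z i).X) i =
      1 - shrinkage (effects z μ) (meanNoises z J) (noiseVars z J) i := by
    unfold weightHE shrinkage
    rw [inv_mul_unitVar_eq hJ, VHat_eq μ hn hJ]
    have : noiseVars z J i + arrayV (effects z μ) (meanNoises z J) (noiseVars z J) ≠ 0 := by
      linarith
    field_simp
    ring
  have hx := unitMean_sub_grandMean (z := z) μ hn hJ i
  unfold thetaHE
  rw [hw, ← grandMean_eq μ hn hJ]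
  unfold shrunk
  rw [← hx]
  ring

/-- The grand mean cancels in θ − θ̂ = b(t + e − c) − e, so the error is u plus β times this
difference and the intercept remains α. -/
lemma outcome_eq (hn : 0 < n) (hJ : ∀ i, 3 ≤ J i) (α β : ℝ)
    (hV : 0 < arrayV (effects z μ) (meanNoises z J) (noiseVars z J)) (i : Fin n) :
    (z i).Y α β = α + β * thetaHE J (fun i => (z i).X) i + regError β (effects z μ)
      (fun i => (z i).u) (meanNoises z J) (noiseVars z J) i := by
  rw [thetaHE_eq μ hn hJ hV]
  unfold regError shrunk Latent.Y centeredMean effects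
  ring

/-- Slope and variance estimator in terms of the arrays of effects, errors and noises. -/
lemma regression_eq (hn : 0 < n) (hJ : ∀ i, 3 ≤ J i) (α β : ℝ)
    {h g : Fin n → ℝ}
    (hh : h = shrunk (effects z μ) (meanNoises z J) (noiseVars z J))
    (hg : g = regError β (effects z μ) (fun i => (z i).u) (meanNoises z J) (noiseVars z J))
    (hV : 0 < arrayV (effects z μ) (meanNoises z J) (noiseVars z J))
    (hD : (sampleMean fun i => (h i - sampleMean h) ^ 2) ≠ 0) :
    olsSlope (thetaHE J fun i => (z i).X) (fun i => (z i).Y α β) - β =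
        (sampleMean fun i => (h i - sampleMean h) * g i) /
          (sampleMean fun i => (h i - sampleMean h) ^ 2) ∧
      ehwVariance (thetaHE J fun i => (z i).X) (fun i => (z i).Y α β) =
        (sampleMean fun i => (h i - sampleMean h) ^ 2 * (g i - sampleMean g -
          (sampleMean fun i => (h i - sampleMean h) * g i) /
          (sampleMean fun i => (h i - sampleMean h) ^ 2) * (h i - sampleMean h)) ^ 2) /
        (sampleMean fun i => (h i - sampleMean h) ^ 2) ^ 2 := by
  have hx := thetaHE_eq μ hn hJ hV
  have hy := outcome_eq μ hn hJ α β hV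
  set x := thetaHE J fun i => (z i).X
  have hdev : ∀ i, x i - sampleMean x = h i - sampleMean h := by
    have : x = fun i => (μ + (sampleMean (effects z μ) + sampleMean (meanNoises z J))) + h i := by
      ext i; rw [hx i, hh]
    intro i
    rw [this, sampleMean_add, sampleMean_const hn]
    ring
  rw [← hg] at hy
  have hslope : olsSlope x (fun i => (z i).Y α β) - β =
        (sampleMean fun i => (h i - sampleMean h) * g i) /
          (sampleMean fun i => (h i - sampleMean h) ^ 2) := by
    rw [olsSlope_eq (g := g) (a := α) (β := β) hn hy (by simpa only [hdev] using hD)]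
    simp only [hdev]
    ring
  refine ⟨hslope, ?_⟩
  rw [ehwVariance_eq]
  simp_rw [olsResidual_eq hn hy, hslope, hdev]

end Link

/-! ### Moments of the measurement counts, effects and errors -/

section Model

variable {Ω : Type*} [MeasurableSpace Ω] {P : Measure Ω}
  {Z : (n : ℕ) → Fin n → Ω → Latent} {J : (n : ℕ) → Fin n → Ω → ℕ}
  {Q : Measure Latent} [IsProbabilityMeasure Q] {R : ℕ → Measure ℕ} {α β κ : ℝ}

lemma Assumption1.noiseModel (h1 : Assumption1 P Z J Q R α β κ) : NoiseModel Q :=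
  ⟨h1.condIndep_eps, h1.condMean_eps, h1.condVar_eps, h1.condMoment_eps, h1.moment_sigma⟩

lemma integrable_of_abs_le_one {g : ℕ → ℝ} (hg : ∀ m, |g m| ≤ 1) (ρ : Measure ℕ)
    (hρ : IsProbabilityMeasure ρ) : Integrable g ρ :=
  (integrable_const (1 : ℝ)).mono' (measurable_of_countable g).aestronglyMeasurable
    (ae_of_all _ hg)

lemma abs_one_div_natCast_le (m : ℕ) : |1 / (m : ℝ)| ≤ 1 := by
  rcases Nat.eq_zero_or_pos m with rfl | h
  · simp
  · have : (1 : ℝ) ≤ m := by exact_mod_cast h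
    rw [abs_of_nonneg (by positivity), div_le_one (by linarith)]
    exact this

lemma abs_one_div_sq_le (m : ℕ) : |1 / (m : ℝ) ^ 2| ≤ 1 := by
  rw [← one_div_pow, abs_pow]
  exact pow_le_one₀ (abs_nonneg _) (abs_one_div_natCast_le m)

lemma abs_one_div_mul_sqrt_le (m : ℕ) : |1 / ((m : ℝ) * √m)| ≤ 1 := by
  rcases Nat.eq_zero_or_pos m with rfl | h
  · simp
  · have : (1 : ℝ) ≤ m := by exact_mod_cast h
    have h2 : 1 ≤ √(m : ℝ) := Real.one_le_sqrt.2 this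
    rw [abs_of_nonneg (by positivity), div_le_one (by positivity)]
    nlinarith

/-- The arithmetic–geometric mean inequality for 1/m and 1/m² with a free weight δ. At m = 0 both
sides vanish by the convention for division. -/
lemma one_div_mul_sqrt_le (m : ℕ) {δ : ℝ} (hδ : 0 < δ) :
    1 / ((m : ℝ) * √m) ≤ δ * (1 / m) + δ⁻¹ * (1 / (m : ℝ) ^ 2) := by
  rcases Nat.eq_zero_or_pos m with rfl | h
  · simp
  · have hm : (0 : ℝ) < m := by exact_mod_cast h
    obtain ⟨a, ha, hma⟩ : ∃ a : ℝ, 0 < a ∧ (m : ℝ) = a ^ 2 :=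
      ⟨√m, Real.sqrt_pos.2 hm, (Real.sq_sqrt hm.le).symm⟩
    rw [hma, Real.sqrt_sq ha.le]
    have key : δ * (1 / a ^ 2) + δ⁻¹ * (1 / (a ^ 2) ^ 2) - 1 / (a ^ 2 * a) =
        (δ ^ 2 * a ^ 2 + 1 - δ * a) / (δ * a ^ 4) := by
      field_simp
    have : 0 ≤ (δ ^ 2 * a ^ 2 + 1 - δ * a) / (δ * a ^ 4) := by
      apply div_nonneg _ (by positivity)
      nlinarith [sq_nonneg (δ * a - 1), mul_pos hδ ha]
    linarith

/-- The intermediate moment of the number of measurements. -/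
lemma tendsto_inv_J_three_halves (hR : ∀ n, 0 < n → IsProbabilityMeasure (R n))
    (h1 : Tendsto (fun n : ℕ => √(n : ℝ) * ∫ j, (1 / (j : ℝ)) ∂(R n)) atTop (𝓝 κ))
    (h2 : Tendsto (fun n : ℕ => √(n : ℝ) * ∫ j, (1 / (j : ℝ) ^ 2) ∂(R n)) atTop (𝓝 0)) :
    Tendsto (fun n : ℕ => √(n : ℝ) * ∫ j : ℕ, (1 / ((j : ℝ) * √j)) ∂(R n)) atTop (𝓝 0) := by
  rw [Metric.tendsto_nhds]
  intro ε hε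
  -- With this weight the E[1/J] part is at most ε/2, since √n E[1/J] is eventually below |κ| + 1;
  -- for fixed δ the E[1/J²] part tends to zero.
  set δ := ε / (2 * (|κ| + 1)) with hδdef
  have hδ : 0 < δ := by positivity
  have e1 := h1.eventually_le_const (show κ < |κ| + 1 by linarith [le_abs_self κ])
  have e2 := (h2.const_mul δ⁻¹).eventually_lt_const (show δ⁻¹ * 0 < ε / 2 by simpa using hε)
  filter_upwards [e1, e2, eventually_gt_atTop 0] with n hn1 hn2 hn
  have := hR n hn
  rw [Real.dist_eq, sub_zero, abs_of_nonneg
    (mul_nonneg (Real.sqrt_nonneg _) (integral_nonneg fun j => by positivity))]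
  have i1 : Integrable (fun j : ℕ => δ * (1 / (j : ℝ))) (R n) :=
    (integrable_of_abs_le_one abs_one_div_natCast_le _ this).const_mul _
  have i2 : Integrable (fun j : ℕ => δ⁻¹ * (1 / (j : ℝ) ^ 2)) (R n) :=
    (integrable_of_abs_le_one abs_one_div_sq_le _ this).const_mul _
  have hle : ∫ j : ℕ, (1 / ((j : ℝ) * √j)) ∂(R n) ≤
      δ * ∫ j, (1 / (j : ℝ)) ∂(R n) + δ⁻¹ * ∫ j, (1 / (j : ℝ) ^ 2) ∂(R n) := by
    rw [← integral_const_mul, ← integral_const_mul, ← integral_add i1 i2]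
    exact integral_mono (integrable_of_abs_le_one abs_one_div_mul_sqrt_le _ this) (i1.add i2)
      fun m => one_div_mul_sqrt_le m hδ
  calc _ ≤ √(n : ℝ) * (δ * ∫ j, (1 / (j : ℝ)) ∂(R n) + δ⁻¹ * ∫ j, (1 / (j : ℝ) ^ 2) ∂(R n)) := by
        gcongr
    _ = δ * (√(n : ℝ) * ∫ j, (1 / (j : ℝ)) ∂(R n)) +
          δ⁻¹ * (√(n : ℝ) * ∫ j, (1 / (j : ℝ) ^ 2) ∂(R n)) := by ring
    _ ≤ δ * (|κ| + 1) + δ⁻¹ * (√(n : ℝ) * ∫ j, (1 / (j : ℝ) ^ 2) ∂(R n)) := by gcongr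
    _ < δ * (|κ| + 1) + ε / 2 := by gcongr
    _ = ε := by
        rw [hδdef]; field_simp; ring

lemma tendsto_zero_of_sqrt_mul_tendsto {a : ℕ → ℝ} {c : ℝ}
    (h : Tendsto (fun n : ℕ => √(n : ℝ) * a n) atTop (𝓝 c)) : Tendsto a atTop (𝓝 0) := by
  have h1 : Tendsto (fun n : ℕ => (√(n : ℝ))⁻¹) atTop (𝓝 0) :=
    tendsto_inv_atTop_zero.comp (Real.tendsto_sqrt_atTop.comp tendsto_natCast_atTop_atTop)
  have h2 := h1.mul h
  rw [zero_mul] at h2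
  refine h2.congr' ?_
  filter_upwards [eventually_gt_atTop 0] with n hn
  have : √(n : ℝ) ≠ 0 := by positivity
  field_simp

/-- The moments of the effects and the errors. -/
structure EffectMoments (Q : Measure Latent) (μ V τ : ℝ) : Prop where
  int_t_four : Integrable (fun z : Latent => (z.theta - μ) ^ 4) Q
  int_u_four : Integrable (fun z : Latent => z.u ^ 4) Q
  int_tu_four : Integrable (fun z : Latent => ((z.theta - μ) * z.u) ^ 4) Q
  mean_t : ∫ z : Latent, (z.theta - μ) ∂Q = 0
  mean_u : ∫ z : Latent, z.u ∂Q = 0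
  mean_tu : ∫ z : Latent, (z.theta - μ) * z.u ∂Q = 0
  var_t : ∫ z : Latent, (z.theta - μ) ^ 2 ∂Q = V
  var_tu : ∫ z : Latent, ((z.theta - μ) * z.u) ^ 2 ∂Q = τ

/-- The fourth moment of u comes from those of Y and θ. That of (θ − μ)u, needed for the law of
large numbers for its square, comes from E|θ⁴u⁴|. -/
lemma effectMoments (h1 : Assumption1 P Z J Q R α β κ) (h2 : Assumption2 Q) :
    EffectMoments Q (∫ z, z.theta ∂Q) Var[Latent.theta; Q] (scoreVariance Q) := by
  set μ := ∫ z, z.theta ∂Q with hμ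
  have mθ := Latent.measurable_theta
  have mu := Latent.measurable_u
  have iu4 : Integrable (fun z : Latent => z.u ^ 4) Q := by
    refine (((h1.moment_Y.add (integrable_const (α ^ 4))).add
      (h1.moment_theta.const_mul (β ^ 4))).const_mul 64).mono' (mu.pow_const 4).aestronglyMeasurable
      (ae_of_all _ fun z => ?_)
    rw [Real.norm_of_nonneg (by positivity)]
    have := add_three_pow_four_le (z.Y α β) (-α) (-(β * z.theta))
    rw [Even.neg_pow (by decide : Even 4), Even.neg_pow (by decide : Even 4), mul_pow] at this
    have hu : z.Y α β + -α + -(β * z.theta) = z.u := by unfold Latent.Y; ring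
    rwa [hu] at this
  have it4 : Integrable (fun z : Latent => (z.theta - μ) ^ 4) Q := by
    refine ((h1.moment_theta.add (integrable_const (μ ^ 4))).const_mul 8).mono'
      ((mθ.sub_const μ).pow_const 4).aestronglyMeasurable (ae_of_all _ fun z => ?_)
    rw [Real.norm_of_nonneg (by positivity)]
    have := add_pow_four_le z.theta (-μ)
    rwa [Even.neg_pow (by decide : Even 4), ← sub_eq_add_neg] at this
  have itu4 : Integrable (fun z : Latent => ((z.theta - μ) * z.u) ^ 4) Q := by
    have h44 := h2.moment_theta_u 4 4 (by norm_num) (by norm_num) (by norm_num) le_rfl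
    refine ((h44.add (iu4.const_mul (μ ^ 4))).const_mul 8).mono'
      (((mθ.sub_const μ).mul mu).pow_const 4).aestronglyMeasurable (ae_of_all _ fun z => ?_)
    rw [Real.norm_of_nonneg (by positivity)]
    have := add_pow_four_le (z.theta * z.u) (-(μ * z.u))
    rw [Even.neg_pow (by decide : Even 4), ← sub_eq_add_neg, ← sub_mul, mul_pow z.theta,
      mul_pow μ] at this
    refine this.trans ?_
    simp only [Pi.add_apply]
    gcongr
    exact le_abs_self _
  have iθ : Integrable Latent.theta Q := by
    refine ((integrable_const 1).add h1.moment_theta).mono' mθ.aestronglyMeasurable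
      (ae_of_all _ fun z => ?_)
    have := abs_le_momWeight_left z.theta 0
    simpa [momWeight] using this
  have iu : Integrable Latent.u Q := by
    refine ((integrable_const 1).add iu4).mono' mu.aestronglyMeasurable (ae_of_all _ fun z => ?_)
    have := abs_le_momWeight_left z.u 0
    simpa [momWeight] using this
  have iuθ : Integrable (fun z : Latent => z.u * z.theta) Q := by
    refine (((integrable_const 1).add h1.moment_theta).add iu4).mono' (mu.mul mθ).aestronglyMeasurable
      (ae_of_all _ fun z => ?_)
    have := abs_mul_le_momWeight z.theta z.u
    rw [mul_comm] at this
    exact this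
  refine ⟨it4, iu4, itu4, ?_, h1.mean_u, ?_, ?_, ?_⟩
  · rw [integral_sub iθ (integrable_const μ)]
    simp [hμ]
  · have : ∀ z : Latent, (z.theta - μ) * z.u = z.u * z.theta - μ * z.u := fun z => by ring
    simp_rw [this]
    rw [integral_sub iuθ (iu.const_mul μ), integral_const_mul, h1.mean_u, h1.mean_u_theta]
    simp
  · rw [variance_eq_integral mθ.aemeasurable]
  · unfold scoreVariance
    refine integral_congr_ae (ae_of_all _ fun z => ?_)
    simp only [hμ]
    ring

end Model

/-! ### Stochastic orders of the sample averages in the model -/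

section ModelLimits

variable {Ω : Type*} [MeasurableSpace Ω] {P : Measure Ω} [IsProbabilityMeasure P]
  {Z : (n : ℕ) → Fin n → Ω → Latent} {J : (n : ℕ) → Fin n → Ω → ℕ}
  {Q : Measure Latent} [IsProbabilityMeasure Q] {R : ℕ → Measure ℕ} {α β κ : ℝ}

/-- Averages of functions of the effect and the error that are centered and square integrable. -/
lemma stochBdd_sqrt_mul_average (hs : IsRandomSample P Z J Q R)
    (h1 : Assumption1 P Z J Q R α β κ) {A : ℝ × ℝ → ℝ} (hA : Measurable A)
    (hAi : Integrable (fun z : Latent => A (z.theta, z.u) ^ 2) Q)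
    (h0 : ∫ z : Latent, A (z.theta, z.u) ∂Q = 0) :
    StochBdd (whp P) fun x : ℕ × Ω => √x.1 * sampleMean fun i : Fin x.1 =>
      A ((Z x.1 i x.2).theta, (Z x.1 i x.2).u) := by
  -- A noise factor identically one covers averages of effects and errors alone.
  have h := (stoch_effectNoise_second (B := fun _ _ => 1) (g := fun _ => 1) (C := 1) (c := 1) hs
    h1.indep_J h1.three_le_J (indepFun_theta_u_eps h1.indep_eps_theta h1.condIndep_u_eps) hA
    (fun m => measurable_const) hAi (fun m _ => by simp)
    (fun ρ hρ => integrable_const 1) (fun m _ => by simp) (fun m _ => by rw [h0, zero_mul]) ?_).1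
  · simpa only [unitAverage, effectNoise, mul_one] using h
  · refine tendsto_const_nhds.congr' ?_
    filter_upwards [eventually_gt_atTop 0] with n hn
    have := hs.isProbabilityMeasure_R hn
    simp

/-- Averages of integrable functions of the effect and the error. -/
lemma stochBdd_average (hs : IsRandomSample P Z J Q R)
    (h1 : Assumption1 P Z J Q R α β κ) {A : ℝ × ℝ → ℝ} (hA : Measurable A)
    (hAi : Integrable (fun z : Latent => A (z.theta, z.u)) Q) :
    StochBdd (whp P) fun x : ℕ × Ω => sampleMean fun i : Fin x.1 =>
      A ((Z x.1 i x.2).theta, (Z x.1 i x.2).u) := by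
  have h := (stoch_effectNoise_first (B := fun _ _ => 1) (g := fun _ => 1) (C := 1) (c := 1)
    (w := fun _ => 1) hs
    h1.indep_J h1.three_le_J (indepFun_theta_u_eps h1.indep_eps_theta h1.condIndep_u_eps) hA
    (fun m => measurable_const) hAi (fun m _ => by simp)
    (fun ρ hρ => integrable_const 1) (fun m _ => by simp) (fun _ => zero_le_one) ?_).1
  · simpa only [unitAverage, effectNoise, mul_one, one_mul] using h
  · refine tendsto_const_nhds.congr' ?_
    filter_upwards [eventually_gt_atTop 0] with n hn
    have := hs.isProbabilityMeasure_R hn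
    simp

/-- Averages of products with noise of vanishing second moment. -/
lemma tendsto_sqrt_mul_noise_average (hs : IsRandomSample P Z J Q R)
    (h1 : Assumption1 P Z J Q R α β κ) {A : ℝ × ℝ → ℝ} {B : ℕ → (ℕ → ℝ) → ℝ} {g : ℕ → ℝ}
    (hA : Measurable A) (hB : ∀ m, Measurable (B m))
    (hAi : Integrable (fun z : Latent => A (z.theta, z.u) ^ 2) Q)
    (hg : ∀ ρ : Measure ℕ, IsProbabilityMeasure ρ → Integrable g ρ) {C : ℝ}
    (hBC : ∀ m, 3 ≤ m → Integrable (fun z : Latent => B m z.eps ^ 2) Q ∧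
      ∫ z : Latent, B m z.eps ^ 2 ∂Q ≤ C * g m)
    (h0 : ∀ m, 3 ≤ m → (∫ z : Latent, A (z.theta, z.u) ∂Q) * ∫ z : Latent, B m z.eps ∂Q = 0)
    (hlim : Tendsto (fun n => ∫ m, g m ∂(R n)) atTop (𝓝 0)) :
    Tendsto (fun x : ℕ × Ω => √x.1 * sampleMean fun i : Fin x.1 =>
      A ((Z x.1 i x.2).theta, (Z x.1 i x.2).u) * B (J x.1 i x.2) (Z x.1 i x.2).eps)
      (whp P) (𝓝 0) :=
  (stoch_effectNoise_second hs h1.indep_J h1.three_le_J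
    (indepFun_theta_u_eps h1.indep_eps_theta h1.condIndep_u_eps) hA hB hAi
    (fun m hm => (hBC m hm).1) hg (fun m hm => (hBC m hm).2) h0 hlim).2 rfl

lemma measurable_unitMean (m : ℕ) : Measurable (unitMean m) := by
  unfold unitMean; fun_prop

lemma measurable_noiseVar (m : ℕ) : Measurable (noiseVar m) := by
  unfold noiseVar unitVar
  have := measurable_unitMean m
  fun_prop

lemma measurable_momWeight : Measurable fun x : ℝ × ℝ => momWeight x.1 x.2 := by
  unfold momWeight; fun_prop

variable (Z J) in
/-- The centered effects in the sample. -/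
def sampleEffects (μ : ℝ) (x : ℕ × Ω) : Fin x.1 → ℝ := effects (fun i => Z x.1 i x.2) μ

variable (Z) in
/-- The regression errors in the sample. -/
def sampleErrors (x : ℕ × Ω) (i : Fin x.1) : ℝ := (Z x.1 i x.2).u

variable (Z J) in
/-- The individual mean noises in the sample. -/
def sampleNoises (x : ℕ × Ω) : Fin x.1 → ℝ :=
  meanNoises (fun i => Z x.1 i x.2) fun i => J x.1 i x.2

variable (Z J) in
/-- The estimated noise variances in the sample. -/
def sampleNoiseVars (x : ℕ × Ω) : Fin x.1 → ℝ :=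
  noiseVars (fun i => Z x.1 i x.2) fun i => J x.1 i x.2

/-- A weak law from second moments: √n times the centered average is bounded in probability, and the
factor √n is divided out. -/
lemma tendsto_average (hs : IsRandomSample P Z J Q R)
    (h1 : Assumption1 P Z J Q R α β κ) {A : ℝ × ℝ → ℝ} (hA : Measurable A) {c : ℝ}
    (hAi : Integrable (fun z : Latent => A (z.theta, z.u) ^ 2) Q)
    (h0 : ∫ z : Latent, A (z.theta, z.u) ∂Q = c) :
    Tendsto (fun x : ℕ × Ω => sampleMean fun i : Fin x.1 =>
      A ((Z x.1 i x.2).theta, (Z x.1 i x.2).u)) (whp P) (𝓝 c) := by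
  have hmem : MemLp (fun z : Latent => A (z.theta, z.u)) 2 Q :=
    (memLp_two_iff_integrable_sq (hA.comp (Latent.measurable_theta.prodMk
      Latent.measurable_u)).aestronglyMeasurable).2 hAi
  have h := stochBdd_sqrt_mul_average hs h1 (A := fun x => A x - c) (hA.sub_const c)
    (hmem.sub (memLp_const c)).integrable_sq
    (by rw [integral_sub (hmem.integrable one_le_two) (integrable_const c), h0]; simp)
  have hinv : Tendsto (fun x : ℕ × Ω => (√(x.1 : ℝ))⁻¹) (whp P) (𝓝 0) :=
    tendsto_inv_atTop_zero.comp (Real.tendsto_sqrt_atTop.comp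
      (tendsto_natCast_atTop_atTop.comp tendsto_fst_whp))
  have h2 := (h _ hinv).add_const c
  rw [zero_add] at h2
  refine h2.congr' ?_
  filter_upwards [tendsto_fst_whp.eventually_gt_atTop 0] with x hx
  have : √(x.1 : ℝ) ≠ 0 := by positivity
  rw [sampleMean_sub, sampleMean_const hx]
  field_simp
  ring

/-- Centered products are treated by second moments, which only have to vanish. The weighted
averages of s and of the noise size are not centered, so there √n multiplies a first moment and the
rates m^{-1} and m^{-3/2} matter. -/
lemma arrayLimits (hs : IsRandomSample P Z J Q R) (h1 : Assumption1 P Z J Q R α β κ)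
    {μ V τ : ℝ} (hM : EffectMoments Q μ V τ) (hV : 0 < V) :
    ArrayLimits (whp P) Prod.fst (sampleEffects Z μ) (sampleErrors Z) (sampleNoises Z J)
      (sampleNoiseVars Z J) V τ := by
  obtain ⟨C, hC0, hC⟩ := h1.noiseModel.exists_moment_bounds
  have mθ := Latent.measurable_theta
  have mu := Latent.measurable_u
  have hg1 := fun ρ hρ => integrable_of_abs_le_one abs_one_div_natCast_le ρ hρ
  have hg2 := fun ρ hρ => integrable_of_abs_le_one abs_one_div_sq_le ρ hρ
  have hg3 := fun ρ hρ => integrable_of_abs_le_one abs_one_div_mul_sqrt_le ρ hρ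
  have hl1 := tendsto_zero_of_sqrt_mul_tendsto h1.tendsto_inv_J
  have hl2 := tendsto_zero_of_sqrt_mul_tendsto h1.tendsto_inv_J_sq
  have hl3 := tendsto_inv_J_three_halves (fun n hn => hs.isProbabilityMeasure_R hn)
    h1.tendsto_inv_J h1.tendsto_inv_J_sq
  have iF : Integrable (fun z : Latent => momWeight (z.theta - μ) z.u) Q :=
    ((integrable_const 1).add hM.int_t_four).add hM.int_u_four
  have of_le : ∀ {f : Latent → ℝ}, Measurable f → (∀ z, |f z| ≤ momWeight (z.theta - μ) z.u) →
      Integrable f Q := fun hf hle => iF.mono' hf.aestronglyMeasurable (ae_of_all _ hle)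
  have it2 : Integrable (fun z : Latent => (z.theta - μ) ^ 2) Q :=
    of_le (by fun_prop) fun z => by rw [abs_of_nonneg (sq_nonneg _)]; exact sq_le_momWeight _ _
  have iu2 : Integrable (fun z : Latent => z.u ^ 2) Q :=
    of_le (by fun_prop) fun z => by
      rw [abs_of_nonneg (sq_nonneg _)]
      refine (sq_le_momWeight z.u (z.theta - μ)).trans (le_of_eq ?_)
      unfold momWeight; ring
  have itu2 : Integrable (fun z : Latent => ((z.theta - μ) * z.u) ^ 2) Q := by
    refine ((integrable_const 1).add hM.int_tu_four).mono'
      (((mθ.sub_const μ).mul mu).pow_const 2).aestronglyMeasurable (ae_of_all _ fun z => ?_)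
    rw [Real.norm_of_nonneg (sq_nonneg _)]
    have := sq_le_momWeight ((z.theta - μ) * z.u) 0
    simpa [momWeight] using this
  have it4 : Integrable (fun z : Latent => ((z.theta - μ) ^ 2) ^ 2) Q := by
    simpa only [← pow_mul] using hM.int_t_four
  have itu4 : Integrable (fun z : Latent => (((z.theta - μ) * z.u) ^ 2) ^ 2) Q := by
    simpa only [← pow_mul] using hM.int_tu_four
  have itV : Integrable (fun z : Latent => ((z.theta - μ) ^ 2 - V) ^ 2) Q := by
    have : MemLp (fun z : Latent => (z.theta - μ) ^ 2) 2 Q :=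
      (memLp_two_iff_integrable_sq (by fun_prop)).2 it4
    exact (this.sub (memLp_const V)).integrable_sq
  have mean_tV : ∫ z : Latent, ((z.theta - μ) ^ 2 - V) ∂Q = 0 := by
    rw [integral_sub it2 (integrable_const V), hM.var_t]; simp
  -- The squared shrinkage factor is at most the factor itself, hence at most s/V, so the first
  -- moment of s suffices.
  have bdd_of : ∀ m, 3 ≤ m →
      Integrable (fun z : Latent => (noiseVar m z.eps / (noiseVar m z.eps + V)) ^ 2) Q ∧
      ∫ z : Latent, (noiseVar m z.eps / (noiseVar m z.eps + V)) ^ 2 ∂Q ≤ (1 / V * C) * (1 / m) := by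
    intro m hm
    have hle : ∀ z : Latent, (noiseVar m z.eps / (noiseVar m z.eps + V)) ^ 2 ≤
        1 / V * noiseVar m z.eps := fun z => by
      have hs0 := noiseVar_nonneg hm z.eps
      exact (pow_le_of_le_one (shrink_nonneg hV le_rfl hs0) (shrink_le_one hV le_rfl hs0)
        two_ne_zero).trans (shrink_le_inv_mul hV le_rfl hs0)
    have hmv := Latent.measurable_noiseVar m
    have hi : Integrable (fun z : Latent =>
        (noiseVar m z.eps / (noiseVar m z.eps + V)) ^ 2) Q := by
      refine ((hC m hm).2.2.1.1.const_mul (1 / V)).mono'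
        ((hmv.div (hmv.add_const V)).pow_const 2).aestronglyMeasurable (ae_of_all _ fun z => ?_)
      rw [Real.norm_of_nonneg (sq_nonneg _)]
      exact hle z
    refine ⟨hi, ?_⟩
    calc _ ≤ ∫ z : Latent, 1 / V * noiseVar m z.eps ∂Q :=
          integral_mono hi ((hC m hm).2.2.1.1.const_mul (1 / V)) hle
      _ = 1 / V * ∫ z : Latent, noiseVar m z.eps ∂Q := integral_const_mul _ _
      _ ≤ 1 / V * (C * (1 / m)) := by
          gcongr
          exact (hC m hm).2.2.1.2
      _ = _ := by ring
  have hmean_e := h1.noiseModel.integral_unitMean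
  have hind := indepFun_theta_u_eps h1.indep_eps_theta h1.condIndep_u_eps
  have mB : ∀ m, Measurable fun y : ℕ → ℝ => noiseVar m y / (noiseVar m y + V) := fun m =>
    (measurable_noiseVar m).div ((measurable_noiseVar m).add_const V)
  refine
    { V_pos := hV
      tendsto_N := tendsto_fst_whp
      s_nonneg := ?_
      bdd_t := ?_
      bdd_u := ?_
      lim_e := ?_
      bdd_tu := ?_
      lim_t_sq := ?_
      lim_tu_sq := ?_
      bdd_t_four := ?_
      bdd_u_four := ?_
      lim_eu := ?_
      lim_te := ?_
      lim_q := ?_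
      bdd_sF := ?_
      lim_rF := ?_
      lim_shrink_tu := ?_
      lim_shrink_t_sq := ?_ }
  · refine eventually_whp_of_ae fun n => ?_
    have h : ∀ᵐ ω ∂P, ∀ i, 3 ≤ J n i ω := ae_all_iff.2 fun i => h1.three_le_J n i
    filter_upwards [h] with ω hω i
    exact noiseVar_nonneg (hω i) _
  · exact stochBdd_sqrt_mul_average hs h1 (A := fun x => x.1 - μ) (by fun_prop) it2 hM.mean_t
  · exact stochBdd_sqrt_mul_average hs h1 (A := fun x => x.2) (by fun_prop) iu2 hM.mean_u
  · have h := tendsto_sqrt_mul_noise_average hs h1 (A := fun _ => 1) (B := unitMean)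
      (g := fun m => 1 / (m : ℝ)) (C := C) measurable_const measurable_unitMean (by simp) hg1
      (fun m hm => (hC m hm).1) (fun m _ => by rw [hmean_e, mul_zero]) hl1
    simp only [one_mul] at h
    exact h
  · exact stochBdd_sqrt_mul_average hs h1 (A := fun x => (x.1 - μ) * x.2) (by fun_prop) itu2
      hM.mean_tu
  · exact tendsto_average hs h1 (A := fun x => (x.1 - μ) ^ 2) (by fun_prop) it4 hM.var_t
  · exact tendsto_average hs h1 (A := fun x => ((x.1 - μ) * x.2) ^ 2) (by fun_prop) itu4 hM.var_tu
  · exact stochBdd_average hs h1 (A := fun x => (x.1 - μ) ^ 4) (by fun_prop) hM.int_t_four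
  · exact stochBdd_average hs h1 (A := fun x => x.2 ^ 4) (by fun_prop) hM.int_u_four
  · have h := tendsto_sqrt_mul_noise_average hs h1 (A := fun x => x.2) (B := unitMean)
      (g := fun m => 1 / (m : ℝ)) (C := C) (by fun_prop) measurable_unitMean iu2 hg1
      (fun m hm => (hC m hm).1) (fun m _ => by rw [hmean_e, mul_zero]) hl1
    refine h.congr fun x => ?_
    congr 2; ext i
    exact mul_comm _ _
  · exact tendsto_sqrt_mul_noise_average hs h1 (A := fun x => x.1 - μ) (B := unitMean)
      (g := fun m => 1 / (m : ℝ)) (C := C) (by fun_prop) measurable_unitMean it2 hg1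
      (fun m hm => (hC m hm).1) (fun m _ => by rw [hmean_e, mul_zero]) hl1
  · have h := tendsto_sqrt_mul_noise_average hs h1 (A := fun _ => 1)
      (B := fun m y => unitMean m y ^ 2 - noiseVar m y)
      (g := fun m => 1 / (m : ℝ) ^ 2) (C := C) measurable_const
      (fun m => ((measurable_unitMean m).pow_const 2).sub (measurable_noiseVar m)) (by simp) hg2
      (fun m hm => (hC m hm).2.1)
      (fun m hm => by rw [(h1.noiseModel.integral_sq_sub_noiseVar hm).2.2, mul_zero]) hl2
    simp only [one_mul] at h
    exact h
  -- The weight `momWeight` is only known to be integrable, which first moments can handle; the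
  -- limit κ may be positive.
  · have h := (stoch_effectNoise_first (A := fun x => momWeight (x.1 - μ) x.2) (B := noiseVar)
      (g := fun m => 1 / (m : ℝ)) (C := C) (w := fun n => √n) hs h1.indep_J h1.three_le_J hind
      (measurable_momWeight.comp (f := fun x : ℝ × ℝ => (x.1 - μ, x.2)) (by fun_prop))
      measurable_noiseVar iF (fun m hm => (hC m hm).2.2.1.1) hg1
      (fun m hm => by
        simp_rw [abs_of_nonneg (noiseVar_nonneg hm _)]
        exact (hC m hm).2.2.1.2) (fun n => Real.sqrt_nonneg _) h1.tendsto_inv_J).1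
    refine h.congr (Eventually.of_forall fun x => ?_)
    unfold unitAverage
    congr 2; ext i
    exact mul_comm _ _
  · have h := (stoch_effectNoise_first (A := fun x => momWeight (x.1 - μ) x.2)
      (B := fun m y => noiseSize (unitMean m y) (noiseVar m y))
      (g := fun m => 1 / ((m : ℝ) * √m)) (C := C) (w := fun n => √n) hs h1.indep_J h1.three_le_J hind
      (measurable_momWeight.comp (f := fun x : ℝ × ℝ => (x.1 - μ, x.2)) (by fun_prop))
      (fun m => by
        unfold noiseSize
        exact (((measurable_noiseVar m).mul (measurable_noiseVar m).sqrt).add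
          ((measurable_unitMean m).abs.pow_const 3))) iF (fun m hm => (hC m hm).2.2.2.1) hg3
      (fun m hm => by
        simp_rw [abs_of_nonneg (noiseSize_nonneg (noiseVar_nonneg hm _))]
        exact (hC m hm).2.2.2.2) (fun n => Real.sqrt_nonneg _) hl3).2 rfl
    refine h.congr fun x => ?_
    unfold unitAverage
    congr 2; ext i
    exact mul_comm _ _
  · have h := tendsto_sqrt_mul_noise_average hs h1 (A := fun x => (x.1 - μ) * x.2)
      (B := fun m y => noiseVar m y / (noiseVar m y + V)) (g := fun m => 1 / (m : ℝ))
      (C := 1 / V * C) (by fun_prop) mB itu2 hg1 bdd_of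
      (fun m _ => by rw [hM.mean_tu, zero_mul]) hl1
    refine h.congr fun x => ?_
    congr 2; ext i
    exact mul_comm _ _
  · have h := tendsto_sqrt_mul_noise_average hs h1 (A := fun x => (x.1 - μ) ^ 2 - V)
      (B := fun m y => noiseVar m y / (noiseVar m y + V)) (g := fun m => 1 / (m : ℝ))
      (C := 1 / V * C) (by fun_prop) mB itV hg1 bdd_of
      (fun m _ => by rw [mean_tV, zero_mul]) hl1
    refine h.congr fun x => ?_
    congr 2; ext i
    exact mul_comm _ _

/-- Consistency of the variance estimator and the first order expansion of the slope. -/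
lemma regression_limits (hs : IsRandomSample P Z J Q R) (h1 : Assumption1 P Z J Q R α β κ)
    {μ V τ : ℝ} (hM : EffectMoments Q μ V τ) (hV : 0 < V) :
    Tendsto (fun x : ℕ × Ω => ehwVariance (regressorHE Z J x.1 x.2) (outcome α β Z x.1 x.2))
      (whp P) (𝓝 (τ / V ^ 2)) ∧
    Tendsto (fun x : ℕ × Ω =>
      √x.1 * (olsSlope (regressorHE Z J x.1 x.2) (outcome α β Z x.1 x.2) - β)
        - (√x.1 * sampleMean fun i => sampleEffects Z μ x i * sampleErrors Z x i) / V)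
      (whp P) (𝓝 0) := by
  have H := arrayLimits hs h1 hM hV
  have hJ : ∀ᶠ x : ℕ × Ω in whp P, ∀ i, 3 ≤ J x.1 i x.2 := by
    refine eventually_whp_of_ae fun n => ?_
    exact ae_all_iff.2 fun i => h1.three_le_J n i
  have hD := H.tendsto_regressor_variance
  constructor
  · have h := (H.tendsto_ehw_numerator β).div (hD.pow 2) (by positivity)
    refine h.congr' ?_
    filter_upwards [hJ, H.eventually_pos, H.eventually_half_le,
      hD.eventually_ne hV.ne'] with x hx hn hW hD0
    have hreg := regression_eq (z := fun i => Z x.1 i x.2) (J := fun i => J x.1 i x.2) μ hn hx α β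
      rfl rfl ((half_pos hV).trans_le hW) hD0
    exact hreg.2.symm
  · refine (H.tendsto_slope β).congr' ?_
    filter_upwards [hJ, H.eventually_pos, H.eventually_half_le,
      hD.eventually_ne hV.ne'] with x hx hn hW hD0
    have hreg := regression_eq (z := fun i => Z x.1 i x.2) (J := fun i => J x.1 i x.2) μ hn hx α β
      rfl rfl ((half_pos hV).trans_le hW) hD0
    have := hreg.1
    unfold regressorHE outcome
    rw [this]
    rfl

end ModelLimits

/-! ### Coverage of the confidence interval -/

section Quantile

variable {p : ℝ}

/-- A jump of the distribution function would be an atom, and this Gaussian law has none. -/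
lemma continuous_cdf_gaussian : Continuous (cdf (gaussianReal 0 1)) := by
  have : NullSingletonClass (gaussianReal 0 1) := nullSingletonClass_gaussianReal one_ne_zero
  rw [continuous_iff_continuousAt]
  intro x
  rw [(monotone_cdf _).continuousAt_iff_leftLim_eq_rightLim, StieltjesFunction.rightLim_eq]
  have h := (cdf (gaussianReal 0 1)).measure_singleton x
  rw [measure_cdf, measure_singleton, eq_comm, ENNReal.ofReal_eq_zero] at h
  exact le_antisymm ((monotone_cdf _).leftLim_le le_rfl) (by linarith)

/-- By continuity the infimum is attained, giving F(z) ≥ p. Points to its left have F < p, which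
gives the reverse inequality in the limit. -/
lemma cdf_normalQuantile (h0 : 0 < p) (h1 : p < 1) :
    cdf (gaussianReal 0 1) (normalQuantile p) = p := by
  set F := cdf (gaussianReal 0 1)
  have hF : Continuous F := continuous_cdf_gaussian
  have hne : {x : ℝ | p ≤ F x}.Nonempty :=
    ((tendsto_cdf_atTop (gaussianReal 0 1)).eventually (eventually_ge_nhds h1)).exists
  obtain ⟨b, hb⟩ := ((tendsto_cdf_atBot (gaussianReal 0 1)).eventually
    (eventually_lt_nhds h0)).exists
  have hbdd : BddBelow {x : ℝ | p ≤ F x} :=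
    ⟨b, fun x hx => le_of_not_gt fun hxb => absurd (hx.trans (monotone_cdf _ hxb.le)) hb.not_ge⟩
  refine le_antisymm ?_ ((isClosed_le continuous_const hF).csInf_mem hne hbdd)
  refine le_of_tendsto (hF.continuousAt.tendsto.mono_left
    (nhdsWithin_le_nhds (s := Set.Iio (normalQuantile p)))) ?_
  filter_upwards [self_mem_nhdsWithin] with x hx
  exact le_of_lt (lt_of_not_ge fun h => absurd (csInf_le hbdd h) (not_le.2 hx))

lemma gaussian_abs_le_normalQuantile {a : ℝ} (h0 : 0 < a) (h1 : a < 1) :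
    (gaussianReal 0 1).real {x | |x| ≤ normalQuantile (1 - a / 2)} = 1 - a := by
  set N := gaussianReal 0 1
  set z := normalQuantile (1 - a / 2)
  have hz : N.real (Set.Iic z) = 1 - a / 2 := by
    rw [← cdf_eq_real]; exact cdf_normalQuantile (by linarith) (by linarith)
  have hz' : N.real (Set.Iio (-z)) = a / 2 := by
    have h : N.real (Set.Iio (-z)) = N.real (Set.Iic z)ᶜ := by
      have hN : N.map (fun x => -x) = N := by
        have := gaussianReal_map_neg (μ := 0) (v := 1)
        rwa [neg_zero] at this
      calc N.real (Set.Iio (-z)) = (N.map fun x => -x).real (Set.Iio (-z)) := by rw [hN]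
        _ = _ := by
          rw [map_measureReal_apply measurable_neg measurableSet_Iio]
          congr 1; ext x; simp
    rw [h, probReal_compl_eq_one_sub measurableSet_Iic, hz]; ring
  -- A negative z would put (−∞, z] inside (−∞, −z), forcing 1 − a/2 ≤ a/2 against a < 1.
  have hz0 : 0 ≤ z := by
    by_contra! h
    have : N.real (Set.Iic z) ≤ N.real (Set.Iio (-z)) :=
      measureReal_mono fun x (hx : x ≤ z) => show x < -z by linarith
    linarith
  have hsub : Set.Iio (-z) ⊆ Set.Iic z := fun x (hx : x < -z) => show x ≤ z by linarith
  have hset : {x | |x| ≤ z} = Set.Iic z \ Set.Iio (-z) := by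
    ext x
    simp [abs_le, and_comm]
  rw [hset, measureReal_sdiff hsub measurableSet_Iio,
    hz, hz']
  ring

end Quantile

/-! ### Studentized statistics and coverage -/

section ConfInterval

variable {Ω : Type*} [MeasurableSpace Ω] {P : Measure Ω} [IsProbabilityMeasure P]

/-- Coverage becomes the event that a continuous function of slope error and variance estimate is
nonpositive, the form suited to continuous mapping and the portmanteau theorem. -/
lemma mem_olsConfInterval_iff {n : ℕ} (hn : 0 < n) {a β : ℝ} {x y : Fin n → ℝ} :
    β ∈ olsConfInterval a x y ↔
      |√n * (olsSlope x y - β)| - normalQuantile (1 - a / 2) * √(ehwVariance x y) ≤ 0 := by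
  have hs : 0 < √(n : ℝ) := Real.sqrt_pos.2 (by exact_mod_cast hn)
  rw [olsConfInterval, Real.sqrt_div' _ (Nat.cast_nonneg n), abs_mul, abs_of_pos hs, sub_nonpos,
    ← le_div_iff₀' hs, abs_le, Set.mem_Icc, mul_div_assoc]
  constructor <;> rintro ⟨h, h'⟩ <;> constructor <;> linarith

/-- Coverage of a studentized statistic whose numerator is asymptotically normal. -/
lemma tendsto_coverage {T D : ℕ → Ω → ℝ} {c a : ℝ} (hc : 0 < c) (h0 : 0 < a) (h1 : a < 1)
    (hT : TendstoInDistribution T atTop (fun x : ℝ => c * x) (fun _ => P) (gaussianReal 0 1))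
    (hD : TendstoInMeasure P D atTop (fun _ => c ^ 2)) (mD : ∀ n, AEMeasurable (D n) P) :
    Tendsto (fun n => P.real {ω | |T n ω| - normalQuantile (1 - a / 2) * √(D n ω) ≤ 0})
      atTop (𝓝 (1 - a)) := by
  set z := normalQuantile (1 - a / 2) with hz
  -- Slutsky's lemma: joint convergence with a constant limit in one coordinate, followed by a
  -- continuous map.
  have hlim := hT.continuous_comp_prodMk_of_tendstoInMeasure_const
    (g := fun q : ℝ × ℝ => |q.1| - z * √q.2) (by fun_prop) hD mD
  have hset : (fun x : ℝ => |c * x| - z * √(c ^ 2)) ⁻¹' Set.Iic 0 = {x | |x| ≤ z} := by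
    ext x
    simp only [Set.mem_preimage, Set.mem_Iic, Set.mem_ofPred_eq]
    rw [Real.sqrt_sq hc.le, abs_mul, abs_of_pos hc, sub_nonpos, mul_comm z, mul_le_mul_iff_right₀ hc]
  have : NullSingletonClass (gaussianReal 0 1) := nullSingletonClass_gaussianReal one_ne_zero
  -- The limit variable equals zero only at ±z, and finite sets are null for the Gaussian law.
  have hnull : ((gaussianReal 0 1).map (fun x : ℝ => |c * x| - z * √(c ^ 2)))
      (frontier (Set.Iic 0)) = 0 := by
    rw [frontier_Iic, Measure.map_apply (by fun_prop) (measurableSet_singleton 0)]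
    refine measure_mono_null (t := {z, -z}) ?_ ((Set.toFinite _).measure_zero _)
    intro x hx
    rw [Set.mem_preimage, Set.mem_singleton_iff, Real.sqrt_sq hc.le, abs_mul, abs_of_pos hc,
      sub_eq_zero, mul_comm z] at hx
    have := mul_left_cancel₀ hc.ne' hx
    rcases abs_choice x with h | h
    · left; linarith
    · right; rw [Set.mem_singleton_iff]; linarith
  have h := ProbabilityMeasure.tendsto_measure_of_null_frontier_of_tendsto' hlim.tendsto hnull
  simp only [ProbabilityMeasure.coe_mk] at h
  rw [Measure.map_apply (by fun_prop) measurableSet_Iic, hset] at h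
  have h' := (ENNReal.tendsto_toReal (measure_ne_top _ _)).comp h
  rw [show ((gaussianReal 0 1) {x | |x| ≤ z}).toReal = 1 - a from
    gaussian_abs_le_normalQuantile h0 h1] at h'
  refine h'.congr fun n => ?_
  rw [Function.comp_apply, Measure.map_apply_of_aemeasurable (hlim.forall_aemeasurable n)
    measurableSet_Iic]
  rfl

end ConfInterval

/-! ### Central limit theorem for the rows -/

section CentralLimit

variable {Ω : Type*} [MeasurableSpace Ω] {P : Measure Ω} [IsProbabilityMeasure P]
  {E : Type*} [MeasurableSpace E] {Q : Measure E} [IsProbabilityMeasure Q]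

/-- The central limit theorem for the rows of a triangular array with independent entries of a
fixed law. -/
lemma tendstoInDistribution_sqrt_mul_sampleMean {Z : (n : ℕ) → Fin n → Ω → E}
    (mZ : ∀ n i, Measurable (Z n i)) (hZ : ∀ n i, P.map (Z n i) = Q)
    (hi : ∀ n, iIndepFun (Z n) P) {φ : E → ℝ} (hφ : Measurable φ) {τ : ℝ} (hτ : 0 < τ)
    (h0 : ∫ z, φ z ∂Q = 0) (h2 : ∫ z, φ z ^ 2 ∂Q = τ) :
    TendstoInDistribution (fun (n : ℕ) ω => √n * sampleMean fun i => φ (Z n i ω)) atTop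
      (fun x : ℝ => √τ * x) (fun _ => P) (gaussianReal 0 1) := by
  have hs : √τ ≠ 0 := (Real.sqrt_pos.2 hτ).ne'
  have mS : ∀ n, Measurable fun ω => ∑ i : Fin n, φ (Z n i ω) / √τ := fun n =>
    Finset.measurable_sum _ fun i _ => (hφ.comp (mZ n i)).div_const _
  have hstd : TendstoInDistribution (fun (n : ℕ) ω => (√n)⁻¹ * ∑ i : Fin n, φ (Z n i ω) / √τ) atTop
      (fun x : ℝ => x) (fun _ => P) (gaussianReal 0 1) := by
    refine ⟨fun n => ((mS n).const_mul _).aemeasurable, aemeasurable_id, ?_⟩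
    refine ProbabilityMeasure.tendsto_iff_tendsto_charFun.2 fun t => ?_
    have hlim := tendsto_charFun_inv_sqrt_mul_pow (P := Q) (X := fun z => φ z / √τ)
      (hφ.div_const _).aemeasurable (by rw [integral_div, h0, zero_div])
      (by
        simp only [Pi.pow_apply, div_pow]
        rw [integral_div, h2, Real.sq_sqrt hτ.le, div_self hτ.ne']) t
    -- The law of an entry is the same in every row, so the characteristic function of a row sum is
    -- the n-th power of one fixed function, as for a single i.i.d. sequence.
    have hchar : ∀ n : ℕ, charFun (P.map fun ω => (√n)⁻¹ * ∑ i : Fin n, φ (Z n i ω) / √τ) t =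
        charFun (Q.map fun z => φ z / √τ) ((√n)⁻¹ * t) ^ n := by
      intro n
      have hprod := ((hi n).comp (fun _ z => φ z / √τ)
        fun _ => hφ.div_const _).charFun_map_fun_sum_eq_prod
        fun i => ((hφ.div_const _).comp (mZ n i)).aemeasurable
      rw [charFun_map_mul_comp (mS n).aemeasurable]
      refine (congrFun hprod _).trans ?_
      have : ∀ i : Fin n, P.map ((fun z => φ z / √τ) ∘ Z n i) = Q.map fun z => φ z / √τ :=
        fun i => by rw [← Measure.map_map (hφ.div_const _) (mZ n i), hZ]
      simp only [this]
      simp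
    simp only [ProbabilityMeasure.coe_mk, hchar, Measure.map_id']
    simpa [charFun_gaussianReal, neg_div] using hlim
  have h := hstd.continuous_comp (g := fun x => √τ * x) (by fun_prop)
  refine h.congr (fun n => Eventually.of_forall fun ω => ?_) (Eventually.of_forall fun _ => rfl)
  simp only [Function.comp_apply, sampleMean]
  rw [← Finset.sum_div]
  rcases Nat.eq_zero_or_pos n with rfl | hn
  · simp
  · have hn' : (0 : ℝ) < n := by exact_mod_cast hn
    have hsn : √(n : ℝ) ≠ 0 := (Real.sqrt_pos.2 hn').ne'
    field_simp
    rw [Real.sq_sqrt hn'.le, mul_comm]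

end CentralLimit

/-! ### Measurability of the estimators -/

section Measurability

variable {Ω : Type*} [MeasurableSpace Ω] {n : ℕ}

lemma measurable_sampleMean {x : Ω → Fin n → ℝ} (hx : ∀ i, Measurable fun ω => x ω i) :
    Measurable fun ω => sampleMean (x ω) :=
  (Finset.measurable_sum _ fun i _ => hx i).div_const _

lemma measurable_olsSlope {x y : Ω → Fin n → ℝ} (hx : ∀ i, Measurable fun ω => x ω i)
    (hy : ∀ i, Measurable fun ω => y ω i) : Measurable fun ω => olsSlope (x ω) (y ω) := by
  have := measurable_sampleMean hx
  have := measurable_sampleMean hy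
  unfold olsSlope
  fun_prop

lemma measurable_ehwVariance {x y : Ω → Fin n → ℝ} (hx : ∀ i, Measurable fun ω => x ω i)
    (hy : ∀ i, Measurable fun ω => y ω i) : Measurable fun ω => ehwVariance (x ω) (y ω) := by
  have := measurable_sampleMean hx
  have := measurable_sampleMean hy
  have := measurable_olsSlope hx hy
  unfold ehwVariance olsResidual olsIntercept
  fun_prop

/-- Handles statistics with a random number of measurements: the count takes countably many values,
so it may be frozen. -/
lemma measurable_comp_count {E : Type*} [MeasurableSpace E] {f : ℕ → E → ℝ}
    (hf : ∀ k, Measurable (f k)) {N : Ω → ℕ} {Z : Ω → E} (hN : Measurable N) (hZ : Measurable Z) :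
    Measurable fun ω => f (N ω) (Z ω) :=
  (measurable_from_prod_countable_right (f := Function.uncurry f) hf).comp (hN.prodMk hZ)

variable {P : Measure Ω} {Z : (n : ℕ) → Fin n → Ω → Latent} {J : (n : ℕ) → Fin n → Ω → ℕ}
  {Q : Measure Latent} {R : ℕ → Measure ℕ}

lemma measurable_X (j : ℕ) : Measurable fun z : Latent => z.X j := by
  unfold Latent.X Latent.theta Latent.eps
  fun_prop

lemma IsRandomSample.measurable_regressorHE (hs : IsRandomSample P Z J Q R) (n : ℕ) (i : Fin n) :
    Measurable fun ω => regressorHE Z J n ω i := by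
  have mX := measurable_X
  have h1 : ∀ k, Measurable fun z : Latent => unitMean k z.X := fun k => by
    unfold unitMean
    fun_prop
  have h2 : ∀ k, Measurable fun z : Latent => unitVar k z.X := fun k => by
    have := h1 k
    unfold unitVar
    fun_prop
  have m1 : ∀ i, Measurable fun ω => unitMean (J n i ω) (Z n i ω).X := fun i =>
    measurable_comp_count h1 (hs.measurable_J n i) (hs.measurable_latent n i)
  have m2 : ∀ i, Measurable fun ω => unitVar (J n i ω) (Z n i ω).X := fun i =>
    measurable_comp_count h2 (hs.measurable_J n i) (hs.measurable_latent n i)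
  have m3 : ∀ i, Measurable fun ω => (1 / (J n i ω : ℝ)) := fun i =>
    measurable_from_top.comp (g := fun m : ℕ => 1 / (m : ℝ)) (hs.measurable_J n i)
  have m4 : Measurable fun ω => grandMean (fun i => J n i ω) fun i => (Z n i ω).X :=
    measurable_sampleMean m1
  have m5 : Measurable fun ω => VHat (fun i => J n i ω) fun i => (Z n i ω).X := by
    unfold VHat
    fun_prop
  unfold regressorHE thetaHE weightHE
  fun_prop

lemma IsRandomSample.measurable_outcome (hs : IsRandomSample P Z J Q R) (α β : ℝ) (n : ℕ)
    (i : Fin n) : Measurable fun ω => outcome α β Z n ω i := by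
  have := hs.measurable_latent n i
  unfold outcome Latent.Y Latent.theta Latent.u
  fun_prop

end Measurability

/-! ### Asymptotic normality of the slope and coverage -/

section Studentization

variable {Ω : Type*} [MeasurableSpace Ω] {P : Measure Ω} [IsProbabilityMeasure P]
  {Z : (n : ℕ) → Fin n → Ω → Latent} {J : (n : ℕ) → Fin n → Ω → ℕ}
  {Q : Measure Latent} [IsProbabilityMeasure Q] {R : ℕ → Measure ℕ} {α β κ μ V τ : ℝ}

lemma tendstoInDistribution_score (hs : IsRandomSample P Z J Q R) (hM : EffectMoments Q μ V τ)
    (hτ : 0 < τ) :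
    TendstoInDistribution (fun (n : ℕ) ω => √n * sampleMean fun i : Fin n =>
        sampleEffects Z μ (n, ω) i * sampleErrors Z (n, ω) i) atTop
      (fun x : ℝ => √τ * x) (fun _ => P) (gaussianReal 0 1) := by
  have mφ : Measurable fun z : Latent => (z.theta - μ) * z.u :=
    (Latent.measurable_theta.sub_const μ).mul Latent.measurable_u
  have hi : ∀ n, iIndepFun (Z n) P := fun n =>
    (hs.indep_units n).comp (fun _ p => p.1) fun _ => measurable_fst
  exact tendstoInDistribution_sqrt_mul_sampleMean hs.measurable_latent hs.law_latent hi mφ hτ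
    hM.mean_tu hM.var_tu

/-- The scaled slope error differs from √n times the average of t u, divided by V, by a null
sequence, so Slutsky's lemma transfers the limit law. -/
lemma tendstoInDistribution_slope (hs : IsRandomSample P Z J Q R)
    (h1 : Assumption1 P Z J Q R α β κ) (hM : EffectMoments Q μ V τ) (hV : 0 < V) (hτ : 0 < τ) :
    TendstoInDistribution (fun (n : ℕ) ω =>
        √n * (olsSlope (regressorHE Z J n ω) (outcome α β Z n ω) - β)) atTop
      (fun x : ℝ => √τ / V * x) (fun _ => P) (gaussianReal 0 1) := by
  have h := (tendstoInDistribution_score hs hM hτ).continuous_comp (g := fun x => x / V)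
    (by fun_prop)
  refine tendstoInDistribution_of_tendstoInMeasure_sub _ _ (h.congr
    (fun _ => Eventually.of_forall fun _ => rfl)
    (Eventually.of_forall fun x => mul_div_right_comm _ _ _))
    (tendstoInMeasure_iff_whp.2 (regression_limits hs h1 hM hV).2) fun n => ?_
  exact (((measurable_olsSlope (hs.measurable_regressorHE n)
    (hs.measurable_outcome α β n)).sub_const _).const_mul _).aemeasurable

lemma tendsto_confInterval_coverage (hs : IsRandomSample P Z J Q R)
    (h1 : Assumption1 P Z J Q R α β κ) (hM : EffectMoments Q μ V τ) (hV : 0 < V) (hτ : 0 < τ)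
    {a : ℝ} (ha0 : 0 < a) (ha1 : a < 1) :
    Tendsto (fun n => P.real {ω | β ∈ olsConfInterval a (regressorHE Z J n ω)
      (outcome α β Z n ω)}) atTop (𝓝 (1 - a)) := by
  have hΩ : TendstoInMeasure P
      (fun n ω => ehwVariance (regressorHE Z J n ω) (outcome α β Z n ω)) atTop
      (fun _ => (√τ / V) ^ 2) := by
    rw [div_pow, Real.sq_sqrt hτ.le]
    exact tendstoInMeasure_iff_whp.2 (regression_limits hs h1 hM hV).1
  have h := tendsto_coverage (div_pos (Real.sqrt_pos.2 hτ) hV) ha0 ha1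
    (tendstoInDistribution_slope hs h1 hM hV hτ) hΩ fun n =>
      (measurable_ehwVariance (hs.measurable_regressorHE n)
        (hs.measurable_outcome α β n)).aemeasurable
  refine h.congr' ?_
  filter_upwards [eventually_gt_atTop 0] with n hn
  simp only [mem_olsConfInterval_iff hn]

end Studentization

end Shrinkage

end

theorem mainTheorem2 {Ω : Type*} [MeasurableSpace Ω] (P : Measure Ω) [IsProbabilityMeasure P]
    (Z : (n : ℕ) → Fin n → Ω → Shrinkage.Latent) (J : (n : ℕ) → Fin n → Ω → ℕ)
    (Q : Measure Shrinkage.Latent) [IsProbabilityMeasure Q] (R : ℕ → Measure ℕ) (α β κ : ℝ)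
    (hsample : Shrinkage.IsRandomSample P Z J Q R)
    (h1 : Shrinkage.Assumption1 P Z J Q R α β κ)
    (h2 : Shrinkage.Assumption2 Q)
    (hV : 0 < Var[Shrinkage.Latent.theta; Q]) :
    TendstoInMeasure P
      (fun n ω => Shrinkage.ehwVariance (Shrinkage.regressorHE Z J n ω)
        (Shrinkage.outcome α β Z n ω))
      atTop
      (fun _ => Shrinkage.scoreVariance Q / Var[Shrinkage.Latent.theta; Q] ^ 2) ∧
    (0 < Shrinkage.scoreVariance Q → ∀ a : ℝ, 0 < a → a < 1 →
      Tendsto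
        (fun n => P.real {ω | β ∈ Shrinkage.olsConfInterval a (Shrinkage.regressorHE Z J n ω)
          (Shrinkage.outcome α β Z n ω)})
        atTop (𝓝 (1 - a))) := by
  have hM := Shrinkage.effectMoments h1 h2
  exact ⟨Shrinkage.tendstoInMeasure_iff_whp.2
      (Shrinkage.regression_limits hsample h1 hM hV).1,
    fun hτ _ ha0 ha1 => Shrinkage.tendsto_confInterval_coverage hsample h1 hM hV hτ ha0 ha1⟩
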